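/- Setting. Let $d,b\ge 1$ and let $\Omega\subseteq\mathbb R^d$ be open with a conforming, locally finite simplicial mesh $\mathcal T$ satisfying $h_K\le\gamma\rho_K$ for every element $K$ ($h_K$ the diameter of $K$, $\rho_K$ the diameter of a ball inscribed in $K$). For $\Omega=\mathbb R^d$ the mesh may be infinite, which covers periodic boundary conditions. Consider $\partial_t(\mathcal G u)+\sum_j\partial_j(\mathcal L^{(j)}u)=0$, $u\in\mathbb R^b$, where $\mathcal G,\mathcal L^{(j)}:\Omega\to\mathbb R^{b\times b}$ are symmetric, have entries bounded by $B$, and are constant on each mesh element, $\mathcal G\ge g_0 I$ with $g_0>0$, $\sum_j\partial_j\mathcal L^{(j)}=0$ in the sense of distributions, and all characteristic speeds (the absolute values of the eigenvalues of $\mathcal G^{-1}\sum_j\nu_j\mathcal L^{(j)}$, $|\nu|=1$) are at most $c_0<c_{\max}$. Write $g(u)=\mathcal Gu$, $f(u)=[\mathcal L^{(1)}u,\dots,\mathcal L^{(d)}u]$, $\mathcal D=\sum_j\nu_j\mathcal L^{(j)}$. On each mesh facet let $S$ be a constant symmetric matrix with entries bounded by $B$ and $S\ge\sigma_0I$, $\sigma_0>0$.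 Let $\mathrm v\in\Omega$ be a mesh vertex, $\Omega^{\mathrm v}$ its patch (the union of the elements having $\mathrm v$ as a vertex), and $\varphi_{\rm bot}\le\varphi_{\rm top}$ continuous functions on $\Omega^{\mathrm v}$, affine on each element, whose nodal values agree at all vertices of the patch except possibly $\mathrm v$, with $|\nabla\varphi_{\rm bot}|,|\nabla\varphi_{\rm top}|<1/c_{\max}$ on each element. Put $\delta=\varphi_{\rm top}-\varphi_{\rm bot}$. Let $V_h$ be the space of $\mathbb R^b$-valued functions constant on each element of the patch (DG with $p=0$), $(\cdot,\cdot)$ the $L^2(\Omega^{\mathrm v})$ inner product, and define $M_0,M_1,A:V_h\to V_h$ by $$(M_0u,w)=(g(u)-f(u)\nabla\varphi_{\rm bot},w),\qquad (M_1u,w)=(f(u)\nabla\delta,w),$$ $$(Au,w)=(\delta f(u),\nabla w)+\int_{\mathcal F^{\mathrm v}}\delta\,\big(\mathcal D\{u\}-S[\![u]\!]\big)\cdot[\![w]\!],$$ where $\nabla w$ is taken element by element (so that the first term is $0$ here), $\mathcal F^{\mathrm v}$ is the set of facets of the patch with unit normals $\nu$, $[\![w]\!]$ is the jump of $w$ in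 the direction $\nu$ and $\{u\}$ the average. Let $M(\hat t)=M_0-\hat tM_1$ and $\|v\|_Q=(Qv,v)^{1/2}$. For integers $s,r\ge1$ let $\tau=1/r$ and, for $l=1,\dots,r$, $M_0^{[l]}=M_0-(l-1)\tau M_1$, $M^{[l]}=M_0^{[l]}-\tau M_1$, $X_0^{[l]}=I$, $X_i^{[l]}=\tau (M_0^{[l]})^{-1}(A+iM_1)X_{i-1}^{[l]}$, and $$R_{[l],s}=\sum_{k=0}^{s-1}\frac1{k!}X_k^{[l]}+\frac1{s!}(M^{[l]})^{-1}M_0^{[l]}X_s^{[l]},\qquad R_{r,s}=R_{[r],s}\circ\cdots\circ R_{[1],s}.$$ Theorem. For every SAT order $s\ge1$ there are constants $\tau_0>0$ and $C>0$, depending only on $s,d,b,\gamma,g_0,B,\sigma_0,c_0,c_{\max}$ (in particular independent of the mesh size, the mesh, the tent and $r$), such that in the above setting: (i) if $\tau=1/r\le\tau_0$, then $\|R_{r,s}v\|_{M(1)}\le\|v\|_{M_0}$ for all $v\in V_h$; (ii) the SAT-DG0 scheme is strongly stable under the usual CFL condition: if the physical time step $\Delta t=\tau\max_{\Omega^{\mathrm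 v}}\delta$ satisfies $\Delta t\le C h_{\mathrm v}$, where $h_{\mathrm v}$ is the smallest diameter of an element of the patch (comparable to the global mesh size on quasi-uniform meshes), then $\|R_{r,s}v\|_{M(1)}\le\|v\|_{M_0}$ for all $v\in V_h$. -/

import Mathlib

open MeasureTheory Set
open scoped Matrix ContDiff

namespace TentDG

noncomputable section

/-- The Euclidean space `ℝ^d`. -/
abbrev E (d : ℕ) : Type := EuclideanSpace ℝ (Fin d)

/-- The closed simplex spanned by a finite set of vertices. -/
def hull {d : ℕ} (K : Finset (E d)) : Set (E d) := convexHull ℝ (K : Set (E d))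

/-- A conforming simplicial mesh of the set `Ω`: a (geometric, locally finite) simplicial complex,
pure of dimension `d`, that covers the closure of `Ω` and whose elements lie in `Ω` up to their
boundary. Bounded domains have finite meshes; a periodic mesh is a mesh of `Ω = ℝ^d`. -/
structure SimplicialMesh (d : ℕ) (Ω : Set (E d)) extends
    Geometry.SimplicialComplex ℝ (E d) where
  pure : ∀ s ∈ faces, ∃ K ∈ faces, s ⊆ K ∧ K.card = d + 1
  locallyFinite : LocallyFinite (fun s : faces => hull (s : Finset (E d)))
  space_eq : (⋃ s ∈ faces, hull s) = closure Ω
  interior_subset : ∀ K ∈ faces, interior (hull K) ⊆ Ω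

variable {d b : ℕ} {Ω : Set (E d)}

/-- The mesh elements: the `d`-simplices of the mesh. -/
def SimplicialMesh.elements (T : SimplicialMesh d Ω) : Set (Finset (E d)) :=
  {K | K ∈ T.faces ∧ K.card = d + 1}

/-- Shape regularity with constant `γ`: `h_K ≤ γ ρ_K`, where `h_K` is the diameter of `K` and
`ρ_K` the diameter of a ball inscribed in `K`. -/
def SimplicialMesh.ShapeRegular (T : SimplicialMesh d Ω) (γ : ℝ) : Prop :=
  ∀ K ∈ T.elements, ∃ (c : E d) (ρ : ℝ), 0 < ρ ∧
    Metric.ball c (ρ / 2) ⊆ hull K ∧ Metric.diam (hull K) ≤ γ * ρ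

theorem SimplicialMesh.finite_patch (T : SimplicialMesh d Ω) (v : E d) :
    {K | K ∈ T.elements ∧ v ∈ K}.Finite := by
  have h := (T.locallyFinite.point_finite v).image (Subtype.val)
  refine h.subset ?_
  rintro K ⟨hK, hv⟩
  exact ⟨⟨K, hK.1⟩, subset_convexHull ℝ _ hv, rfl⟩

/-- The vertex patch `Ω^v`: all mesh elements that have `v` as a vertex. -/
def SimplicialMesh.patch (T : SimplicialMesh d Ω) (v : E d) : Finset (Finset (E d)) :=
  (T.finite_patch v).toFinset

/-- The linear combination `𝒟_ν = ∑_j ν_j ℒ^{(j)}(x)`. -/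
def normalMatrix (L : Fin d → E d → Matrix (Fin b) (Fin b) ℝ) (ν x : E d) :
    Matrix (Fin b) (Fin b) ℝ := ∑ j, ν j • L j x

/-- The flux `f(u)` at `x`: the `b × d` matrix with entries `∑_k ℒ^{(j)}_{lk}(x) u_k`. -/
def flux (L : Fin d → E d → Matrix (Fin b) (Fin b) ℝ) (x : E d) (u : Fin b → ℝ) :
    Matrix (Fin b) (Fin d) ℝ := Matrix.of fun l j => (L j x *ᵥ u) l

/-- Standing assumptions on the coefficients of the symmetric hyperbolic system
`∂_t (𝒢 u) + ∑_j ∂_j (ℒ^{(j)} u) = 0` on `Ω`: symmetric, bounded (by `B`), `𝒢` uniformly positive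
definite (with constant `g₀`), `∑_j ∂_j ℒ^{(j)} = 0` in the sense of distributions, and all
characteristic speeds (the eigenvalues of `𝒢⁻¹ 𝒟_ν` for unit vectors `ν`) at most `c₀`. -/
structure IsSymmetricHyperbolic (Ω : Set (E d)) (G : E d → Matrix (Fin b) (Fin b) ℝ)
    (L : Fin d → E d → Matrix (Fin b) (Fin b) ℝ) (g₀ B c₀ : ℝ) : Prop where
  symm_G : ∀ x ∈ Ω, (G x).IsSymm
  symm_L : ∀ j, ∀ x ∈ Ω, (L j x).IsSymm
  bound_G : ∀ x ∈ Ω, ∀ i k, |G x i k| ≤ B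
  bound_L : ∀ j, ∀ x ∈ Ω, ∀ i k, |L j x i k| ≤ B
  posDef_G : ∀ x ∈ Ω, ∀ u : Fin b → ℝ, g₀ * (u ⬝ᵥ u) ≤ (G x *ᵥ u) ⬝ᵥ u
  div_L : ∀ i k, ∀ ψ : E d → ℝ, ContDiff ℝ ∞ ψ → HasCompactSupport ψ → tsupport ψ ⊆ Ω →
    ∫ x in Ω, ∑ j, L j x i k * fderiv ℝ ψ x (EuclideanSpace.single j 1) = 0
  speed : ∀ x ∈ Ω, ∀ ν : E d, ‖ν‖ = 1 → ∀ (μ : ℝ) (w : Fin b → ℝ), w ≠ 0 →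
    normalMatrix L ν x *ᵥ w = μ • (G x *ᵥ w) → |μ| ≤ c₀

/-- The coefficients are constant on (the interior of) each mesh element. -/
def IsElementwiseConstant (T : SimplicialMesh d Ω) (G : E d → Matrix (Fin b) (Fin b) ℝ)
    (L : Fin d → E d → Matrix (Fin b) (Fin b) ℝ) : Prop :=
  ∀ K ∈ T.elements, ∀ x ∈ interior (hull K), ∀ y ∈ interior (hull K),
    G x = G y ∧ ∀ j, L j x = L j y

/-- For every facet `F` of the mesh a constant symmetric positive definite stabilization matrix
`S F`, with uniform lower bound `σ₀` and upper bound `B`. -/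
structure IsStabilization (T : SimplicialMesh d Ω) (S : Finset (E d) → Matrix (Fin b) (Fin b) ℝ)
    (σ₀ B : ℝ) : Prop where
  symm : ∀ F ∈ T.faces, F.card = d → (S F).IsSymm
  bound : ∀ F ∈ T.faces, F.card = d → ∀ i k, |S F i k| ≤ B
  posDef : ∀ F ∈ T.faces, F.card = d → ∀ u : Fin b → ℝ, σ₀ * (u ⬝ᵥ u) ≤ (S F *ᵥ u) ⬝ᵥ u

/-- A tent erected over the interior mesh vertex `v` between the (restrictions to the vertex patch
of the) advancing fronts `φbot ≤ φtop`. Both are continuous and piecewise linear, both satisfy the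
causality condition, and they differ only by their nodal value at `v`. -/
structure IsTent (T : SimplicialMesh d Ω) (v : E d) (cmax : ℝ) (φbot φtop : E d → ℝ) : Prop where
  vertex : {v} ∈ T.faces
  mem : v ∈ Ω
  affine_bot : ∀ K ∈ T.patch v, ∃ a : E d →ᵃ[ℝ] ℝ, ∀ x ∈ hull K, φbot x = a x
  affine_top : ∀ K ∈ T.patch v, ∃ a : E d →ᵃ[ℝ] ℝ, ∀ x ∈ hull K, φtop x = a x
  pole : φbot v ≤ φtop v
  boundary : ∀ K ∈ T.patch v, ∀ w ∈ K, w ≠ v → φtop w = φbot w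
  causal_bot : ∀ K ∈ T.patch v, ∀ x ∈ interior (hull K), ‖gradient φbot x‖ < 1 / cmax
  causal_top : ∀ K ∈ T.patch v, ∀ x ∈ interior (hull K), ‖gradient φtop x‖ < 1 / cmax

/-- Vector-valued functions on the patch that are defined element by element; on a facet of `K`
the trace from `K` is the value of the `K`-component. -/
abbrev Broken (T : SimplicialMesh d Ω) (v : E d) (b : ℕ) : Type :=
  T.patch v → E d → Fin b → ℝ

/-- The piecewise constant (`p = 0`) discontinuous Galerkin space `V_h` on the patch. -/
abbrev DG0 (T : SimplicialMesh d Ω) (v : E d) (b : ℕ) : Type :=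
  T.patch v → Fin b → ℝ

/-- An element of `V_h` as a function on the patch. -/
def DG0.toBroken {T : SimplicialMesh d Ω} {v : E d} (u : DG0 T v b) : Broken T v b :=
  fun K _ => u K

/-- `(u, w) = ∑_K ∫_K u · w dx`. -/
def l2Form {T : SimplicialMesh d Ω} {v : E d} (u w : Broken T v b) : ℝ :=
  ∑ K : T.patch v, ∫ x in hull K.1, u K x ⬝ᵥ w K x

/-- `(g(u) - f(u) grad φbot, w)`. -/
def massForm0 {T : SimplicialMesh d Ω} {v : E d} (G : E d → Matrix (Fin b) (Fin b) ℝ)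
    (L : Fin d → E d → Matrix (Fin b) (Fin b) ℝ) (φbot : E d → ℝ) (u w : Broken T v b) : ℝ :=
  ∑ K : T.patch v, ∫ x in hull K.1,
    (G x *ᵥ u K x - flux L x (u K x) *ᵥ (fun j => gradient φbot x j)) ⬝ᵥ w K x

/-- `(f(u) grad δ, w)`. -/
def massForm1 {T : SimplicialMesh d Ω} {v : E d}
    (L : Fin d → E d → Matrix (Fin b) (Fin b) ℝ) (δ : E d → ℝ) (u w : Broken T v b) : ℝ :=
  ∑ K : T.patch v, ∫ x in hull K.1,
    (flux L x (u K x) *ᵥ (fun j => gradient δ x j)) ⬝ᵥ w K x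

/-- `ν` is the unit normal of the facet `K ∩ K'` that points out of `K`. -/
def IsFacetNormal (K K' : Finset (E d)) (ν : E d) : Prop :=
  ‖ν‖ = 1 ∧ (∀ x, x ∈ K → x ∈ K' → ∀ y, y ∈ K → y ∈ K' → inner ℝ ν (y - x) = 0) ∧
    ∀ x, x ∈ K → x ∈ K' → ∀ z ∈ K, inner ℝ ν (z - x) ≤ 0

/-- The unit normal of the common facet of `K` and `K'` that points from `K` to `K'`. -/
def facetNormal (K K' : Finset (E d)) : E d := Classical.epsilon (IsFacetNormal K K')

open Classical in
/-- The common facet of `K` and `K'`. -/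
def facet (K K' : Finset (E d)) : Finset (E d) := K ∩ K'

/-- The barycenter of a simplex. For coefficients that are constant in the interior of `K`, the
value at the barycenter is the value on `K`, hence the trace from `K` on every facet of `K`. -/
def barycenter (K : Finset (E d)) : E d := (K.card : ℝ)⁻¹ • ∑ x ∈ K, x

/-- The numerical flux `𝒟 {u} - S ⟦u⟧` at a point `x` of the facet between `K` and `K'`, with the
normal pointing from `K` to `K'`, so that `⟦u⟧ = u|_{K'} - u|_K`. -/
def numericalFlux {T : SimplicialMesh d Ω} {v : E d}
    (L : Fin d → E d → Matrix (Fin b) (Fin b) ℝ) (S : Finset (E d) → Matrix (Fin b) (Fin b) ℝ)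
    (u : Broken T v b) (K K' : T.patch v) (x : E d) : Fin b → ℝ :=
  normalMatrix L (facetNormal K.1 K'.1) (barycenter K.1) *ᵥ
      ((1 / 2 : ℝ) • (u K' x + u K x)) -
    S (facet K.1 K'.1) *ᵥ (u K' x - u K x)

open Classical in
/-- `(δ f(u), grad w) + (δ F̂^ν, ⟦w⟧)_ℱ`. The facet term does not depend on the direction of the
normal, and `δ` vanishes on the facets on the boundary of the patch; so the sum over facets is one
half of the sum over ordered pairs of elements of the patch that share a facet. -/
def dgForm {T : SimplicialMesh d Ω} {v : E d} (L : Fin d → E d → Matrix (Fin b) (Fin b) ℝ)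
    (S : Finset (E d) → Matrix (Fin b) (Fin b) ℝ) (δ : E d → ℝ) (u w : Broken T v b) : ℝ :=
  (∑ K : T.patch v, ∫ x in hull K.1, δ x * ∑ l, ∑ j,
      flux L x (u K x) l j * fderiv ℝ (fun y => w K y l) x (EuclideanSpace.single j 1)) +
  (1 / 2) * ∑ K : T.patch v, ∑ K' : T.patch v,
    if (facet K.1 K'.1).card = d then
      ∫ x in hull (facet K.1 K'.1),
        δ x * (numericalFlux L S u K K' x ⬝ᵥ (w K' x - w K x))
          ∂(Measure.euclideanHausdorffMeasure (d - 1))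
    else 0

/-- The `L²` inner product on `V_h`. -/
def ip {T : SimplicialMesh d Ω} {v : E d} (u w : DG0 T v b) : ℝ := l2Form u.toBroken w.toBroken

open Classical in
/-- The operator `Q : V_h → V_h` with `(Q u, w) = a(u, w)` for all `u, w ∈ V_h`; it exists and is
unique for every bilinear `a`, see `existsUnique_repr`. -/
def formOperator {T : SimplicialMesh d Ω} {v : E d} (a : Broken T v b → Broken T v b → ℝ) :
    Module.End ℝ (DG0 T v b) :=
  if h : ∃ Q : Module.End ℝ (DG0 T v b), ∀ u w, ip (Q u) w = a u.toBroken w.toBroken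
  then h.choose else 0

theorem ip_eq {T : SimplicialMesh d Ω} {v : E d} (u w : DG0 T v b) :
    ip u w = ∑ K : T.patch v, (volume (hull K.1)).toReal * (u K ⬝ᵥ w K) := by
  simp [ip, l2Form, DG0.toBroken, Measure.real]

theorem volume_pos (T : SimplicialMesh d Ω) {v : E d} (K : T.patch v) :
    0 < (volume (hull K.1)).toReal := by
  have hK : K.1 ∈ T.elements := ((T.finite_patch v).mem_toFinset.1 K.2).1
  have hne : (interior (hull K.1)).Nonempty := by
    unfold hull
    rw [interior_convexHull_nonempty_iff_affineSpan_eq_top]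
    have hi := T.indep hK.1
    have := hi.affineSpan_eq_top_iff_card_eq_finrank_add_one.2 (by simp [hK.2])
    simpa using this
  have hb : Bornology.IsBounded (hull K.1) :=
    (isBounded_convexHull (s := (K.1 : Set (E d)))).2 K.1.finite_toSet.isBounded
  refine ENNReal.toReal_pos (ne_of_gt ?_) hb.measure_lt_top.ne
  exact (isOpen_interior.measure_pos volume hne).trans_le (measure_mono interior_subset)

/-- Every bilinear form on `V_h` is represented by exactly one operator. -/
theorem existsUnique_repr {T : SimplicialMesh d Ω} {v : E d}
    (a : DG0 T v b →ₗ[ℝ] DG0 T v b →ₗ[ℝ] ℝ) :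
    ∃! Q : Module.End ℝ (DG0 T v b), ∀ u w, ip (Q u) w = a u w := by
  classical
  have key : ∀ (K : T.patch v) (i : Fin b) (z : DG0 T v b),
      ip z (Pi.single K (Pi.single i 1)) = (volume (hull K.1)).toReal * z K i := by
    intro K i z
    rw [ip_eq, Finset.sum_eq_single K]
    · simp
    · intro K' _ hne
      simp [Pi.single_eq_of_ne hne]
    · simp
  refine ⟨{ toFun := fun u K i => (volume (hull K.1)).toReal⁻¹ *
              a u (Pi.single K (Pi.single i 1)),
            map_add' := ?_, map_smul' := ?_ }, ?_, ?_⟩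
  · intro u w
    ext K i
    simp [mul_add]
  · intro c u
    ext K i
    simp
    ring
  · intro u w
    have hw : w = ∑ K : T.patch v, ∑ i : Fin b,
        w K i • (Pi.single K (Pi.single i 1) : DG0 T v b) := by
      ext K i
      simp [Finset.sum_apply, Pi.single_apply]
      rw [Finset.sum_eq_single K]
      · simp [Pi.single_apply]
      · intro K' _ hne
        simp [hne.symm]
      · simp
    conv_rhs => rw [hw]
    rw [ip_eq]
    simp only [map_sum, map_smul, smul_eq_mul, dotProduct, LinearMap.coe_mk, AddHom.coe_mk,
      Finset.mul_sum]
    refine Finset.sum_congr rfl fun K _ => Finset.sum_congr rfl fun i _ => ?_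
    have := (volume_pos T K).ne'
    field_simp
  · intro Q hQ
    refine LinearMap.ext fun u => funext fun K => funext fun i => ?_
    have h := hQ u (Pi.single K (Pi.single i 1))
    rw [key] at h
    have := (volume_pos T K).ne'
    change Q u K i = (volume (hull K.1)).toReal⁻¹ * a u (Pi.single K (Pi.single i 1))
    rw [← h]
    field_simp

/-- `‖u‖_Q = √(Q u, u)`. -/
def opNorm {T : SimplicialMesh d Ω} {v : E d} (Q : Module.End ℝ (DG0 T v b))
    (u : DG0 T v b) : ℝ := Real.sqrt (ip (Q u) u)

section SAT

variable {V : Type*} [AddCommGroup V] [Module ℝ V]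

/-- `X_0 = I`, `X_i = τ M₀⁻¹ (A + i M₁) X_{i-1}`. -/
def satX (τ : ℝ) (M₀ M₁ A : Module.End ℝ V) : ℕ → Module.End ℝ V
  | 0 => 1
  | i + 1 => τ • (Ring.inverse M₀ * (A + ((i : ℝ) + 1) • M₁) * satX τ M₀ M₁ A i)

/-- One SAT step of order `s` and size `τ`:
`R_s = ∑_{i<s} X_i / i! + M⁻¹ M₀ X_s / s!` with `M = M₀ - τ M₁`. -/
def satStep (s : ℕ) (τ : ℝ) (M₀ M₁ A : Module.End ℝ V) : Module.End ℝ V :=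
  ∑ i ∈ Finset.range s, (i.factorial : ℝ)⁻¹ • satX τ M₀ M₁ A i +
    (s.factorial : ℝ)⁻¹ • (Ring.inverse (M₀ - τ • M₁) * M₀ * satX τ M₀ M₁ A s)

/-- The composition `R_{[l],s} ∘ ⋯ ∘ R_{[1],s}` of the propagators of the first `l` subtents of
size `τ`; the `l`-th of them starts from `M₀^{[l]} = M₀ - (l - 1) τ M₁`. -/
def satSubtents (s : ℕ) (τ : ℝ) (M₀ M₁ A : Module.End ℝ V) : ℕ → Module.End ℝ V
  | 0 => 1
  | l + 1 => satStep s τ (M₀ - ((l : ℝ) * τ) • M₁) M₁ A * satSubtents s τ M₀ M₁ A l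

/-- The propagator `R_{r,s}` over the whole tent, divided into `r` subtents, `τ = 1 / r`. -/
def satPropagator (r s : ℕ) (M₀ M₁ A : Module.End ℝ V) : Module.End ℝ V :=
  satSubtents s (1 / (r : ℝ)) M₀ M₁ A r

end SAT

end

end TentDG

/-! For piecewise constants the tent enters only through the facet weights $\int_F\delta$. On each
element $\delta$ is the pole height times the barycentric coordinate of the vertex, so the
divergence theorem turns $(M_1u,w)$ into $\sum_K\sum_{F\subset\partial K}\int_F\delta\,\mathcal D
u_K\cdot w_K$ (`IsTent.massForm1_eq_outflowForm`). Since the vertex lies in the open set $\Omega$,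
every facet through it has a neighbour in the patch. Since $\sum_j\partial_j\mathcal L^{(j)}=0$, the
matrix $\mathcal D$ has the same value from both sides of such a facet (`sum_affGrad_mul_eq`).

Three facts follow. The balance $2(Au,u)+(M_1u,u)$ is minus a multiple of
$\sum_F\int_F\delta\,S[\![u]\!]\cdot[\![u]\!]$ (`two_mul_edgeForm_self`). The residual $(A+M_1)u$ is
controlled by the jumps of $u$ alone (`abs_edgeForm_add_outflowForm_le`). So is $(Aw,u)$ in its
second argument (`abs_edgeForm_le`). As $S\ge\sigma_0I$, the dissipation $j$ of one step controls
all these jumps.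

In time, $X_1u=\tau M_0^{-1}(A+M_1)u$ has size $\sqrt{\varepsilon j}$, where $\varepsilon$ is a
multiple of the CFL number, and every later stage inherits this bound. The stages telescope exactly,
$MR_su=M_0u+\tau A\sum_{i<s}X_iu/(i+1)!$ (`mul_satStep`), so that
$(MR_su,R_su)=(M_0u,u)-2j+O(\varepsilon j)$, and the energy cannot grow once $\varepsilon$ is small
(`satStep_energy_le`). The argument is the same for every order $s$.

Coercivity of all the mass operators comes from causality and the bound on the characteristic
speeds. The facet weights are bounded through shape regularity. The first claim follows from the CFL
case, because causality bounds the pole height by $2h_K/c_{\max}$ (`IsTent.pole_le`). -/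

namespace TentDG

/-! ### Abstract energy estimate for the SAT time stepping -/

section Energy

variable {V : Type*} [NormedAddCommGroup V] [InnerProductSpace ℝ V] [FiniteDimensional ℝ V]

/-- Ensures that `Ring.inverse` is a genuine inverse rather than its default value `0`. -/
theorem isUnit_of_coercive {M : Module.End ℝ V} {κ : ℝ} (hκ : 0 < κ)
    (hM : ∀ w, κ * ‖w‖ ^ 2 ≤ inner ℝ (M w) w) : IsUnit M := by
  rw [Module.End.isUnit_iff]
  have hinj : Function.Injective M := by
    rw [injective_iff_map_eq_zero]
    intro w hw
    have h := hM w
    rw [hw, inner_zero_left] at h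
    have h2 : ‖w‖ ^ 2 ≤ 0 := by nlinarith [sq_nonneg ‖w‖]
    simpa using le_antisymm h2 (sq_nonneg _)
  exact ⟨hinj, LinearMap.injective_iff_surjective.1 hinj⟩

theorem norm_inverse_le_of_coercive {M : Module.End ℝ V} {κ : ℝ} (hκ : 0 < κ)
    (hM : ∀ w, κ * ‖w‖ ^ 2 ≤ inner ℝ (M w) w) (w : V) :
    κ * ‖Ring.inverse M w‖ ≤ ‖w‖ := by
  set z := Ring.inverse M w with hz
  have hw : M z = w := by
    rw [hz, ← Module.End.mul_apply, Ring.mul_inverse_cancel _ (isUnit_of_coercive hκ hM)]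
    rfl
  have h := (hM z).trans (real_inner_le_norm _ _)
  rw [hw] at h
  rcases eq_or_lt_of_le (norm_nonneg z) with h0 | h0
  · rw [← h0]; simp
  · nlinarith


theorem mul_satX_succ {V : Type*} [AddCommGroup V] [Module ℝ V] {M₀ : Module.End ℝ V}
    (h₀ : IsUnit M₀) (τ : ℝ) (M₁ A : Module.End ℝ V) (i : ℕ) :
    M₀ * satX τ M₀ M₁ A (i + 1) = τ • ((A + ((i : ℝ) + 1) • M₁) * satX τ M₀ M₁ A i) := by
  rw [satX, mul_smul_comm, mul_assoc, Ring.mul_inverse_cancel_left _ _ h₀]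

/-- Dividing the recursion by $(i+1)!$ gives $M_0X_{i+1}/(i+1)!=\tau AX_i/(i+1)!+\tau M_1X_i/i!$.
The $M_1$ terms cancel against those of $M_0-\tau M_1$, and the sum telescopes. -/
theorem mul_sum_satX {V : Type*} [AddCommGroup V] [Module ℝ V] {M₀ : Module.End ℝ V}
    (h₀ : IsUnit M₀) (τ : ℝ) (M₁ A : Module.End ℝ V) (s : ℕ) :
    (M₀ - τ • M₁) * (∑ i ∈ Finset.range (s + 1), (i.factorial : ℝ)⁻¹ • satX τ M₀ M₁ A i) +
        ((s + 1).factorial : ℝ)⁻¹ • (M₀ * satX τ M₀ M₁ A (s + 1)) =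
      M₀ + τ • (A * ∑ i ∈ Finset.range (s + 1),
        ((i + 1).factorial : ℝ)⁻¹ • satX τ M₀ M₁ A i) := by
  induction s with
  | zero =>
    rw [mul_satX_succ h₀]
    simp [satX]
  | succ s ih =>
    rw [Finset.sum_range_succ _ (s + 1), Finset.sum_range_succ _ (s + 1), mul_add, mul_add,
      smul_add, ← add_assoc M₀, ← ih, mul_satX_succ h₀ τ M₁ A (s + 1)]
    have hf : ((s + 1).factorial : ℝ)⁻¹ =
        (((s + 1 + 1).factorial : ℕ) : ℝ)⁻¹ * (((s + 1 : ℕ) : ℝ) + 1) := by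
      rw [Nat.factorial_succ (s + 1)]
      push_cast
      field_simp
    rw [hf]
    simp only [add_mul, sub_mul, mul_smul_comm, smul_mul_assoc, smul_add, smul_sub]
    module

/-- The factor $M^{-1}M_0$ on the last stage supplies exactly the closing term of the telescoping
sum. -/
theorem mul_satStep {V : Type*} [AddCommGroup V] [Module ℝ V] {M₀ M₁ : Module.End ℝ V} {τ : ℝ}
    (h₀ : IsUnit M₀) (h₁ : IsUnit (M₀ - τ • M₁)) (A : Module.End ℝ V) {s : ℕ} (hs : 1 ≤ s) :
    (M₀ - τ • M₁) * satStep s τ M₀ M₁ A = M₀ + τ • (A * ∑ i ∈ Finset.range s,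
        ((i + 1).factorial : ℝ)⁻¹ • satX τ M₀ M₁ A i) := by
  obtain ⟨s, rfl⟩ := Nat.exists_eq_add_of_le' hs
  rw [← mul_sum_satX h₀, satStep, mul_add, mul_smul_comm, mul_assoc (Ring.inverse _),
    Ring.mul_inverse_cancel_left _ _ h₁]

omit [FiniteDimensional ℝ V] in
-- Separates the leading term $u$ from the small stages, both for the weights $1/i!$ and for
-- $1/(i+1)!$.
theorem norm_sum_range_sub_le (s : ℕ) (c : ℕ → ℝ) (hc : ∀ i, |c i| ≤ 1) (hc0 : c 0 = 1)
    (x : ℕ → V) {P : ℝ} (hP : 0 ≤ P) (hx : ∀ i, 1 ≤ i → i < s → ‖x i‖ ≤ P) (hs : 1 ≤ s) :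
    ‖∑ i ∈ Finset.range s, c i • x i - x 0‖ ≤ s * P := by
  obtain ⟨s, rfl⟩ := Nat.exists_eq_add_of_le' hs
  rw [Finset.sum_range_succ', hc0, one_smul, add_sub_cancel_right]
  refine (norm_sum_le_of_le _ (f := fun i => c (i + 1) • x (i + 1)) (n := fun _ => P) ?_).trans ?_
  · intro i hi
    rw [norm_smul, Real.norm_eq_abs]
    have := hx (i + 1) (by omega) (by have := Finset.mem_range.1 hi; omega)
    calc _ ≤ 1 * P := mul_le_mul (hc _) this (norm_nonneg _) zero_le_one
      _ = P := one_mul P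
  · simp
    nlinarith

/-- Here $2j$ is the energy dissipated in the step, $\varepsilon$ the small parameter and $q$ the
growth factor from one stage to the next. All stages after $X_0$ have size $\sqrt{\varepsilon j}$,
so both error terms in the expansion of the energy are $O(\varepsilon j)$ and are absorbed by $-2j$.
-/
theorem satStep_energy_le {s : ℕ} (hs : 1 ≤ s) {M₀ M₁ A : Module.End ℝ V}
    {τ κ Λ q ε j : ℝ} (u : V) (hκ : 0 < κ) (hΛ : 0 ≤ Λ) (hε : 0 ≤ ε) (hε1 : ε ≤ 1) (hj : 0 ≤ j)
    (hq1 : 1 ≤ q) (hq : 1 + (s : ℝ) ≤ q * κ)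
    (hM₀ : ∀ w, κ * ‖w‖ ^ 2 ≤ inner ℝ (M₀ w) w)
    (hM : ∀ w, κ * ‖w‖ ^ 2 ≤ inner ℝ ((M₀ - τ • M₁) w) w)
    (hsymm : ∀ w z, inner ℝ ((M₀ - τ • M₁) w) z = inner ℝ w ((M₀ - τ • M₁) z))
    (hM₀b : ∀ w, ‖M₀ w‖ ≤ Λ * ‖w‖) (hMb : ∀ w, ‖(M₀ - τ • M₁) w‖ ≤ Λ * ‖w‖)
    (hA : ∀ w, ‖τ • A w‖ ≤ ε * ‖w‖) (hM₁ : ∀ w, ‖τ • M₁ w‖ ≤ ε * ‖w‖)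
    (hdiss : 2 * (τ * inner ℝ (A u) u) + τ * inner ℝ (M₁ u) u = -2 * j)
    (hres : ‖τ • (A u + M₁ u)‖ ≤ √(ε * j))
    (hadj : ∀ w, |τ * inner ℝ (A w) u| ≤ ‖w‖ * √(ε * j))
    (hsmall : ε * (2 * (s * q ^ s) + Λ * ((s + Λ / κ) * q ^ s) ^ 2) ≤ 2) :
    inner ℝ ((M₀ - τ • M₁) (satStep s τ M₀ M₁ A u)) (satStep s τ M₀ M₁ A u) ≤
      inner ℝ (M₀ u) u := by
  set σ := √(ε * j) with hσ
  have hσ0 : 0 ≤ σ := Real.sqrt_nonneg _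
  have hσ2 : σ ^ 2 = ε * j := Real.sq_sqrt (mul_nonneg hε hj)
  have hq0 : 0 ≤ q := zero_le_one.trans hq1
  set x : ℕ → V := fun i => satX τ M₀ M₁ A i u with hx
  have hx0 : x 0 = u := rfl
  have hxs (i : ℕ) : x (i + 1) =
      Ring.inverse M₀ (τ • (A (x i)) + ((i : ℝ) + 1) • (τ • M₁ (x i))) := by
    simp only [hx, satX, LinearMap.smul_apply, Module.End.mul_apply, LinearMap.add_apply]
    rw [← map_smul, smul_add, smul_comm τ ((i : ℝ) + 1)]
  have hinv := norm_inverse_le_of_coercive hκ hM₀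
  -- The first stage sees precisely the combination $A+M_1$, whose value at $u$ is controlled by the
  -- dissipation.
  have hx1 : ‖x 1‖ ≤ q * σ := by
    have h1 := hinv (τ • (A (x 0)) + (((0 : ℕ) : ℝ) + 1) • (τ • M₁ (x 0)))
    rw [← hxs 0, hx0] at h1
    have h2 : τ • A u + (((0 : ℕ) : ℝ) + 1) • (τ • M₁ u) = τ • (A u + M₁ u) := by
      simp
    rw [h2] at h1
    have h3 : κ * ‖x 1‖ ≤ σ := h1.trans hres
    have h4 : 1 ≤ q * κ := by
      have : (0 : ℝ) ≤ s := Nat.cast_nonneg s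
      linarith
    nlinarith [norm_nonneg (x 1), mul_le_mul_of_nonneg_left h3 hq0,
      mul_le_mul_of_nonneg_right h4 (norm_nonneg (x 1))]
  -- From here on boundedness suffices: $\tau(A+(k+1)M_1)$ has norm at most $1+s$ because
  -- $\varepsilon\le1$, $M_0^{-1}$ has norm at most $1/\kappa$, and $q\ge(1+s)/\kappa$.
  have hxk : ∀ k : ℕ, 1 ≤ k → k ≤ s → ‖x k‖ ≤ q ^ k * σ := by
    intro k hk
    induction k, hk using Nat.le_induction with
    | base => intro _; simpa using hx1
    | succ k hk ih =>
      intro hks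
      have ih := ih (by omega)
      have h1 := hinv (τ • (A (x k)) + ((k : ℝ) + 1) • (τ • M₁ (x k)))
      rw [← hxs k] at h1
      have hks' : (k : ℝ) + 1 ≤ s := by exact_mod_cast hks
      have h2 : ‖τ • (A (x k)) + ((k : ℝ) + 1) • (τ • M₁ (x k))‖ ≤ (1 + s) * ‖x k‖ := by
        refine (norm_add_le _ _).trans ?_
        rw [norm_smul ((k : ℝ) + 1), Real.norm_of_nonneg (by positivity)]
        have h3 := (hA (x k)).trans (mul_le_mul_of_nonneg_right hε1 (norm_nonneg _))
        have h4 := (hM₁ (x k)).trans (mul_le_mul_of_nonneg_right hε1 (norm_nonneg _))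
        have h5 : ((k : ℝ) + 1) * ‖τ • M₁ (x k)‖ ≤ s * ‖x k‖ :=
          mul_le_mul hks' (by simpa using h4) (norm_nonneg _) (Nat.cast_nonneg _)
        linarith
      have h3 : κ * ‖x (k + 1)‖ ≤ (q * κ) * ‖x k‖ :=
        h1.trans (h2.trans (mul_le_mul_of_nonneg_right hq (norm_nonneg _)))
      have h4 : ‖x (k + 1)‖ ≤ q * ‖x k‖ := by
        refine le_of_mul_le_mul_left ?_ hκ
        linarith
      calc _ ≤ q * ‖x k‖ := h4
        _ ≤ q * (q ^ k * σ) := mul_le_mul_of_nonneg_left ih hq0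
        _ = q ^ (k + 1) * σ := by ring
  set P := q ^ s * σ with hP
  have hP0 : 0 ≤ P := by positivity
  have hxP (k : ℕ) (hk : 1 ≤ k) (hks : k ≤ s) : ‖x k‖ ≤ P :=
    (hxk k hk hks).trans (mul_le_mul_of_nonneg_right (pow_le_pow_right₀ hq1 hks) hσ0)
  have hfac (n : ℕ) : |((n.factorial : ℕ) : ℝ)⁻¹| ≤ 1 := by
    rw [abs_of_nonneg (by positivity)]
    exact inv_le_one_of_one_le₀ (by exact_mod_cast n.factorial_pos)
  set y : V := ∑ i ∈ Finset.range s, ((i + 1).factorial : ℝ)⁻¹ • x i with hy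
  have hyu : ‖y - u‖ ≤ s * P :=
    norm_sum_range_sub_le s (fun i => ((i + 1).factorial : ℝ)⁻¹) (fun i => hfac _) (by simp) x
      hP0 (fun i h1 h2 => hxP i h1 h2.le) hs
  set z : V := satStep s τ M₀ M₁ A u with hz
  have hzexp : z = ∑ i ∈ Finset.range s, (i.factorial : ℝ)⁻¹ • x i +
      (s.factorial : ℝ)⁻¹ • (Ring.inverse (M₀ - τ • M₁) (M₀ (x s))) := by
    simp only [hz, satStep, LinearMap.add_apply, LinearMap.sum_apply, LinearMap.smul_apply,
      Module.End.mul_apply, hx]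
  set e : V := z - u with he
  have hzu : z = u + e := by rw [he]; abel
  have he1 : ‖e‖ ≤ (s + Λ / κ) * P := by
    have h1 : e = (∑ i ∈ Finset.range s, (i.factorial : ℝ)⁻¹ • x i - x 0) +
        (s.factorial : ℝ)⁻¹ • (Ring.inverse (M₀ - τ • M₁) (M₀ (x s))) := by
      rw [he, hzexp, hx0]; abel
    rw [h1, add_mul]
    refine (norm_add_le _ _).trans (add_le_add ?_ ?_)
    · exact norm_sum_range_sub_le s (fun i => (i.factorial : ℝ)⁻¹) (fun i => hfac _) (by simp) x
        hP0 (fun i h1 h2 => hxP i h1 h2.le) hs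
    · rw [norm_smul]
      have h2 := norm_inverse_le_of_coercive hκ hM (M₀ (x s))
      have h3 := (hM₀b (x s)).trans (mul_le_mul_of_nonneg_left (hxP s hs le_rfl) hΛ)
      have h4 : ‖Ring.inverse (M₀ - τ • M₁) (M₀ (x s))‖ ≤ Λ / κ * P := by
        rw [div_mul_eq_mul_div, le_div_iff₀ hκ]
        linarith
      calc _ ≤ 1 * (Λ / κ * P) :=
            mul_le_mul (hfac s) h4 (norm_nonneg _) zero_le_one
        _ = _ := one_mul _
  have hMz : (M₀ - τ • M₁) z = M₀ u + τ • A y := by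
    have h := congrArg (fun Q : Module.End ℝ V => Q u) (mul_satStep (isUnit_of_coercive hκ hM₀)
      (isUnit_of_coercive hκ hM) A hs)
    simpa [Module.End.mul_apply, LinearMap.sum_apply, hx, hy, hz] using h
  have hMe : (M₀ - τ • M₁) e = τ • M₁ u + τ • A y := by
    rw [he, map_sub, hMz]
    simp only [LinearMap.sub_apply, LinearMap.smul_apply]
    abel
  have hMee : inner ℝ ((M₀ - τ • M₁) e) e ≤ Λ * ((s + Λ / κ) * P) ^ 2 := by
    refine (real_inner_le_norm _ _).trans ?_
    calc _ ≤ (Λ * ‖e‖) * ‖e‖ := mul_le_mul_of_nonneg_right (hMb e) (norm_nonneg _)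
      _ = Λ * ‖e‖ ^ 2 := by ring
      _ ≤ _ := mul_le_mul_of_nonneg_left (pow_le_pow_left₀ (norm_nonneg _) he1 2) hΛ
  -- One factor $\sqrt{\varepsilon j}$ comes from $y-u$, the other from the test function $u$;
  -- together they give the full $\varepsilon j$.
  have hAy : τ * inner ℝ (A (y - u)) u ≤ s * P * σ :=
    (le_abs_self _).trans ((hadj _).trans (mul_le_mul_of_nonneg_right hyu hσ0))
  -- With $Me=\tau M_1u+\tau Ay$ one has $(Mu,u)+2\tau(M_1u,u)=(M_0u,u)+\tau(M_1u,u)$; adding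
  -- $2\tau(Au,u)$ produces $-2j$ by `hdiss`.
  have hexp : inner ℝ ((M₀ - τ • M₁) z) z = inner ℝ (M₀ u) u - 2 * j +
      2 * (τ * inner ℝ (A (y - u)) u) + inner ℝ ((M₀ - τ • M₁) e) e := by
    have h1 : inner ℝ ((M₀ - τ • M₁) z) z = inner ℝ ((M₀ - τ • M₁) u) u +
        2 * inner ℝ ((M₀ - τ • M₁) e) u + inner ℝ ((M₀ - τ • M₁) e) e := by
      rw [hzu, map_add, inner_add_left, inner_add_right, inner_add_right, hsymm u e,
        real_inner_comm ((M₀ - τ • M₁) e) u]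
      ring
    rw [h1, hMe, map_sub]
    simp only [LinearMap.sub_apply, LinearMap.smul_apply, inner_sub_left, inner_add_left,
      inner_smul_left, RCLike.conj_to_real]
    linarith
  rw [hexp]
  have hPσ : P * σ = q ^ s * (ε * j) := by rw [hP, ← hσ2]; ring
  have hP2 : P ^ 2 = (q ^ s) ^ 2 * (ε * j) := by rw [hP, ← hσ2]; ring
  have hfin : 2 * (s * P * σ) + Λ * ((s + Λ / κ) * P) ^ 2 ≤ 2 * j := by
    have : 2 * (s * P * σ) + Λ * ((s + Λ / κ) * P) ^ 2 =
        ε * (2 * (s * q ^ s) + Λ * ((s + Λ / κ) * q ^ s) ^ 2) * j := by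
      rw [mul_pow, hP2, mul_assoc (s : ℝ) P σ, hPσ]; ring
    rw [this]
    exact mul_le_mul_of_nonneg_right hsmall hj
  linarith


/-- The mass operator at the end of a subtent is the one at the start of the next, so the one-step
estimates chain along $M(l\tau)$, from $M_0$ at $l=0$ to $M(1)$ at $l=r$. -/
theorem satPropagator_energy_le {s r : ℕ} (hs : 1 ≤ s) (hr : 1 ≤ r) {M₀ M₁ A : Module.End ℝ V}
    {κ Λ q ε : ℝ} {j : V → ℝ} (u : V) (hκ : 0 < κ) (hΛ : 0 ≤ Λ) (hε : 0 ≤ ε) (hε1 : ε ≤ 1)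
    (hj : ∀ w, 0 ≤ j w) (hq1 : 1 ≤ q) (hq : 1 + (s : ℝ) ≤ q * κ)
    (hM : ∀ t ∈ Icc (0 : ℝ) 1, ∀ w, κ * ‖w‖ ^ 2 ≤ inner ℝ ((M₀ - t • M₁) w) w)
    (hsymm₀ : ∀ w z, inner ℝ (M₀ w) z = inner ℝ w (M₀ z))
    (hsymm₁ : ∀ w z, inner ℝ (M₁ w) z = inner ℝ w (M₁ z))
    (hMb : ∀ t ∈ Icc (0 : ℝ) 1, ∀ w, ‖(M₀ - t • M₁) w‖ ≤ Λ * ‖w‖)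
    (hA : ∀ w, ‖(1 / (r : ℝ)) • A w‖ ≤ ε * ‖w‖) (hM₁ : ∀ w, ‖(1 / (r : ℝ)) • M₁ w‖ ≤ ε * ‖w‖)
    (hdiss : ∀ w, 2 * (1 / (r : ℝ) * inner ℝ (A w) w) + 1 / (r : ℝ) * inner ℝ (M₁ w) w = -2 * j w)
    (hres : ∀ w, ‖(1 / (r : ℝ)) • (A w + M₁ w)‖ ≤ √(ε * j w))
    (hadj : ∀ w z, |1 / (r : ℝ) * inner ℝ (A w) z| ≤ ‖w‖ * √(ε * j z))
    (hsmall : ε * (2 * (s * q ^ s) + Λ * ((s + Λ / κ) * q ^ s) ^ 2) ≤ 2) :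
    inner ℝ ((M₀ - M₁) (satPropagator r s M₀ M₁ A u)) (satPropagator r s M₀ M₁ A u) ≤
      inner ℝ (M₀ u) u := by
  have hr0 : (0 : ℝ) < r := by exact_mod_cast hr
  set τ : ℝ := 1 / (r : ℝ) with hτ
  have hrτ : (r : ℝ) * τ = 1 := by rw [hτ]; field_simp
  have hτ0 : 0 ≤ τ := by positivity
  have hmem (l : ℕ) (hl : l ≤ r) : (l : ℝ) * τ ∈ Icc (0 : ℝ) 1 := by
    refine ⟨by positivity, ?_⟩
    rw [← hrτ]
    exact mul_le_mul_of_nonneg_right (by exact_mod_cast hl) hτ0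
  have key : ∀ l : ℕ, l ≤ r → inner ℝ ((M₀ - ((l : ℝ) * τ) • M₁) (satSubtents s τ M₀ M₁ A l u))
      (satSubtents s τ M₀ M₁ A l u) ≤ inner ℝ (M₀ u) u := by
    intro l
    induction l with
    | zero => intro _; simp [satSubtents]
    | succ l ih =>
      intro hl
      refine le_trans ?_ (ih (by omega))
      have hstep : M₀ - (((l + 1 : ℕ) : ℝ) * τ) • M₁ = (M₀ - ((l : ℝ) * τ) • M₁) - τ • M₁ := by
        push_cast
        module
      have hl1 := hmem (l + 1) hl
      have hl0 := hmem l (by omega)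
      rw [hstep]
      refine satStep_energy_le hs (satSubtents s τ M₀ M₁ A l u) hκ hΛ hε hε1
        (hj _) hq1 hq (hM _ hl0) ?_ ?_ (hMb _ hl0) ?_ hA hM₁ (hdiss _) (hres _)
        (fun w => hadj w _) hsmall
      · rw [← hstep]; exact hM _ hl1
      · intro w z
        simp only [LinearMap.sub_apply, LinearMap.smul_apply, inner_sub_left, inner_sub_right,
          inner_smul_left, inner_smul_right, RCLike.conj_to_real, hsymm₀, hsymm₁]
      · rw [← hstep]; exact hMb _ hl1
  have h := key r le_rfl
  rwa [hrτ, one_smul] at h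

end Energy

/-! ### Euclidean norms and entrywise matrix bounds -/

section VecNorm

variable {n : ℕ}

/-- The Euclidean norm on `Fin n → ℝ`. -/
noncomputable def vecNorm (x : Fin n → ℝ) : ℝ := ‖(WithLp.toLp 2 x : EuclideanSpace ℝ (Fin n))‖

theorem vecNorm_nonneg (x : Fin n → ℝ) : 0 ≤ vecNorm x := norm_nonneg _

theorem vecNorm_sq (x : Fin n → ℝ) : vecNorm x ^ 2 = x ⬝ᵥ x := by
  rw [vecNorm, EuclideanSpace.norm_sq_eq]
  simp [dotProduct, sq]

theorem vecNorm_add_le (x y : Fin n → ℝ) : vecNorm (x + y) ≤ vecNorm x + vecNorm y := by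
  simpa [vecNorm] using norm_add_le (WithLp.toLp 2 x : EuclideanSpace ℝ (Fin n)) (WithLp.toLp 2 y)

theorem vecNorm_sub_le (x y : Fin n → ℝ) : vecNorm (x - y) ≤ vecNorm x + vecNorm y := by
  simpa [vecNorm] using norm_sub_le (WithLp.toLp 2 x : EuclideanSpace ℝ (Fin n)) (WithLp.toLp 2 y)

theorem vecNorm_smul (c : ℝ) (x : Fin n → ℝ) : vecNorm (c • x) = |c| * vecNorm x := by
  simpa [vecNorm] using norm_smul c (WithLp.toLp 2 x : EuclideanSpace ℝ (Fin n))

theorem abs_apply_le_vecNorm (x : Fin n → ℝ) (i : Fin n) : |x i| ≤ vecNorm x := by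
  simpa [vecNorm] using PiLp.norm_apply_le (WithLp.toLp 2 x : EuclideanSpace ℝ (Fin n)) i

theorem abs_mulVec_dotProduct_le {M : Matrix (Fin n) (Fin n) ℝ} {β : ℝ}
    (hM : ∀ i k, |M i k| ≤ β) (x y : Fin n → ℝ) :
    |(M *ᵥ x) ⬝ᵥ y| ≤ (n ^ 2 * β) * (vecNorm x * vecNorm y) := by
  have h : ∀ i k, |M i k * x k * y i| ≤ β * (vecNorm x * vecNorm y) := by
    intro i k
    rw [abs_mul, abs_mul, mul_assoc]
    have hβ : 0 ≤ β := (abs_nonneg _).trans (hM i k)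
    exact mul_le_mul (hM i k) (mul_le_mul (abs_apply_le_vecNorm x k) (abs_apply_le_vecNorm y i)
      (abs_nonneg _) (vecNorm_nonneg _)) (by positivity) hβ
  calc |(M *ᵥ x) ⬝ᵥ y| = |∑ i, ∑ k, M i k * x k * y i| := by
        simp [dotProduct, Matrix.mulVec, Finset.sum_mul]
    _ ≤ ∑ i, ∑ k, |M i k * x k * y i| :=
        (Finset.abs_sum_le_sum_abs _ _).trans
          (Finset.sum_le_sum fun i _ => Finset.abs_sum_le_sum_abs _ _)
    _ ≤ ∑ _i : Fin n, ∑ _k : Fin n, β * (vecNorm x * vecNorm y) :=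
        Finset.sum_le_sum fun i _ => Finset.sum_le_sum fun k _ => h i k
    _ = _ := by simp; ring

end VecNorm

/-! ### Facet forms: dissipation and jump estimates -/

section EdgeForm

variable {I : Type*} [Fintype I] {b : ℕ}

/-- The form `∑_F θ_F (D {u} - S ⟦u⟧) · ⟦w⟧`, as half of the sum over ordered pairs. -/
noncomputable def edgeForm (θ : I → I → ℝ) (D S : I → I → Matrix (Fin b) (Fin b) ℝ)
    (u w : I → Fin b → ℝ) : ℝ :=
  (1 / 2) * ∑ K, ∑ K', θ K K' *
    ((D K K' *ᵥ ((1 / 2 : ℝ) • (u K' + u K)) - S K K' *ᵥ (u K' - u K)) ⬝ᵥ (w K' - w K))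

/-- The form `∑_K ∑_{F ⊂ ∂K} θ_F D u_K · w_K`. -/
noncomputable def outflowForm (θ : I → I → ℝ) (D : I → I → Matrix (Fin b) (Fin b) ℝ)
    (u w : I → Fin b → ℝ) : ℝ :=
  ∑ K, ∑ K', θ K K' * ((D K K' *ᵥ u K) ⬝ᵥ w K)

/-- The jump seminorm `∑_F θ_F |⟦u⟧|²`, summed over ordered pairs. -/
noncomputable def jumpSq (θ : I → I → ℝ) (u : I → Fin b → ℝ) : ℝ :=
  ∑ K, ∑ K', θ K K' * vecNorm (u K' - u K) ^ 2

/-- The trace seminorm `∑_K ∑_{F ⊂ ∂K} θ_F |u_K|²`. -/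
noncomputable def traceSq (θ : I → I → ℝ) (u : I → Fin b → ℝ) : ℝ :=
  ∑ K, ∑ K', θ K K' * vecNorm (u K) ^ 2

/-- The dissipation `½ ∑_F θ_F S ⟦u⟧ · ⟦u⟧`, summed over ordered pairs. -/
noncomputable def dissipation (θ : I → I → ℝ) (S : I → I → Matrix (Fin b) (Fin b) ℝ)
    (u : I → Fin b → ℝ) : ℝ :=
  (1 / 2) * ∑ K, ∑ K', θ K K' * ((S K K' *ᵥ (u K' - u K)) ⬝ᵥ (u K' - u K))

/-- Symmetry and bounds of the data of `edgeForm`, where the weight does not vanish. -/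
structure IsFluxData (θ : I → I → ℝ) (D S : I → I → Matrix (Fin b) (Fin b) ℝ)
    (β σ : ℝ) : Prop where
  nonneg : ∀ K K', 0 ≤ θ K K'
  comm : ∀ K K', θ K' K = θ K K'
  symm : ∀ K K', θ K K' ≠ 0 → (D K K').IsSymm
  anti : ∀ K K', θ K K' ≠ 0 → D K' K = -D K K'
  bound_D : ∀ K K', θ K K' ≠ 0 → ∀ x y, |(D K K' *ᵥ x) ⬝ᵥ y| ≤ β * (vecNorm x * vecNorm y)
  bound_S : ∀ K K', θ K K' ≠ 0 → ∀ x y, |(S K K' *ᵥ x) ⬝ᵥ y| ≤ β * (vecNorm x * vecNorm y)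
  coercive : ∀ K K', θ K K' ≠ 0 → ∀ x, σ * (x ⬝ᵥ x) ≤ (S K K' *ᵥ x) ⬝ᵥ x

theorem sum_sum_mul_le_sqrt {θ f g : I → I → ℝ} (hθ : ∀ K K', 0 ≤ θ K K') :
    ∑ K, ∑ K', θ K K' * (f K K' * g K K') ≤
      √(∑ K, ∑ K', θ K K' * f K K' ^ 2) * √(∑ K, ∑ K', θ K K' * g K K' ^ 2) := by
  have h := Real.sum_mul_le_sqrt_mul_sqrt (Finset.univ : Finset (I × I))
    (fun e => √(θ e.1 e.2) * f e.1 e.2) (fun e => √(θ e.1 e.2) * g e.1 e.2)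
  simp only [mul_pow, Real.sq_sqrt (hθ _ _), Fintype.sum_prod_type] at h
  refine le_trans (le_of_eq ?_) h
  refine Finset.sum_congr rfl fun K _ => Finset.sum_congr rfl fun K' _ => ?_
  have := Real.mul_self_sqrt (hθ K K')
  linear_combination (-(f K K' * g K K')) * this

theorem sum_sum_abs_le {θ f g : I → I → ℝ} (hθ : ∀ K K', 0 ≤ θ K K')
    (h : ∀ K K', θ K K' ≠ 0 → |f K K'| ≤ g K K') :
    |∑ K, ∑ K', θ K K' * f K K'| ≤ ∑ K, ∑ K', θ K K' * g K K' := by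
  refine (Finset.abs_sum_le_sum_abs _ _).trans (Finset.sum_le_sum fun K _ =>
    (Finset.abs_sum_le_sum_abs _ _).trans (Finset.sum_le_sum fun K' _ => ?_))
  rw [abs_mul, abs_of_nonneg (hθ K K')]
  by_cases h0 : θ K K' = 0
  · simp [h0]
  · exact mul_le_mul_of_nonneg_left (h K K' h0) (hθ K K')

variable {θ : I → I → ℝ} {D S : I → I → Matrix (Fin b) (Fin b) ℝ} {β σ : ℝ}

namespace IsFluxData

theorem traceSq_swap (h : IsFluxData θ D S β σ) (u : I → Fin b → ℝ) :
    ∑ K, ∑ K', θ K K' * vecNorm (u K') ^ 2 = traceSq θ u := by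
  rw [Finset.sum_comm, traceSq]
  exact Finset.sum_congr rfl fun K _ => Finset.sum_congr rfl fun K' _ => by rw [h.comm]

theorem jumpSq_nonneg (h : IsFluxData θ D S β σ) (u : I → Fin b → ℝ) : 0 ≤ jumpSq θ u :=
  Finset.sum_nonneg fun K _ => Finset.sum_nonneg fun K' _ =>
    mul_nonneg (h.nonneg K K') (sq_nonneg _)

theorem jumpSq_le (h : IsFluxData θ D S β σ) (u : I → Fin b → ℝ) :
    jumpSq θ u ≤ 4 * traceSq θ u := by
  have h1 : jumpSq θ u ≤ 2 * (∑ K, ∑ K', θ K K' * vecNorm (u K') ^ 2) + 2 * traceSq θ u := by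
    simp only [jumpSq, traceSq, Finset.mul_sum, ← Finset.sum_add_distrib]
    refine Finset.sum_le_sum fun K _ => Finset.sum_le_sum fun K' _ => ?_
    have h2 := vecNorm_sub_le (u K') (u K)
    have h3 : vecNorm (u K' - u K) ^ 2 ≤ 2 * vecNorm (u K') ^ 2 + 2 * vecNorm (u K) ^ 2 := by
      have := pow_le_pow_left₀ (vecNorm_nonneg _) h2 2
      nlinarith [sq_nonneg (vecNorm (u K') - vecNorm (u K))]
    nlinarith [mul_le_mul_of_nonneg_left h3 (h.nonneg K K')]
  rw [h.traceSq_swap] at h1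
  linarith

theorem sum_self_le (h : IsFluxData θ D S β σ) (u w : I → Fin b → ℝ) :
    ∑ K, ∑ K', θ K K' * (vecNorm (u K' - u K) * vecNorm (w K)) ≤
      √(jumpSq θ u) * √(traceSq θ w) :=
  sum_sum_mul_le_sqrt (f := fun K K' => vecNorm (u K' - u K)) (g := fun K _ => vecNorm (w K))
    h.nonneg

theorem sum_neighbour_le (h : IsFluxData θ D S β σ) (u w : I → Fin b → ℝ) :
    ∑ K, ∑ K', θ K K' * (vecNorm (u K' - u K) * vecNorm (w K')) ≤
      √(jumpSq θ u) * √(traceSq θ w) := by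
  rw [← h.traceSq_swap w]
  exact sum_sum_mul_le_sqrt (f := fun K K' => vecNorm (u K' - u K))
    (g := fun _ K' => vecNorm (w K')) h.nonneg

/-- Exchanging the two elements of a facet keeps the weight and reverses the normal, hence the sign
of $\mathcal D$. -/
theorem sum_swap_eq_neg (h : IsFluxData θ D S β σ) (f : I → I → (Fin b → ℝ))
    (g : I → I → (Fin b → ℝ)) :
    ∑ K, ∑ K', θ K K' * ((D K K' *ᵥ f K' K) ⬝ᵥ g K' K) =
      -∑ K, ∑ K', θ K K' * ((D K K' *ᵥ f K K') ⬝ᵥ g K K') := by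
  rw [Finset.sum_comm, ← Finset.sum_neg_distrib]
  refine Finset.sum_congr rfl fun K _ => ?_
  rw [← Finset.sum_neg_distrib]
  refine Finset.sum_congr rfl fun K' _ => ?_
  by_cases h0 : θ K K' = 0
  · simp [h.comm, h0]
  · rw [h.comm, h.anti _ _ h0, Matrix.neg_mulVec, neg_dotProduct, mul_neg]

/-- By the swap the central flux part of `edgeForm` equals $-\sum_K\sum_F\theta_F\mathcal
D\{u\}\cdot w_K$. Adding the outflow replaces $\{u\}$ by $\{u\}-u_K=\frac12(u_{K'}-u_K)$, so only
jumps of $u$ survive. -/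
theorem edgeForm_add_outflowForm (h : IsFluxData θ D S β σ) (u w : I → Fin b → ℝ) :
    edgeForm θ D S u w + outflowForm θ D u w =
      -(1 / 2) * ∑ K, ∑ K', θ K K' * ((D K K' *ᵥ (u K' - u K)) ⬝ᵥ w K) -
      (1 / 2) * ∑ K, ∑ K', θ K K' * ((S K K' *ᵥ (u K' - u K)) ⬝ᵥ (w K' - w K)) := by
  have h1 := h.sum_swap_eq_neg (fun K K' => (1 / 2 : ℝ) • (u K' + u K)) (fun K _ => w K)
  have e1 : edgeForm θ D S u w =
      (1 / 2) * ∑ K, ∑ K', θ K K' * ((D K K' *ᵥ ((1 / 2 : ℝ) • (u K + u K'))) ⬝ᵥ w K') -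
      (1 / 2) * ∑ K, ∑ K', θ K K' * ((D K K' *ᵥ ((1 / 2 : ℝ) • (u K' + u K))) ⬝ᵥ w K) -
      (1 / 2) * ∑ K, ∑ K', θ K K' * ((S K K' *ᵥ (u K' - u K)) ⬝ᵥ (w K' - w K)) := by
    simp only [edgeForm, Finset.mul_sum, ← Finset.sum_sub_distrib]
    refine Finset.sum_congr rfl fun K _ => Finset.sum_congr rfl fun K' _ => ?_
    rw [sub_dotProduct, dotProduct_sub (D K K' *ᵥ _), add_comm (u K)]
    ring
  have e2 : ∑ K, ∑ K', θ K K' * ((D K K' *ᵥ (u K' - u K)) ⬝ᵥ w K) =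
      2 * (∑ K, ∑ K', θ K K' * ((D K K' *ᵥ ((1 / 2 : ℝ) • (u K' + u K))) ⬝ᵥ w K)) -
      2 * outflowForm θ D u w := by
    simp only [outflowForm, Finset.mul_sum, ← Finset.sum_sub_distrib]
    refine Finset.sum_congr rfl fun K _ => Finset.sum_congr rfl fun K' _ => ?_
    simp only [Matrix.mulVec_sub, Matrix.mulVec_smul, Matrix.mulVec_add, sub_dotProduct,
      smul_dotProduct, add_dotProduct, smul_eq_mul]
    ring
  rw [e1, e2, h1]
  ring

/-- The cross terms $\mathcal D u_{K'}\cdot u_K$ cancel in pairs, $\mathcal D$ being symmetric as a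
matrix and odd under exchange of the elements; only the stabilization remains. -/
theorem two_mul_edgeForm_self (h : IsFluxData θ D S β σ) (u : I → Fin b → ℝ) :
    2 * edgeForm θ D S u u + outflowForm θ D u u = -2 * dissipation θ S u := by
  have h1 := h.edgeForm_add_outflowForm u u
  have h2 : ∑ K, ∑ K', θ K K' * ((D K K' *ᵥ u K') ⬝ᵥ u K) = 0 := by
    have h3 := h.sum_swap_eq_neg (fun _ K' => u K') (fun K _ => u K)
    have h4 : ∑ K, ∑ K', θ K K' * ((D K K' *ᵥ u K) ⬝ᵥ u K') =
        ∑ K, ∑ K', θ K K' * ((D K K' *ᵥ u K') ⬝ᵥ u K) := by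
      refine Finset.sum_congr rfl fun K _ => Finset.sum_congr rfl fun K' _ => ?_
      by_cases h0 : θ K K' = 0
      · simp [h0]
      · rw [dotProduct_comm, Matrix.dotProduct_mulVec, ← Matrix.mulVec_transpose,
          (h.symm _ _ h0).eq]
    linarith
  have h5 : ∑ K, ∑ K', θ K K' * ((D K K' *ᵥ (u K' - u K)) ⬝ᵥ u K) =
      ∑ K, ∑ K', θ K K' * ((D K K' *ᵥ u K') ⬝ᵥ u K) - outflowForm θ D u u := by
    simp only [outflowForm, ← Finset.sum_sub_distrib]
    refine Finset.sum_congr rfl fun K _ => Finset.sum_congr rfl fun K' _ => ?_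
    rw [Matrix.mulVec_sub, sub_dotProduct]
    ring
  rw [h5, h2] at h1
  rw [dissipation]
  linarith

theorem jumpSq_le_dissipation (h : IsFluxData θ D S β σ) (u : I → Fin b → ℝ) :
    σ * jumpSq θ u ≤ 2 * dissipation θ S u := by
  rw [dissipation, ← mul_assoc, mul_one_div_cancel two_ne_zero, one_mul, jumpSq, Finset.mul_sum]
  refine Finset.sum_le_sum fun K _ => ?_
  rw [Finset.mul_sum]
  refine Finset.sum_le_sum fun K' _ => ?_
  by_cases h0 : θ K K' = 0
  · simp [h0]
  · rw [vecNorm_sq]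
    nlinarith [mul_le_mul_of_nonneg_left (h.coercive K K' h0 (u K' - u K)) (h.nonneg K K')]

theorem abs_outflowForm_le (h : IsFluxData θ D S β σ) (hβ : 0 ≤ β) (u w : I → Fin b → ℝ) :
    |outflowForm θ D u w| ≤ β * (√(traceSq θ u) * √(traceSq θ w)) := by
  refine (sum_sum_abs_le h.nonneg fun K K' h0 => h.bound_D K K' h0 _ _).trans ?_
  have := sum_sum_mul_le_sqrt (f := fun K _ => vecNorm (u K)) (g := fun K _ => vecNorm (w K))
    h.nonneg
  refine le_trans (le_of_eq ?_) (mul_le_mul_of_nonneg_left this hβ)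
  simp only [Finset.mul_sum]
  exact Finset.sum_congr rfl fun K _ => Finset.sum_congr rfl fun K' _ => by ring

theorem abs_edgeForm_add_outflowForm_le (h : IsFluxData θ D S β σ) (hβ : 0 ≤ β)
    (u w : I → Fin b → ℝ) :
    |edgeForm θ D S u w + outflowForm θ D u w| ≤
      3 / 2 * β * (√(jumpSq θ u) * √(traceSq θ w)) := by
  rw [h.edgeForm_add_outflowForm]
  have h1 := sum_sum_abs_le (f := fun K K' => (D K K' *ᵥ (u K' - u K)) ⬝ᵥ w K) h.nonneg
    fun K K' h0 => h.bound_D K K' h0 (u K' - u K) (w K)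
  have h2 := sum_sum_abs_le (f := fun K K' => (S K K' *ᵥ (u K' - u K)) ⬝ᵥ (w K' - w K)) h.nonneg
    fun K K' h0 => (h.bound_S K K' h0 (u K' - u K) (w K' - w K)).trans
      (mul_le_mul_of_nonneg_left (mul_le_mul_of_nonneg_left (vecNorm_sub_le _ _)
        (vecNorm_nonneg _)) hβ)
  have e1 : ∑ K, ∑ K', θ K K' * (β * (vecNorm (u K' - u K) * vecNorm (w K))) =
      β * ∑ K, ∑ K', θ K K' * (vecNorm (u K' - u K) * vecNorm (w K)) := by
    simp only [Finset.mul_sum]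
    exact Finset.sum_congr rfl fun K _ => Finset.sum_congr rfl fun K' _ => by ring
  have e2 : ∑ K, ∑ K', θ K K' * (β * (vecNorm (u K' - u K) * (vecNorm (w K') + vecNorm (w K)))) =
      β * ∑ K, ∑ K', θ K K' * (vecNorm (u K' - u K) * vecNorm (w K')) +
      β * ∑ K, ∑ K', θ K K' * (vecNorm (u K' - u K) * vecNorm (w K)) := by
    simp only [Finset.mul_sum, ← Finset.sum_add_distrib]
    exact Finset.sum_congr rfl fun K _ => Finset.sum_congr rfl fun K' _ => by ring
  rw [e1] at h1
  rw [e2] at h2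
  have h3 := mul_le_mul_of_nonneg_left (h.sum_self_le u w) hβ
  have h4 := mul_le_mul_of_nonneg_left (h.sum_neighbour_le u w) hβ
  rw [abs_le] at h1 h2 ⊢
  constructor <;> linarith [h1.1, h1.2, h2.1, h2.2]

/-- The numerical flux is tested only with jumps. This gives the adjoint estimate `hadj` and,
together with `jumpSq_le`, the boundedness of $\tau A$. -/
theorem abs_edgeForm_le (h : IsFluxData θ D S β σ) (hβ : 0 ≤ β) (w u : I → Fin b → ℝ) :
    |edgeForm θ D S w u| ≤ 3 / 2 * β * (√(traceSq θ w) * √(jumpSq θ u)) := by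
  have h2 := sum_sum_abs_le (f := fun K K' =>
      (D K K' *ᵥ ((1 / 2 : ℝ) • (w K' + w K)) - S K K' *ᵥ (w K' - w K)) ⬝ᵥ (u K' - u K))
    (g := fun K K' => 3 / 2 * β * (vecNorm (u K' - u K) * vecNorm (w K')) +
      3 / 2 * β * (vecNorm (u K' - u K) * vecNorm (w K))) h.nonneg ?_
  · have e2 : ∑ K, ∑ K', θ K K' * (3 / 2 * β * (vecNorm (u K' - u K) * vecNorm (w K')) +
          3 / 2 * β * (vecNorm (u K' - u K) * vecNorm (w K))) =
        3 / 2 * β * ∑ K, ∑ K', θ K K' * (vecNorm (u K' - u K) * vecNorm (w K')) +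
        3 / 2 * β * ∑ K, ∑ K', θ K K' * (vecNorm (u K' - u K) * vecNorm (w K)) := by
      simp only [Finset.mul_sum, ← Finset.sum_add_distrib]
      exact Finset.sum_congr rfl fun K _ => Finset.sum_congr rfl fun K' _ => by ring
    rw [e2] at h2
    have hβ' : 0 ≤ 3 / 2 * β := by positivity
    have h3 := mul_le_mul_of_nonneg_left (h.sum_self_le u w) hβ'
    have h4 := mul_le_mul_of_nonneg_left (h.sum_neighbour_le u w) hβ'
    rw [edgeForm, abs_mul, abs_of_pos (by norm_num : (0 : ℝ) < 1 / 2)]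
    linarith [mul_comm (√(traceSq θ w)) √(jumpSq θ u)]
  · intro K K' h0
    rw [sub_dotProduct]
    refine (abs_sub _ _).trans ?_
    have h3 := h.bound_D K K' h0 ((1 / 2 : ℝ) • (w K' + w K)) (u K' - u K)
    have h4 := h.bound_S K K' h0 (w K' - w K) (u K' - u K)
    rw [vecNorm_smul, abs_of_pos (by norm_num : (0 : ℝ) < 1 / 2)] at h3
    have h5 := mul_le_mul_of_nonneg_left (mul_le_mul_of_nonneg_right (vecNorm_add_le (w K') (w K))
      (vecNorm_nonneg (u K' - u K))) hβ
    have h6 := mul_le_mul_of_nonneg_left (mul_le_mul_of_nonneg_right (vecNorm_sub_le (w K') (w K))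
      (vecNorm_nonneg (u K' - u K))) hβ
    linarith

end IsFluxData

end EdgeForm

theorem norm_le_of_abs_inner_le {V : Type*} [NormedAddCommGroup V] [InnerProductSpace ℝ V]
    {x : V} {c : ℝ} (hc : 0 ≤ c) (h : ∀ z, |inner ℝ x z| ≤ c * ‖z‖) : ‖x‖ ≤ c := by
  have h1 := (le_abs_self _).trans (h x)
  rw [real_inner_self_eq_norm_sq] at h1
  rcases eq_or_lt_of_le (norm_nonneg x) with h0 | h0
  · rwa [← h0]
  · nlinarith

/-- `satPropagator_energy_le` with all bounds stated in terms of bilinear forms. -/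
theorem satPropagator_energy_le_of_core {V : Type*} [AddCommGroup V] [Module ℝ V]
    [FiniteDimensional ℝ V] (c : InnerProductSpace.Core ℝ V) {s r : ℕ} (hs : 1 ≤ s) (hr : 1 ≤ r)
    {M₀ M₁ A : Module.End ℝ V} {κ Λ q ε : ℝ} {j : V → ℝ} (u : V) (hκ : 0 < κ) (hΛ : 0 ≤ Λ)
    (hε : 0 ≤ ε) (hε1 : ε ≤ 1) (hj : ∀ w, 0 ≤ j w) (hq1 : 1 ≤ q) (hq : 1 + (s : ℝ) ≤ q * κ)
    (hM : ∀ t ∈ Icc (0 : ℝ) 1, ∀ w, κ * c.inner w w ≤ c.inner ((M₀ - t • M₁) w) w)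
    (hsymm₀ : ∀ w z, c.inner (M₀ w) z = c.inner w (M₀ z))
    (hsymm₁ : ∀ w z, c.inner (M₁ w) z = c.inner w (M₁ z))
    (hMb : ∀ t ∈ Icc (0 : ℝ) 1, ∀ w z, |c.inner ((M₀ - t • M₁) w) z| ≤
      Λ * √(c.inner w w) * √(c.inner z z))
    (hA : ∀ w z, |1 / (r : ℝ) * c.inner (A w) z| ≤ ε * √(c.inner w w) * √(c.inner z z))
    (hM₁ : ∀ w z, |1 / (r : ℝ) * c.inner (M₁ w) z| ≤ ε * √(c.inner w w) * √(c.inner z z))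
    (hdiss : ∀ w, 2 * (1 / (r : ℝ) * c.inner (A w) w) + 1 / (r : ℝ) * c.inner (M₁ w) w =
      -2 * j w)
    (hres : ∀ w z, |1 / (r : ℝ) * (c.inner (A w) z + c.inner (M₁ w) z)| ≤
      √(ε * j w) * √(c.inner z z))
    (hadj : ∀ w z, |1 / (r : ℝ) * c.inner (A w) z| ≤ √(c.inner w w) * √(ε * j z))
    (hsmall : ε * (2 * (s * q ^ s) + Λ * ((s + Λ / κ) * q ^ s) ^ 2) ≤ 2) :
    c.inner ((M₀ - M₁) (satPropagator r s M₀ M₁ A u)) (satPropagator r s M₀ M₁ A u) ≤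
      c.inner (M₀ u) u := by
  -- The inner product is passed as a core and becomes a norm only here, which avoids a clash with
  -- the sup norm of `I → Fin b → ℝ`.
  let _ : NormedAddCommGroup V := c.toNormedAddCommGroup
  let _ : InnerProductSpace ℝ V := InnerProductSpace.ofCore c.toCore
  have hn (w : V) : √(c.inner w w) = ‖w‖ := rfl
  have hi (w z : V) : c.inner w z = inner ℝ w z := rfl
  have hnn (w : V) : c.inner w w = ‖w‖ ^ 2 := real_inner_self_eq_norm_sq w
  simp only [hn] at hMb hA hM₁ hres hadj
  simp only [hnn] at hM
  simp only [hi] at *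
  have hτ : 0 ≤ 1 / (r : ℝ) := by positivity
  refine satPropagator_energy_le hs hr u hκ hΛ hε hε1 hj hq1 hq hM hsymm₀ hsymm₁ ?_ ?_ ?_
    hdiss ?_ hadj hsmall
  · exact fun t ht w => norm_le_of_abs_inner_le (by positivity) (hMb t ht w)
  · refine fun w => norm_le_of_abs_inner_le (by positivity) fun z => ?_
    rw [inner_smul_left, RCLike.conj_to_real]
    exact hA w z
  · refine fun w => norm_le_of_abs_inner_le (by positivity) fun z => ?_
    rw [inner_smul_left, RCLike.conj_to_real]
    exact hM₁ w z
  · refine fun w => norm_le_of_abs_inner_le (Real.sqrt_nonneg _) fun z => ?_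
    rw [inner_smul_left, RCLike.conj_to_real, inner_add_left]
    exact hres w z

/-! ### Energy estimate in the volume-weighted inner product -/

section Weighted

variable {I : Type*} [Fintype I] {b : ℕ}

/-- The weighted inner product `∑_K p_K u_K · w_K`. -/
@[reducible]
noncomputable def weightedCore (p : I → ℝ) (hp : ∀ K, 0 < p K) :
    InnerProductSpace.Core ℝ (I → Fin b → ℝ) where
  inner u w := ∑ K, p K * (u K ⬝ᵥ w K)
  conj_inner_symm u w := by
    simp only [RCLike.conj_to_real]
    exact Finset.sum_congr rfl fun K _ => by rw [dotProduct_comm]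
  re_inner_nonneg u := by
    refine Finset.sum_nonneg fun K _ => mul_nonneg (hp K).le ?_
    rw [← vecNorm_sq]; positivity
  add_left u w z := by
    simp [add_dotProduct, mul_add, Finset.sum_add_distrib]
  smul_left u w c := by
    simp only [Pi.smul_apply, smul_dotProduct, smul_eq_mul, RCLike.conj_to_real, Finset.mul_sum]
    exact Finset.sum_congr rfl fun K _ => by ring
  definite u hu := by
    have h := (Finset.sum_eq_zero_iff_of_nonneg fun K _ => mul_nonneg (hp K).le (by
      rw [← vecNorm_sq]; positivity)).1 hu
    funext K
    have h1 := h K (Finset.mem_univ K)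
    rcases mul_eq_zero.1 h1 with h2 | h2
    · exact absurd h2 (hp K).ne'
    · exact dotProduct_self_eq_zero.1 h2

theorem abs_sum_mul_le_sqrt {p : I → ℝ} (hp : ∀ K, 0 < p K) {Λ : ℝ} (hΛ : 0 ≤ Λ)
    {Q : I → Matrix (Fin b) (Fin b) ℝ}
    (hQ : ∀ K x y, |(Q K *ᵥ x) ⬝ᵥ y| ≤ Λ * (vecNorm x * vecNorm y)) (u w : I → Fin b → ℝ) :
    |∑ K, p K * ((Q K *ᵥ u K) ⬝ᵥ w K)| ≤
      Λ * √(∑ K, p K * (u K ⬝ᵥ u K)) * √(∑ K, p K * (w K ⬝ᵥ w K)) := by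
  have h := Real.sum_mul_le_sqrt_mul_sqrt (Finset.univ : Finset I)
    (fun K => √(p K) * vecNorm (u K)) (fun K => √(p K) * vecNorm (w K))
  simp only [mul_pow, Real.sq_sqrt (hp _).le, vecNorm_sq] at h
  rw [mul_assoc]
  refine le_trans ?_ (mul_le_mul_of_nonneg_left h hΛ)
  refine (Finset.abs_sum_le_sum_abs _ _).trans ?_
  rw [Finset.mul_sum]
  refine Finset.sum_le_sum fun K _ => ?_
  rw [abs_mul, abs_of_pos (hp K)]
  calc _ ≤ p K * (Λ * (vecNorm (u K) * vecNorm (w K))) :=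
        mul_le_mul_of_nonneg_left (hQ K _ _) (hp K).le
    _ = _ := by
        have := Real.mul_self_sqrt (hp K).le
        linear_combination (-(Λ * vecNorm (u K) * vecNorm (w K))) * this

/-- The number $\eta$ plays the role of the CFL number: by `hθ` every trace costs a factor
$\sqrt\eta$. The operator $M_1$ is used in two forms, as a block diagonal for symmetry and
coercivity (`hM₁`) and as a facet sum for its interplay with $A$ (`hM₁'`). -/
theorem satPropagator_weighted_energy_le {p : I → ℝ} (hp : ∀ K, 0 < p K) {s r : ℕ} (hs : 1 ≤ s)
    (hr : 1 ≤ r) {M₀ M₁ A : Module.End ℝ (I → Fin b → ℝ)}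
    {P N : I → Matrix (Fin b) (Fin b) ℝ} {θ : I → I → ℝ} {D S : I → I → Matrix (Fin b) (Fin b) ℝ}
    {β σ κ Λ q η : ℝ} (u : I → Fin b → ℝ) (hκ : 0 < κ) (hΛ : 0 ≤ Λ) (hβ : 0 ≤ β) (hσ : 0 < σ)
    (hη : 0 ≤ η) (hq1 : 1 ≤ q) (hq : 1 + (s : ℝ) ≤ q * κ)
    (hε1 : η * (4 * β + 5 * β ^ 2 / σ) ≤ 1)
    (hsmall : η * (4 * β + 5 * β ^ 2 / σ) *
      (2 * (s * q ^ s) + Λ * ((s + Λ / κ) * q ^ s) ^ 2) ≤ 2)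
    (hflux : IsFluxData θ D S β σ) (hθ : ∀ K, ∑ K', θ K K' ≤ η * p K)
    (hPsymm : ∀ K, (P K).IsSymm) (hNsymm : ∀ K, (N K).IsSymm)
    (hcoer : ∀ t ∈ Icc (0 : ℝ) 1, ∀ K x, κ * (x ⬝ᵥ x) ≤ ((P K - t • N K) *ᵥ x) ⬝ᵥ x)
    (hbound : ∀ t ∈ Icc (0 : ℝ) 1, ∀ K x y,
      |((P K - t • N K) *ᵥ x) ⬝ᵥ y| ≤ Λ * (vecNorm x * vecNorm y))
    (hM₀ : ∀ u w : I → Fin b → ℝ, ∑ K, p K * (M₀ u K ⬝ᵥ w K) = ∑ K, p K * ((P K *ᵥ u K) ⬝ᵥ w K))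
    (hM₁ : ∀ u w : I → Fin b → ℝ, ∑ K, p K * (M₁ u K ⬝ᵥ w K) = ∑ K, p K * ((N K *ᵥ u K) ⬝ᵥ w K))
    (hM₁' : ∀ u w, 1 / (r : ℝ) * ∑ K, p K * (M₁ u K ⬝ᵥ w K) = outflowForm θ D u w)
    (hA : ∀ u w, 1 / (r : ℝ) * ∑ K, p K * (A u K ⬝ᵥ w K) = edgeForm θ D S u w) :
    ∑ K, p K * ((M₀ - M₁) (satPropagator r s M₀ M₁ A u) K ⬝ᵥ satPropagator r s M₀ M₁ A u K) ≤
      ∑ K, p K * (M₀ u K ⬝ᵥ u K) := by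
  -- The part $4\beta$ covers the norms $3\eta\beta$ and $\eta\beta$ of $\tau A$ and $\tau M_1$; the
  -- part $5\beta^2/\sigma$ covers $(\frac32\beta)^2\cdot2/\sigma$ from `hjump`.
  set ε := η * (4 * β + 5 * β ^ 2 / σ) with hε
  have hε0 : 0 ≤ ε := by positivity
  set c := weightedCore (b := b) p hp with hc
  have hi (u w : I → Fin b → ℝ) : c.inner u w = ∑ K, p K * (u K ⬝ᵥ w K) := rfl
  have htrace (w : I → Fin b → ℝ) : traceSq θ w ≤ η * c.inner w w := by
    rw [hi, Finset.mul_sum, traceSq]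
    refine Finset.sum_le_sum fun K _ => ?_
    rw [← Finset.sum_mul, ← vecNorm_sq, ← mul_assoc]
    exact mul_le_mul_of_nonneg_right (hθ K) (sq_nonneg _)
  have hstrace (w : I → Fin b → ℝ) : √(traceSq θ w) ≤ √η * √(c.inner w w) := by
    rw [← Real.sqrt_mul hη]
    exact Real.sqrt_le_sqrt (htrace w)
  have hj (w : I → Fin b → ℝ) : 0 ≤ dissipation θ S w := by
    have h1 := hflux.jumpSq_le_dissipation w
    have h2 := mul_nonneg hσ.le (hflux.jumpSq_nonneg w)
    linarith
  have hjump (w : I → Fin b → ℝ) :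
      3 / 2 * β * √η * √(jumpSq θ w) ≤ √(ε * dissipation θ S w) := by
    refine Real.le_sqrt_of_sq_le ?_
    rw [mul_pow, mul_pow, Real.sq_sqrt hη, Real.sq_sqrt (hflux.jumpSq_nonneg w)]
    have h1 := hflux.jumpSq_le_dissipation w
    have h2 : jumpSq θ w ≤ 2 / σ * dissipation θ S w := by
      rw [div_mul_eq_mul_div, le_div_iff₀ hσ]; linarith
    calc (3 / 2 * β) ^ 2 * η * jumpSq θ w ≤
          (3 / 2 * β) ^ 2 * η * (2 / σ * dissipation θ S w) :=
          mul_le_mul_of_nonneg_left h2 (by positivity)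
      _ = η * (9 / 2 * β ^ 2 / σ) * dissipation θ S w := by ring
      _ ≤ ε * dissipation θ S w := by
          refine mul_le_mul_of_nonneg_right (mul_le_mul_of_nonneg_left ?_ hη) (hj w)
          have h3 : 9 / 2 * β ^ 2 / σ ≤ 5 * β ^ 2 / σ := by gcongr; norm_num
          linarith
  have hsη : √η * √η = η := Real.mul_self_sqrt hη
  have hm (u w : I → Fin b → ℝ) : |outflowForm θ D u w| ≤
      η * β * (√(c.inner u u) * √(c.inner w w)) := by
    refine (hflux.abs_outflowForm_le hβ u w).trans ?_
    calc _ ≤ β * ((√η * √(c.inner u u)) * (√η * √(c.inner w w))) :=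
          mul_le_mul_of_nonneg_left (mul_le_mul (hstrace u) (hstrace w) (Real.sqrt_nonneg _)
            (by positivity)) hβ
      _ = (√η * √η) * β * (√(c.inner u u) * √(c.inner w w)) := by ring
      _ = _ := by rw [hsη]
  have ha (u w : I → Fin b → ℝ) : |edgeForm θ D S u w| ≤
      η * (3 * β) * (√(c.inner u u) * √(c.inner w w)) := by
    refine (hflux.abs_edgeForm_le hβ u w).trans ?_
    have h1 : √(jumpSq θ w) ≤ 2 * (√η * √(c.inner w w)) := by
      have h2 := Real.sqrt_le_sqrt (hflux.jumpSq_le w)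
      rw [Real.sqrt_mul (by norm_num : (0 : ℝ) ≤ 4), show (4 : ℝ) = 2 ^ 2 by norm_num,
        Real.sqrt_sq (by norm_num)] at h2
      exact h2.trans (mul_le_mul_of_nonneg_left (hstrace w) zero_le_two)
    calc _ ≤ 3 / 2 * β * ((√η * √(c.inner u u)) * (2 * (√η * √(c.inner w w)))) :=
          mul_le_mul_of_nonneg_left (mul_le_mul (hstrace u) h1 (Real.sqrt_nonneg _)
            (by positivity)) (by positivity)
      _ = (√η * √η) * (3 * β) * (√(c.inner u u) * √(c.inner w w)) := by ring
      _ = _ := by rw [hsη]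
  have hdiv : 0 ≤ 5 * β ^ 2 / σ := by positivity
  have hM (t : ℝ) (w z : I → Fin b → ℝ) : c.inner ((M₀ - t • M₁) w) z =
      ∑ K, p K * (((P K - t • N K) *ᵥ w K) ⬝ᵥ z K) := by
    have h1 : c.inner ((M₀ - t • M₁) w) z = ∑ K, p K * (M₀ w K ⬝ᵥ z K) -
        t * ∑ K, p K * (M₁ w K ⬝ᵥ z K) := by
      rw [hi, Finset.mul_sum, ← Finset.sum_sub_distrib]
      refine Finset.sum_congr rfl fun K _ => ?_
      simp only [LinearMap.sub_apply, LinearMap.smul_apply, Pi.sub_apply, Pi.smul_apply,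
        sub_dotProduct, smul_dotProduct, smul_eq_mul]
      ring
    rw [h1, hM₀, hM₁, Finset.mul_sum, ← Finset.sum_sub_distrib]
    refine Finset.sum_congr rfl fun K _ => ?_
    rw [Matrix.sub_mulVec, Matrix.smul_mulVec, sub_dotProduct, smul_dotProduct, smul_eq_mul]
    ring
  have hsymm {Q : Module.End ℝ (I → Fin b → ℝ)} {R : I → Matrix (Fin b) (Fin b) ℝ}
      (hR : ∀ K, (R K).IsSymm)
      (hQ : ∀ u w : I → Fin b → ℝ, ∑ K, p K * (Q u K ⬝ᵥ w K) = ∑ K, p K * ((R K *ᵥ u K) ⬝ᵥ w K))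
      (w z : I → Fin b → ℝ) : c.inner (Q w) z = c.inner w (Q z) := by
    have h1 : c.inner w (Q z) = ∑ K, p K * (Q z K ⬝ᵥ w K) :=
      Finset.sum_congr rfl fun K _ => by rw [dotProduct_comm]
    rw [h1, hi, hQ, hQ]
    refine Finset.sum_congr rfl fun K _ => ?_
    rw [dotProduct_comm, Matrix.dotProduct_mulVec, ← Matrix.mulVec_transpose, (hR K).eq]
  refine satPropagator_energy_le_of_core c hs hr (j := dissipation θ S) u hκ hΛ hε0 hε1 hj hq1 hq
    ?_ (hsymm hPsymm hM₀) (hsymm hNsymm hM₁) ?_ ?_ ?_ ?_ ?_ ?_ hsmall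
  · intro t ht w
    rw [hM, hi, Finset.mul_sum]
    refine Finset.sum_le_sum fun K _ => ?_
    calc _ = p K * (κ * (w K ⬝ᵥ w K)) := by ring
      _ ≤ _ := mul_le_mul_of_nonneg_left (hcoer t ht K _) (hp K).le
  · intro t ht w z
    rw [hM]
    exact abs_sum_mul_le_sqrt hp hΛ (hbound t ht) w z
  · intro w z
    rw [hi (A w), hA, mul_assoc]
    refine (ha w z).trans (mul_le_mul_of_nonneg_right ?_ (by positivity))
    exact mul_le_mul_of_nonneg_left (by linarith) hη
  · intro w z
    rw [hi (M₁ w), hM₁', mul_assoc]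
    refine (hm w z).trans (mul_le_mul_of_nonneg_right ?_ (by positivity))
    exact mul_le_mul_of_nonneg_left (by linarith) hη
  · intro w
    rw [hi (A w), hi (M₁ w), hA, hM₁', hflux.two_mul_edgeForm_self]
  · intro w z
    rw [mul_add, hi (A w), hi (M₁ w), hA, hM₁']
    refine (hflux.abs_edgeForm_add_outflowForm_le hβ w z).trans ?_
    calc _ ≤ 3 / 2 * β * (√(jumpSq θ w) * (√η * √(c.inner z z))) := by
          gcongr; exact hstrace z
      _ = (3 / 2 * β * √η * √(jumpSq θ w)) * √(c.inner z z) := by ring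
      _ ≤ _ := mul_le_mul_of_nonneg_right (hjump w) (Real.sqrt_nonneg _)
  · intro w z
    rw [hi (A w), hA]
    refine (hflux.abs_edgeForm_le hβ w z).trans ?_
    calc _ ≤ 3 / 2 * β * ((√η * √(c.inner w w)) * √(jumpSq θ z)) := by
          gcongr; exact hstrace w
      _ = √(c.inner w w) * (3 / 2 * β * √η * √(jumpSq θ z)) := by ring
      _ ≤ _ := mul_le_mul_of_nonneg_left (hjump z) (Real.sqrt_nonneg _)

end Weighted

/-! ### Barycentric coordinates and facet integrals on a simplex -/

section Simplex

variable {d : ℕ} {K : Finset (E d)}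

/-- `K` is the vertex set of a nondegenerate `d`-simplex in `ℝ^d`. -/
def IsSimplex (K : Finset (E d)) : Prop :=
  AffineIndependent ℝ ((↑) : K → E d) ∧ K.card = d + 1

/-- The vertices of a `d`-simplex as an affine basis of `ℝ^d`. -/
noncomputable def simplexBasis (hK : IsSimplex K) : AffineBasis K ℝ (E d) :=
  ⟨(↑), hK.1, hK.1.affineSpan_eq_top_iff_card_eq_finrank_add_one.2 (by simp [hK.2])⟩

open Classical in
/-- The barycentric coordinate of the vertex `z` of the simplex `K`. -/
noncomputable def bary (K : Finset (E d)) (z : E d) : E d →ᵃ[ℝ] ℝ :=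
  if h : IsSimplex K ∧ z ∈ K then (simplexBasis h.1).coord ⟨z, h.2⟩ else 0

theorem bary_eq (hK : IsSimplex K) (z : K) : bary K z = (simplexBasis hK).coord z := by
  rw [bary, dif_pos ⟨hK, z.2⟩]

theorem bary_self (hK : IsSimplex K) {z : E d} (hz : z ∈ K) : bary K z z = 1 := by
  rw [bary_eq hK ⟨z, hz⟩]
  exact (simplexBasis hK).coord_apply_eq ⟨z, hz⟩

theorem bary_of_ne (hK : IsSimplex K) {z y : E d} (hz : z ∈ K) (hy : y ∈ K) (h : z ≠ y) :
    bary K z y = 0 := by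
  rw [bary_eq hK ⟨z, hz⟩]
  exact (simplexBasis hK).coord_apply_ne (i := ⟨z, hz⟩) (j := ⟨y, hy⟩)
    (fun h' => h (congrArg Subtype.val h'))

theorem sum_bary (hK : IsSimplex K) (x : E d) : ∑ z ∈ K, bary K z x = 1 := by
  rw [← (simplexBasis hK).sum_coord_apply_eq_one x, ← Finset.sum_coe_sort]
  exact Finset.sum_congr rfl fun z _ => by rw [bary_eq hK]

theorem sum_bary_smul (hK : IsSimplex K) (x : E d) : ∑ z ∈ K, bary K z x • z = x := by
  conv_rhs => rw [← (simplexBasis hK).linear_combination_coord_eq_self x]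
  rw [← Finset.sum_coe_sort]
  exact Finset.sum_congr rfl fun z _ => by rw [bary_eq hK]; rfl

theorem mem_hull_iff (hK : IsSimplex K) {x : E d} : x ∈ hull K ↔ ∀ z ∈ K, 0 ≤ bary K z x := by
  have h : hull K = convexHull ℝ (range (simplexBasis hK)) := by
    rw [hull]; congr 1; exact Subtype.range_coe.symm
  rw [h, AffineBasis.convexHull_eq_nonneg_coord]
  refine ⟨fun hx z hz => ?_, fun hx z => ?_⟩
  · rw [bary_eq hK ⟨z, hz⟩]; exact hx _
  · rw [← bary_eq hK]; exact hx z z.2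

theorem mem_interior_hull_iff (hK : IsSimplex K) {x : E d} :
    x ∈ interior (hull K) ↔ ∀ z ∈ K, 0 < bary K z x := by
  have h : hull K = convexHull ℝ (range (simplexBasis hK)) := by
    rw [hull]; congr 1; exact Subtype.range_coe.symm
  rw [h, AffineBasis.interior_convexHull]
  refine ⟨fun hx z hz => ?_, fun hx z => ?_⟩
  · rw [bary_eq hK ⟨z, hz⟩]; exact hx _
  · rw [← bary_eq hK]; exact hx z z.2

theorem affine_eq_sum_bary (hK : IsSimplex K) (a : E d →ᵃ[ℝ] ℝ) (x : E d) :
    a x = ∑ z ∈ K, bary K z x * a z := by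
  have h : x = K.affineCombination ℝ id (fun z => bary K z x) := by
    rw [Finset.affineCombination_eq_linear_combination _ _ _ (sum_bary hK x)]
    exact (sum_bary_smul hK x).symm
  conv_lhs => rw [h]
  rw [Finset.map_affineCombination _ _ _ (sum_bary hK x),
    Finset.affineCombination_eq_linear_combination _ _ _ (sum_bary hK x)]
  rfl

/-- The vector representing the linear part of an affine function. -/
noncomputable def affGrad (a : E d →ᵃ[ℝ] ℝ) : E d :=
  (InnerProductSpace.toDual ℝ (E d)).symm (LinearMap.toContinuousLinearMap a.linear)

theorem inner_affGrad (a : E d →ᵃ[ℝ] ℝ) (x : E d) : inner ℝ (affGrad a) x = a.linear x := by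
  rw [affGrad, InnerProductSpace.toDual_symm_apply]
  rfl

theorem affine_add (a : E d →ᵃ[ℝ] ℝ) (x y : E d) : a (x + y) = a x + inner ℝ (affGrad a) y := by
  rw [inner_affGrad, add_comm x y]
  have h := a.map_vadd x y
  rw [vadd_eq_add, vadd_eq_add] at h
  rw [h, add_comm]

theorem affine_sub (a : E d →ᵃ[ℝ] ℝ) (x y : E d) : a x - a y = inner ℝ (affGrad a) (x - y) := by
  have h := affine_add a y (x - y)
  rw [add_sub_cancel] at h
  linarith

theorem continuous_affine (a : E d →ᵃ[ℝ] ℝ) : Continuous a :=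
  AffineMap.continuous_of_finiteDimensional a

theorem hasGradientAt_affine (a : E d →ᵃ[ℝ] ℝ) (x : E d) : HasGradientAt a (affGrad a) x := by
  rw [hasGradientAt_iff_hasFDerivAt, affGrad, LinearIsometryEquiv.apply_symm_apply]
  have h : HasFDerivAt (fun y => a x + (LinearMap.toContinuousLinearMap a.linear) (y - x))
      (LinearMap.toContinuousLinearMap a.linear) x := by
    have := ((LinearMap.toContinuousLinearMap a.linear).hasFDerivAt.comp x
      ((hasFDerivAt_id x).sub_const x)).const_add (a x)
    simpa using this
  refine h.congr_of_eventuallyEq (Filter.Eventually.of_forall fun y => ?_)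
  have h1 := affine_sub a y x
  rw [inner_affGrad] at h1
  change a y = a x + a.linear (y - x)
  linarith

theorem affGrad_eq_of_inner {a : E d →ᵃ[ℝ] ℝ} {g : E d}
    (h : ∀ y, a.linear y = inner ℝ g y) : affGrad a = g :=
  ext_inner_right ℝ fun y => by rw [inner_affGrad, h]

theorem affine_linear_eq (a : E d →ᵃ[ℝ] ℝ) (y : E d) : a.linear y = a y - a 0 := by
  rw [affine_sub, sub_zero, inner_affGrad]

theorem affGrad_eq_sum (hK : IsSimplex K) (a : E d →ᵃ[ℝ] ℝ) :
    affGrad a = ∑ z ∈ K, a z • affGrad (bary K z) := by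
  refine affGrad_eq_of_inner fun y => ?_
  rw [sum_inner, affine_linear_eq, affine_eq_sum_bary hK a y, affine_eq_sum_bary hK a 0,
    ← Finset.sum_sub_distrib]
  refine Finset.sum_congr rfl fun z _ => ?_
  rw [inner_smul_left, inner_affGrad, affine_linear_eq, RCLike.conj_to_real]
  ring

theorem sum_affGrad_bary (hK : IsSimplex K) : ∑ z ∈ K, affGrad (bary K z) = 0 := by
  have h := affGrad_eq_sum hK (AffineMap.const ℝ (E d) (1 : ℝ))
  simp only [AffineMap.const_apply, one_smul] at h
  rw [← h]
  exact affGrad_eq_of_inner fun y => by simp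

theorem affGrad_bary_ne_zero (hK : IsSimplex K) {z y : E d} (hz : z ∈ K) (hy : y ∈ K)
    (h : z ≠ y) : affGrad (bary K z) ≠ 0 := by
  intro h0
  have h1 := affine_sub (bary K z) z y
  rw [bary_self hK hz, bary_of_ne hK hz hy h, h0, inner_zero_left] at h1
  norm_num at h1

theorem exists_mem_ne (hd : 1 ≤ d) (hK : IsSimplex K) (z : E d) : ∃ y ∈ K, y ≠ z := by
  have h : 1 < K.card := by rw [hK.2]; omega
  exact Finset.exists_mem_ne h z

/-- Shape regularity bounds the gradients of the barycentric coordinates. -/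
theorem norm_affGrad_bary_mul_le (hK : IsSimplex K) {z : E d} (hz : z ∈ K) {c : E d} {ρ : ℝ}
    (hball : Metric.ball c (ρ / 2) ⊆ hull K) :
    ‖affGrad (bary K z)‖ * ρ ≤ 1 := by
  set g := affGrad (bary K z) with hg
  rcases eq_or_ne g 0 with h0 | h0
  · rw [h0]; simp
  have hgn : 0 < ‖g‖ := norm_pos_iff.2 h0
  have hle : ∀ x ∈ hull K, bary K z x ≤ 1 := by
    intro x hx
    rw [← sum_bary hK x]
    exact Finset.single_le_sum (f := fun z => bary K z x)
      (fun y hy => (mem_hull_iff hK).1 hx y hy) hz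
  refine le_of_forall_lt_imp_le_of_dense fun m hm => ?_
  rcases le_or_gt m 0 with hm0 | hm0
  · linarith
  -- The points $c\pm e$, with $e$ of length $s$ along $g$, lie in the open ball. The coordinate
  -- differs by $m$ between them and takes values in $[0,1]$ on the simplex.
  set s := m / (2 * ‖g‖) with hs
  have hsρ : s < ρ / 2 := by
    rw [hs, div_lt_div_iff₀ (by positivity) two_pos]
    nlinarith
  have hs0 : 0 < s := by positivity
  set e := (s / ‖g‖) • g with he
  have hen : ‖e‖ = s := by
    rw [he, norm_smul, Real.norm_of_nonneg (by positivity), div_mul_cancel₀ _ hgn.ne']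
  have h1 := hle (c + e) (hball (by simp [hen, hsρ]))
  have h2 := (mem_hull_iff hK).1 (hball (by simp [hen, hsρ] : c + -e ∈ Metric.ball c (ρ / 2))) z hz
  rw [affine_add] at h1 h2
  rw [inner_neg_right, ← hg] at h2
  rw [← hg] at h1
  have h3 : inner ℝ g e = m / 2 := by
    rw [he, inner_smul_right, real_inner_self_eq_norm_sq, hs]
    field_simp
  linarith

theorem bary_eq_zero_of_mem_convexHull (hK : IsSimplex K) {S : Set (E d)} (hS : S ⊆ K) {z : E d}
    (hz : z ∈ K) (hzS : z ∉ S) {x : E d} (hx : x ∈ convexHull ℝ S) : bary K z x = 0 := by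
  have hconv : Convex ℝ (bary K z ⁻¹' {0}) := (convex_singleton 0).affine_preimage _
  exact convexHull_min (fun y hy => bary_of_ne hK hz (hS hy) (by rintro rfl; exact hzS hy))
    hconv hx

theorem mem_hull_facet_iff (hK : IsSimplex K) {F : Finset (E d)} {w : E d}
    (hw : w ∈ K) (hF : ∀ y, y ∈ F ↔ y ∈ K ∧ y ≠ w) {x : E d} :
    x ∈ hull F ↔ x ∈ hull K ∧ bary K w x = 0 := by
  constructor
  · intro hx
    have hFK : (F : Set (E d)) ⊆ K := fun y hy => ((hF y).1 hy).1
    exact ⟨convexHull_mono hFK hx,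
      bary_eq_zero_of_mem_convexHull hK hFK hw (fun h => ((hF w).1 h).2 rfl) hx⟩
  · rintro ⟨hx, h0⟩
    have hsub : F ⊆ K := fun y hy => ((hF y).1 hy).1
    have hz : ∀ y ∈ K, y ∉ F → bary K y x = 0 := by
      intro y hy hyF
      have : y = w := by
        by_contra h
        exact hyF ((hF y).2 ⟨hy, h⟩)
      rw [this, h0]
    have h1 := sum_bary hK x
    have h2 := sum_bary_smul hK x
    rw [← Finset.sum_subset hsub hz] at h1
    rw [← Finset.sum_subset hsub fun y hy hyF => by rw [hz y hy hyF, zero_smul]] at h2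
    rw [← h2]
    exact (convex_convexHull ℝ (F : Set (E d))).sum_mem
      (fun y hy => (mem_hull_iff hK).1 hx y (hsub hy)) h1
      (fun y hy => subset_convexHull ℝ _ hy)

theorem measurableSet_hull (K : Finset (E d)) : MeasurableSet (hull K) :=
  (K.finite_toSet.isClosed_convexHull ℝ).measurableSet

/-- Coarea formula for an affine function. -/
theorem lintegral_slices (a : E d →ᵃ[ℝ] ℝ) (ha : affGrad a ≠ 0)
    {t : Set (E d)} (ht : MeasurableSet t) :
    ∫⁻ s : ℝ, μHE[d - 1] (t ∩ {x | a x = s}) = volume t * ENNReal.ofReal ‖affGrad a‖ := by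
  set g := affGrad a with hg
  have hgn : 0 < ‖g‖ := norm_pos_iff.2 ha
  -- Scaled so that $a$ increases by $1$ along $e$, while $p$ below is a zero of $a$; the slices
  -- orthogonal to $e$ are then labelled by the values of $a$.
  set e : E d := (1 / ‖g‖ ^ 2) • g with he
  have hen : ‖e‖ = 1 / ‖g‖ := by
    rw [he, norm_smul, Real.norm_of_nonneg (by positivity)]
    field_simp
  have he0 : e ≠ 0 := by
    rw [← norm_pos_iff, hen]; positivity
  set p : E d := -(a 0) • e with hp
  have hae (c : ℝ) : a (c • e + p) = c := by
    have h1 := affine_add a 0 (c • e + p)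
    rw [zero_add] at h1
    rw [h1, ← hg, hp, ← add_smul, inner_smul_right, he, inner_smul_right,
      real_inner_self_eq_norm_sq]
    field_simp
    ring
  have h := EuclideanGeometry.euclideanHausdorffMeasure_eq_lintegral p he0 ht
  rw [finrank_euclideanSpace_fin, EuclideanSpace.euclideanHausdorffMeasure_eq_volume] at h
  have hset (c : ℝ) : (AffineSubspace.mk' (c • e +ᵥ p) (ℝ ∙ e)ᗮ : Set (E d)) = {x | a x = c} := by
    ext x
    rw [SetLike.mem_coe, AffineSubspace.mem_mk', Submodule.mem_orthogonal_singleton_iff_inner_right,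
      vsub_eq_sub, vadd_eq_add, he, inner_smul_left, ← he, ← affine_sub, hae, mem_ofPred_eq,
      mul_eq_zero, sub_eq_zero]
    simp [hgn.ne']
  simp only [hset] at h
  rw [h, mul_right_comm, ← ofReal_norm, hen, ← ENNReal.ofReal_mul (by positivity),
    one_div_mul_cancel hgn.ne', ENNReal.ofReal_one, one_mul]

/-- The integral of the hat function of the vertex `v` over the facet opposite to `w`. -/
theorem integral_bary_facet (hK : IsSimplex K) {F : Finset (E d)} {v w : E d}
    (hv : v ∈ K) (hw : w ∈ K) (hvw : v ≠ w) (hF : ∀ y, y ∈ F ↔ y ∈ K ∧ y ≠ w) :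
    ∫ x in hull F, bary K v x ∂μHE[d - 1] =
      (volume (hull K)).toReal * ‖affGrad (bary K w)‖ := by
  have hnn : 0 ≤ᵐ[(μHE[d - 1] : Measure (E d)).restrict (hull F)] bary K v := by
    filter_upwards [ae_restrict_mem (measurableSet_hull F)] with x hx
    exact (mem_hull_iff hK).1 ((mem_hull_facet_iff hK hw hF).1 hx).1 v hv
  have hmeas : Measurable (bary K v) := (continuous_affine _).measurable
  rw [integral_eq_lintegral_of_nonneg_ae hnn hmeas.aestronglyMeasurable,
    lintegral_eq_lintegral_meas_le _ hnn hmeas.aemeasurable]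
  -- Translation by $t(w-v)$ carries the part of the facet with $\lambda_v\ge t$ onto the slice
  -- $\lambda_w=t$ of $K$. Thus the layer cake formula on the facet becomes the coarea formula on
  -- $K$.
  have hslice : ∀ t ∈ Ioi (0 : ℝ), (μHE[d - 1] : Measure (E d)).restrict (hull F)
      {x | t ≤ bary K v x} = μHE[d - 1] (hull K ∩ {x | bary K w x = t}) := by
    intro t ht
    rw [Measure.restrict_apply' (measurableSet_hull F)]
    have himg : hull K ∩ {x | bary K w x = t} =
        (fun x => x + t • (w - v)) '' ({x | t ≤ bary K v x} ∩ hull F) := by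
      have hval (y : E d) (hy : y ∈ K) (x : E d) (c : ℝ) : bary K y (x + c • (w - v)) =
          bary K y x + c * (bary K y w - bary K y v) := by
        rw [affine_add, inner_smul_right, ← affine_sub]
      ext x
      constructor
      · rintro ⟨hx, hxt⟩
        refine ⟨x + (-t) • (w - v), ⟨?_, ?_⟩, by simp⟩
        · rw [mem_ofPred_eq, hval v hv, bary_self hK hv, bary_of_ne hK hv hw hvw]
          have := (mem_hull_iff hK).1 hx v hv
          linarith
        · rw [mem_hull_facet_iff hK hw hF]
          have hw0 : bary K w (x + (-t) • (w - v)) = 0 := by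
            rw [hval w hw, bary_self hK hw, bary_of_ne hK hw hv hvw.symm, hxt]
            ring
          refine ⟨(mem_hull_iff hK).2 fun y hy => ?_, hw0⟩
          rcases eq_or_ne y w with rfl | hyw
          · exact hw0.ge
          · rw [hval y hy, bary_of_ne hK hy hw hyw]
            have h1 := (mem_hull_iff hK).1 hx y hy
            have h2 : 0 ≤ bary K y v := (mem_hull_iff hK).1 (subset_convexHull ℝ _ hv) y hy
            nlinarith [mul_nonneg (le_of_lt ht) h2]
      · rintro ⟨x, ⟨hxt, hx⟩, rfl⟩
        obtain ⟨hx, hx0⟩ := (mem_hull_facet_iff hK hw hF).1 hx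
        refine ⟨(mem_hull_iff hK).2 fun y hy => ?_, ?_⟩
        · rw [hval y hy]
          have h1 := (mem_hull_iff hK).1 hx y hy
          rcases eq_or_ne y v with rfl | hyv
          · rw [bary_self hK hy, bary_of_ne hK hy hw hvw]
            have : t ≤ bary K y x := hxt
            linarith
          · rw [bary_of_ne hK hy hv hyv]
            have h2 : 0 ≤ bary K y w := (mem_hull_iff hK).1 (subset_convexHull ℝ _ hw) y hy
            nlinarith [mul_nonneg (le_of_lt ht) h2]
        · rw [mem_ofPred_eq, hval w hw, bary_self hK hw, bary_of_ne hK hw hv hvw.symm, hx0]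
          ring
    rw [himg, (isometry_add_right (t • (w - v))).euclideanHausdorffMeasure_image]
  rw [setLIntegral_congr_fun measurableSet_Ioi hslice]
  have htot := lintegral_slices (bary K w) (affGrad_bary_ne_zero hK hw hv hvw.symm)
    (measurableSet_hull K)
  -- The slice at level $0$ is the facet itself, but a single level is negligible; the slices at
  -- negative levels are empty.
  rw [← lintegral_add_compl _ (measurableSet_Ioi (a := (0 : ℝ))), compl_Ioi,
    ← setLIntegral_congr Iio_ae_eq_Iic] at htot
  have hneg : ∫⁻ t in Iio (0 : ℝ), μHE[d - 1] (hull K ∩ {x | bary K w x = t}) = 0 := by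
    rw [setLIntegral_congr_fun (g := fun _ => 0) measurableSet_Iio, lintegral_zero]
    intro t ht
    have : hull K ∩ {x | bary K w x = t} = ∅ := by
      ext x
      simp only [mem_inter_iff, mem_ofPred_eq, mem_empty_iff_false, iff_false, not_and]
      intro hx hxt
      have := (mem_hull_iff hK).1 hx w hw
      rw [hxt] at this
      exact absurd ht (not_lt.2 this)
    simp [this]
  rw [hneg, add_zero] at htot
  rw [htot, ENNReal.toReal_mul, ENNReal.toReal_ofReal (norm_nonneg _)]

end Simplex

/-! ### Neighbouring elements and facet normals -/

section Mesh

variable {d : ℕ} {Ω : Set (E d)} {K K' K'' : Finset (E d)} {w w' w'' : E d}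

theorem SimplicialMesh.isSimplex {T : SimplicialMesh d Ω} (hK : K ∈ T.elements) : IsSimplex K :=
  ⟨T.indep hK.1, hK.2⟩

theorem SimplicialMesh.mem_patch {T : SimplicialMesh d Ω} {v : E d} :
    K ∈ T.patch v ↔ K ∈ T.elements ∧ v ∈ K :=
  (T.finite_patch v).mem_toFinset

/-- The relative interior of a facet meets every neighbourhood of each of its vertices. -/
theorem exists_facet_point (hK : IsSimplex K) {U : Set (E d)} (hU : IsOpen U) {v : E d}
    (hvU : v ∈ U) (hv : v ∈ K) (hw : w ∈ K) (hvw : v ≠ w) :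
    ∃ x ∈ U, bary K w x = 0 ∧ ∀ z ∈ K, z ≠ w → 0 < bary K z x := by
  classical
  -- A small move from $v$ along $e$ stays in the hyperplane of the facet and makes the coordinates
  -- of all its other vertices positive.
  set e : E d := ∑ z ∈ K.erase w, (z - v) with he
  have hval (y : E d) (t : ℝ) : bary K y (v + t • e) =
      bary K y v + t * ∑ z ∈ K.erase w, (bary K y z - bary K y v) := by
    rw [affine_add, inner_smul_right, he, inner_sum]
    simp only [← affine_sub]
  have hcont : Filter.Tendsto (fun t : ℝ => v + t • e) (nhdsWithin 0 (Ioi 0)) (nhds v) := by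
    have : Continuous fun t : ℝ => v + t • e := by fun_prop
    have h := this.tendsto 0
    rw [zero_smul, add_zero] at h
    exact h.mono_left nhdsWithin_le_nhds
  have hV : {x | 0 < bary K v x} ∈ nhds v :=
    (isOpen_lt continuous_const (continuous_affine _)).mem_nhds (by
      rw [mem_ofPred_eq, bary_self hK hv]; exact one_pos)
  obtain ⟨t, ⟨ht, htv⟩, ht0⟩ := ((hcont.eventually (hU.mem_nhds hvU)).and
    (hcont.eventually hV)).and self_mem_nhdsWithin |>.exists
  refine ⟨v + t • e, ht, ?_, fun z hz hzw => ?_⟩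
  · rw [hval, bary_of_ne hK hw hv hvw.symm, Finset.sum_eq_zero, mul_zero, add_zero]
    intro z hz
    rw [bary_of_ne hK hw (Finset.mem_of_mem_erase hz) (Finset.ne_of_mem_erase hz).symm, sub_zero]
  · rcases eq_or_ne z v with rfl | hzv
    · exact htv
    · rw [hval, bary_of_ne hK hz hv hzv, Finset.sum_eq_single z, bary_self hK hz]
      · have : (0 : ℝ) < t := ht0
        linarith
      · intro y hy hyz
        rw [bary_of_ne hK hz (Finset.mem_of_mem_erase hy) hyz.symm, sub_zero]
      · intro h
        exact absurd (Finset.mem_erase.2 ⟨hzw, hz⟩) h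

/-- The simplices `K` and `K'` share the facet that is opposite to `w` in `K` and to `w'` in
`K'`. -/
structure SharesFacet (K K' : Finset (E d)) (w w' : E d) : Prop where
  left : w ∈ K
  right : w' ∈ K'
  iff_left : ∀ y, y ∈ K ∧ y ∈ K' ↔ y ∈ K ∧ y ≠ w
  iff_right : ∀ y, y ∈ K ∧ y ∈ K' ↔ y ∈ K' ∧ y ≠ w'

theorem SharesFacet.symm (h : SharesFacet K K' w w') : SharesFacet K' K w' w :=
  ⟨h.right, h.left, fun y => and_comm.trans (h.iff_right y),
    fun y => and_comm.trans (h.iff_left y)⟩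

open Classical in
theorem mem_facet {y : E d} : y ∈ facet K K' ↔ y ∈ K ∧ y ∈ K' := Finset.mem_inter

open Classical in
theorem facet_comm (K K' : Finset (E d)) : facet K K' = facet K' K := Finset.inter_comm _ _

theorem exists_opposite {F : Finset (E d)} (hK : K.card = d + 1) (hF : F.card = d) (hFK : F ⊆ K) :
    ∃ w ∈ K, ∀ y, y ∈ F ↔ y ∈ K ∧ y ≠ w := by
  classical
  have h1 : (K \ F).card = 1 := by
    rw [Finset.card_sdiff_of_subset hFK]; omega
  obtain ⟨w, hw⟩ := Finset.card_eq_one.1 h1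
  have hmem (y : E d) : y ∈ K ∧ y ∉ F ↔ y = w := by
    rw [← Finset.mem_sdiff, hw, Finset.mem_singleton]
  refine ⟨w, ((hmem w).2 rfl).1, fun y => ⟨fun hy => ⟨hFK hy, ?_⟩, fun hy => ?_⟩⟩
  · rintro rfl
    exact ((hmem y).2 rfl).2 hy
  · by_contra h
    exact hy.2 ((hmem y).1 ⟨hy.1, h⟩)

theorem exists_sharesFacet (hK : K.card = d + 1) (hK' : K'.card = d + 1)
    (h : (facet K K').card = d) : ∃ w w', SharesFacet K K' w w' := by
  obtain ⟨w, hw, h1⟩ := exists_opposite hK h fun y hy => (mem_facet.1 hy).1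
  obtain ⟨w', hw', h2⟩ := exists_opposite hK' h fun y hy => (mem_facet.1 hy).2
  exact ⟨w, w', hw, hw', fun y => by rw [← mem_facet, h1], fun y => by rw [← mem_facet, h2]⟩

theorem SharesFacet.card_facet (h : SharesFacet K K' w w') (hK : K.card = d + 1) :
    (facet K K').card = d := by
  classical
  have : facet K K' = K.erase w := by
    ext y
    rw [mem_facet, h.iff_left, Finset.mem_erase, and_comm]
  rw [this, Finset.card_erase_of_mem h.left, hK, Nat.add_sub_cancel]

theorem SharesFacet.notMem_right (h : SharesFacet K K' w w') : w ∉ K' := fun hw =>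
  ((h.iff_left w).1 ⟨h.left, hw⟩).2 rfl

theorem SharesFacet.mem_of_ne (h : SharesFacet K K' w w') {y : E d} (hy : y ∈ K) (hyw : y ≠ w) :
    y ∈ K' := ((h.iff_left y).2 ⟨hy, hyw⟩).2

/-- Both coordinates vanish on the common facet, so one is a multiple of the other; the factor is
read off at $w'$. -/
theorem SharesFacet.bary_mul (h : SharesFacet K K' w w') (hK : IsSimplex K) (hK' : IsSimplex K')
    (x : E d) : bary K' w' x * bary K w w' = bary K w x := by
  rw [affine_eq_sum_bary hK' (bary K w) x, Finset.sum_eq_single w']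
  · intro y hy hyw
    have hyK := h.symm.mem_of_ne hy hyw
    rw [bary_of_ne hK h.left hyK (by rintro rfl; exact h.notMem_right hy), mul_zero]
  · exact fun h' => absurd h.right h'

theorem SharesFacet.affGrad_eq (h : SharesFacet K K' w w') (hK : IsSimplex K)
    (hK' : IsSimplex K') :
    affGrad (bary K w) = bary K w w' • affGrad (bary K' w') := by
  refine affGrad_eq_of_inner fun y => ?_
  rw [inner_smul_left, inner_affGrad, affine_linear_eq, affine_linear_eq, ← h.bary_mul hK hK' y,
    ← h.bary_mul hK hK' 0, RCLike.conj_to_real]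
  ring

/-- Two elements that share a facet lie on opposite sides of it. -/
theorem SharesFacet.bary_neg {T : SimplicialMesh d Ω} (hd : 1 ≤ d) (h : SharesFacet K K' w w')
    (hK : K ∈ T.elements) (hK' : K' ∈ T.elements) : bary K w w' < 0 := by
  have sK := T.isSimplex hK
  have sK' := T.isSimplex hK'
  by_contra hneg
  rcases eq_or_lt_of_le (not_lt.1 hneg) with h0 | hpos
  · have h1 := h.bary_mul sK sK' w
    rw [← h0, mul_zero, bary_self sK h.left] at h1
    norm_num at h1
  -- If $\lambda_w(w')>0$, a short move towards $w'$ from a point in the relative interior of the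
  -- facet stays in both elements. By conformity it remains in the hull of the common vertices,
  -- where $\lambda_w=0$.
  obtain ⟨v, hv, hvw⟩ := exists_mem_ne hd sK w
  obtain ⟨x, -, hx0, hx⟩ := exists_facet_point sK isOpen_univ (mem_univ v) hv h.left hvw
  have hF : ∀ y, y ∈ facet K K' ↔ y ∈ K ∧ y ≠ w := fun y => by rw [mem_facet, h.iff_left]
  have hxF : x ∈ hull (facet K K') := by
    rw [mem_hull_facet_iff sK h.left hF]
    refine ⟨(mem_hull_iff sK).2 fun z hz => ?_, hx0⟩
    rcases eq_or_ne z w with rfl | hzw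
    · exact hx0.ge
    · exact (hx z hz hzw).le
  have hxK' : x ∈ hull K' := convexHull_mono (fun y hy => (mem_facet.1 hy).2) hxF
  have hcont : Filter.Tendsto (fun t : ℝ => x + t • (w' - x)) (nhdsWithin 0 (Ioi 0))
      (nhds x) := by
    have : Continuous fun t : ℝ => x + t • (w' - x) := by fun_prop
    have h := this.tendsto 0
    rw [zero_smul, add_zero] at h
    exact h.mono_left nhdsWithin_le_nhds
  have hev : ∀ᶠ y in nhds x, ∀ z ∈ (K : Set (E d)) \ {w}, 0 < bary K z y := by
    refine (Filter.eventually_all_finite (K.finite_toSet.sdiff)).2 fun z hz => ?_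
    exact (isOpen_lt continuous_const (continuous_affine _)).mem_nhds (hx z hz.1 hz.2)
  obtain ⟨t, ⟨ht, ht1⟩, ht0⟩ := ((hcont.eventually hev).and
    (nhdsWithin_le_nhds (Iio_mem_nhds zero_lt_one))).and self_mem_nhdsWithin |>.exists
  have ht0 : 0 < t := ht0
  have hw : bary K w (x + t • (w' - x)) = t * bary K w w' := by
    rw [affine_add, inner_smul_right, ← affine_sub, hx0]
    ring
  have hmem : x + t • (w' - x) ∈ hull K ∩ hull K' := by
    refine ⟨(mem_hull_iff sK).2 fun z hz => ?_, ?_⟩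
    · rcases eq_or_ne z w with rfl | hzw
      · rw [hw]; positivity
      · exact (ht z ⟨hz, hzw⟩).le
    · exact (convex_convexHull ℝ _).add_smul_sub_mem hxK' (subset_convexHull ℝ _ h.right)
        ⟨ht0.le, (le_of_lt ht1)⟩
  have h1 := bary_eq_zero_of_mem_convexHull sK inter_subset_left h.left
    (fun hh => h.notMem_right hh.2) (T.inter_subset_convexHull hK.1 hK'.1 hmem)
  rw [hw] at h1
  exact (mul_pos ht0 hpos).ne' h1

/-- There is at most one element on the other side of a facet. -/
theorem SharesFacet.unique {T : SimplicialMesh d Ω} (hd : 1 ≤ d) (h : SharesFacet K K' w w')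
    (h' : SharesFacet K K'' w w'') (hK : K ∈ T.elements) (hK' : K' ∈ T.elements)
    (hK'' : K'' ∈ T.elements) : K' = K'' := by
  by_contra hne
  have aux : ∀ {L L' : Finset (E d)} {z z' : E d}, L ∈ T.elements → L' ∈ T.elements →
      SharesFacet K L w z → SharesFacet K L' w z' → L ≠ L' → z ∉ L' := by
    intro L L' z z' hL hL' hs hs' hne hz
    refine hne (Finset.eq_of_subset_of_card_le (fun y hy => ?_) (by rw [hL.2, hL'.2]))
    rcases eq_or_ne y z with rfl | hyz
    · exact hz
    · have hyK := hs.symm.mem_of_ne hy hyz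
      exact hs'.mem_of_ne hyK (by rintro rfl; exact hs.notMem_right hy)
  have h1 := aux hK' hK'' h h' hne
  have h2 := aux hK'' hK' h' h (Ne.symm hne)
  -- Three distinct elements on one facet would lie pairwise on opposite sides of it, which
  -- contradicts the rule of signs in `bary_mul`.
  have hs : SharesFacet K' K'' w' w'' := by
    refine ⟨h.right, h'.right, fun y => ⟨fun hy => ⟨hy.1, ?_⟩, fun hy => ⟨hy.1, ?_⟩⟩,
      fun y => ⟨fun hy => ⟨hy.2, ?_⟩, fun hy => ⟨?_, hy.1⟩⟩⟩
    · rintro rfl; exact h1 hy.2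
    · exact h'.mem_of_ne (h.symm.mem_of_ne hy.1 hy.2) (by rintro rfl; exact h.notMem_right hy.1)
    · rintro rfl; exact h2 hy.1
    · exact h.mem_of_ne (h'.symm.mem_of_ne hy.1 hy.2) (by rintro rfl; exact h'.notMem_right hy.1)
  have n1 := h.bary_neg hd hK hK'
  have n2 := h'.bary_neg hd hK hK''
  have n3 := hs.bary_neg hd hK' hK''
  have h4 := h.bary_mul (T.isSimplex hK) (T.isSimplex hK') w''
  nlinarith

/-- A facet that touches `Ω` at one of its vertices has an element on its other side. -/
theorem SimplicialMesh.exists_neighbour (T : SimplicialMesh d Ω) (hΩ : IsOpen Ω)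
    {v : E d} (hvΩ : v ∈ Ω) (hK : K ∈ T.elements) (hv : v ∈ K) (hw : w ∈ K) (hvw : v ≠ w) :
    ∃ K' ∈ T.patch v, ∃ w', SharesFacet K K' w w' := by
  have sK := T.isSimplex hK
  obtain ⟨x, hxΩ, hx0, hx⟩ := exists_facet_point sK hΩ hvΩ hv hw hvw
  set g := affGrad (bary K w) with hg
  have hg0 : g ≠ 0 := affGrad_bary_ne_zero sK hw hv hvw.symm
  have hcont : Filter.Tendsto (fun t : ℝ => x + t • (-g)) (nhdsWithin 0 (Ioi 0)) (nhds x) := by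
    have : Continuous fun t : ℝ => x + t • (-g) := by fun_prop
    have h := this.tendsto 0
    rw [zero_smul, add_zero] at h
    exact h.mono_left nhdsWithin_le_nhds
  obtain ⟨U, hU, hfin⟩ := T.locallyFinite x
  -- Leaving $K$ through $x$ along $-g$, the points stay in $\Omega$ and are covered by the mesh;
  -- local finiteness yields one face that contains such points arbitrarily close to $x$.
  have key : ∃ s ∈ {s : T.faces | (hull (s : Finset (E d)) ∩ U).Nonempty},
      ∃ᶠ t in nhdsWithin (0 : ℝ) (Ioi 0), x + t • (-g) ∈ hull (s : Finset (E d)) := by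
    by_contra hcon
    push Not at hcon
    have h1 := (Filter.eventually_all_finite hfin).2 hcon
    obtain ⟨t, ⟨h2, h3⟩, h4⟩ := ((h1.and (hcont.eventually hU)).and
      (hcont.eventually (hΩ.mem_nhds hxΩ))).exists
    have h5 : x + t • (-g) ∈ ⋃ s ∈ T.faces, hull s := by
      rw [T.space_eq]; exact subset_closure h4
    obtain ⟨s, hs, hts⟩ := mem_iUnion₂.1 h5
    exact h2 ⟨s, hs⟩ ⟨_, hts, h3⟩ hts
  obtain ⟨s, -, hs⟩ := key
  obtain ⟨K', hK'f, hsK', hK'c⟩ := T.pure s s.2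
  have hK' : K' ∈ T.elements := ⟨hK'f, hK'c⟩
  have hs : ∃ᶠ t in nhdsWithin (0 : ℝ) (Ioi 0), x + t • (-g) ∈ hull K' :=
    hs.mono fun t ht => convexHull_mono (by exact_mod_cast hsK') ht
  have hxK' : x ∈ hull K' :=
    (K'.finite_toSet.isClosed_convexHull ℝ).mem_of_frequently_of_tendsto hs hcont
  have hxK : x ∈ hull K := (mem_hull_iff sK).2 fun z hz => by
    rcases eq_or_ne z w with rfl | hzw
    · exact hx0.ge
    · exact (hx z hz hzw).le
  have hxi := T.inter_subset_convexHull hK.1 hK'.1 ⟨hxK, hxK'⟩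
  -- All facet coordinates of $x$ are positive, so $x$ can lie in the hull of $K\cap K'$ only if
  -- every vertex of the facet belongs to $K'$.
  have hsub : ∀ z ∈ K, z ≠ w → z ∈ K' := by
    intro z hz hzw
    by_contra h
    exact (hx z hz hzw).ne' (bary_eq_zero_of_mem_convexHull sK inter_subset_left hz
      (fun hh => h hh.2) hxi)
  have hw' : w ∉ K' := by
    intro hw'
    have hKK' : K = K' := Finset.eq_of_subset_of_card_le
      (fun z hz => by
        rcases eq_or_ne z w with rfl | hzw
        · exact hw'
        · exact hsub z hz hzw) (by rw [hK.2, hK'.2])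
    obtain ⟨t, ht, ht0⟩ := (hs.and_eventually self_mem_nhdsWithin).exists
    have ht0 : 0 < t := ht0
    rw [← hKK'] at ht
    have h1 := (mem_hull_iff sK).1 ht w hw
    rw [affine_add, hx0, inner_smul_right, inner_neg_right, ← hg, real_inner_self_eq_norm_sq] at h1
    have : 0 < t * ‖g‖ ^ 2 := by positivity
    linarith
  have hleft : ∀ y, y ∈ K ∧ y ∈ K' ↔ y ∈ K ∧ y ≠ w := fun y =>
    ⟨fun hy => ⟨hy.1, by rintro rfl; exact hw' hy.2⟩, fun hy => ⟨hy.1, hsub y hy.1 hy.2⟩⟩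
  have hcard : (facet K K').card = d := by
    classical
    have : facet K K' = K.erase w := by
      ext y
      rw [mem_facet, hleft, Finset.mem_erase, and_comm]
    rw [this, Finset.card_erase_of_mem hw, hK.2, Nat.add_sub_cancel]
  obtain ⟨z, z', hz⟩ := exists_sharesFacet hK.2 hK'.2 hcard
  have hzw : z = w := by
    by_contra h
    exact hz.notMem_right (hsub z hz.left h)
  exact ⟨K', SimplicialMesh.mem_patch.2 ⟨hK', hsub v hv hvw⟩, z', hzw ▸ hz⟩

/-- Expanding $\nu$ in the gradients of the barycentric coordinates, orthogonality to the facet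
leaves only the term of $w$; unit length and orientation fix its factor. Hence the choice made in
`facetNormal` is unambiguous. -/
theorem SharesFacet.isFacetNormal_iff (hd : 1 ≤ d) (h : SharesFacet K K' w w') (hK : IsSimplex K)
    {ν : E d} : IsFacetNormal K K' ν ↔
      ν = -(‖affGrad (bary K w)‖⁻¹ • affGrad (bary K w)) := by
  set g := affGrad (bary K w) with hg
  obtain ⟨v, hv, hvw⟩ := exists_mem_ne hd hK w
  have hg0 : g ≠ 0 := affGrad_bary_ne_zero hK h.left hv hvw.symm
  have hgn : 0 < ‖g‖ := norm_pos_iff.2 hg0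
  have hzero (y : E d) (hy : y ∈ K) (hy' : y ∈ K') : bary K w y = 0 :=
    bary_of_ne hK h.left hy (by rintro rfl; exact h.notMem_right hy')
  constructor
  · rintro ⟨h1, h2, h3⟩
    have hvK' := h.mem_of_ne hv hvw
    have e1 : ν = inner ℝ ν (w - v) • g := by
      have h4 : affGrad ((innerSL ℝ ν).toLinearMap.toAffineMap) = ν :=
        affGrad_eq_of_inner fun y => by simp
      have h5 := affGrad_eq_sum hK ((innerSL ℝ ν).toLinearMap.toAffineMap)
      rw [h4] at h5
      have h6 : ν = ∑ z ∈ K, inner ℝ ν (z - v) • affGrad (bary K z) := by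
        simp only [inner_sub_right, sub_smul, Finset.sum_sub_distrib, ← Finset.smul_sum,
          sum_affGrad_bary hK, smul_zero, sub_zero]
        simpa using h5
      conv_lhs => rw [h6]
      refine Finset.sum_eq_single w (fun z hz hzw => ?_) (fun hh => absurd h.left hh)
      rw [h2 v hv hvK' z hz (h.mem_of_ne hz hzw), zero_smul]
    have e2 := h3 v hv hvK' w h.left
    have e3 : ‖ν‖ = -inner ℝ ν (w - v) * ‖g‖ := by
      conv_lhs => rw [e1]
      rw [norm_smul, Real.norm_of_nonpos e2]
    rw [h1] at e3
    have e4 : inner ℝ ν (w - v) = -‖g‖⁻¹ := by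
      field_simp
      linarith
    rw [e1, e4, neg_smul]
  · rintro rfl
    have hin (x y : E d) : inner ℝ (-(‖g‖⁻¹ • g)) (y - x) =
        -(‖g‖⁻¹ * (bary K w y - bary K w x)) := by
      rw [inner_neg_left, inner_smul_left, RCLike.conj_to_real, ← affine_sub]
    refine ⟨?_, fun x hx hx' y hy hy' => ?_, fun x hx hx' z hz => ?_⟩
    · rw [norm_neg, norm_smul, norm_inv, norm_norm, inv_mul_cancel₀ hgn.ne']
    · rw [hin, hzero x hx hx', hzero y hy hy']
      simp
    · rw [hin, hzero x hx hx', sub_zero]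
      have : 0 ≤ bary K w z := (mem_hull_iff hK).1 (subset_convexHull ℝ _ hz) w h.left
      have : 0 ≤ ‖g‖⁻¹ * bary K w z := by positivity
      linarith

theorem SharesFacet.facetNormal_eq (hd : 1 ≤ d) (h : SharesFacet K K' w w') (hK : IsSimplex K) :
    facetNormal K K' = -(‖affGrad (bary K w)‖⁻¹ • affGrad (bary K w)) :=
  (h.isFacetNormal_iff hd hK).1
    (Classical.epsilon_spec ⟨_, (h.isFacetNormal_iff hd hK).2 rfl⟩)

theorem SharesFacet.facetNormal_swap {T : SimplicialMesh d Ω} (hd : 1 ≤ d)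
    (h : SharesFacet K K' w w') (hK : K ∈ T.elements) (hK' : K' ∈ T.elements) :
    facetNormal K' K = -facetNormal K K' := by
  have hneg := h.bary_neg hd hK hK'
  rw [h.facetNormal_eq hd (T.isSimplex hK), h.symm.facetNormal_eq hd (T.isSimplex hK'),
    h.affGrad_eq (T.isSimplex hK) (T.isSimplex hK'), norm_smul, Real.norm_of_nonpos hneg.le, smul_smul,
    mul_inv, mul_right_comm, inv_neg, neg_mul, inv_mul_cancel₀ hneg.ne]
  simp

end Mesh

/-! ### Test functions that detect a jump across a hyperplane -/

section Divergence

variable {d : ℕ}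

theorem volume_affine_level (a : E d →ᵃ[ℝ] ℝ) (ha : affGrad a ≠ 0) (c : ℝ) :
    volume {x | a x = c} = 0 := by
  have h := lintegral_slices a ha (t := {x | a x = c})
    (isClosed_eq (continuous_affine a) continuous_const).measurableSet
  have h0 : ∫⁻ s : ℝ, μHE[d - 1] ({x | a x = c} ∩ {x | a x = s}) = 0 := by
    rw [lintegral_eq_zero_of_ae_eq_zero]
    have : ({c}ᶜ : Set ℝ) ∈ ae (volume : Measure ℝ) := by
      rw [mem_ae_iff, compl_compl]; exact Real.volume_singleton
    filter_upwards [this] with s hs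
    have : {x | a x = c} ∩ {x | a x = s} = ∅ := by
      ext x
      simp only [mem_inter_iff, mem_ofPred_eq, mem_empty_iff_false, iff_false, not_and]
      rintro rfl rfl
      exact hs rfl
    simp [this]
  rw [h0] at h
  have hpos : ENNReal.ofReal ‖affGrad a‖ ≠ 0 := by
    simpa using ha
  exact (mul_eq_zero.1 h.symm).resolve_right hpos

/-- For a direction `e` transversal to a hyperplane there is a localized test function with
nonvanishing integral of its derivative over the half space. -/
theorem exists_setIntegral_fderiv_ne_zero (a : E d →ᵃ[ℝ] ℝ) {x₀ : E d} (hx₀ : a x₀ = 0) {R : ℝ}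
    (hR : 0 < R) {e : E d} (he : 0 < inner ℝ (affGrad a) e) :
    ∃ ψ : E d → ℝ, ContDiff ℝ ∞ ψ ∧ HasCompactSupport ψ ∧ tsupport ψ ⊆ Metric.ball x₀ R ∧
      ∫ x in {x | 0 < a x}, fderiv ℝ ψ x e ≠ 0 := by
  -- Otherwise $s\mapsto\int_H\beta(x+se)\,dx$ would be constant for a bump $\beta$. But shifting
  -- the half space along $e$ cuts off a slab on which $\beta$ has positive mass.
  by_contra! hcon
  let β : ContDiffBump x₀ := ⟨R / 8, R / 4, by positivity, by linarith⟩
  have hβ : ContDiff ℝ ∞ β := β.contDiff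
  set H : Set (E d) := {x | 0 < a x} with hH
  have hHm : MeasurableSet H := (isOpen_lt continuous_const (continuous_affine a)).measurableSet
  have he0 : 0 < ‖e‖ := norm_pos_iff.2 (by rintro rfl; simp at he)
  -- Shifts up to $2s_1$ move the support, of radius $R/4$, by at most $R/2$, hence within radius
  -- $3R/4<R$. The range beyond $s_1$ leaves room to differentiate at the ends of $[0,s_1]$.
  set s₁ : ℝ := R / (4 * ‖e‖) with hs₁
  have hs₁0 : 0 < s₁ := by positivity
  have hs₁e : s₁ * ‖e‖ = R / 4 := by rw [hs₁]; field_simp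
  have hsupp (s : ℝ) (hs : |s| ≤ 2 * s₁) (x : E d) (hx : x + s • e ∈ Metric.closedBall x₀ (R / 4)) :
      x ∈ Metric.closedBall x₀ (3 * R / 4) := by
    rw [Metric.mem_closedBall, dist_eq_norm] at hx ⊢
    have h1 : x - x₀ = (x + s • e - x₀) - s • e := by abel
    rw [h1]
    refine (norm_sub_le _ _).trans ?_
    rw [norm_smul, Real.norm_eq_abs]
    have : |s| * ‖e‖ ≤ 2 * s₁ * ‖e‖ := mul_le_mul_of_nonneg_right hs he0.le
    linarith
  have hzero (s : ℝ) (hs : |s| ≤ 2 * s₁) : ∫ x in H, fderiv ℝ β (x + s • e) e = 0 := by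
    have hsub : tsupport (fun x => β (x + s • e)) ⊆ Metric.closedBall x₀ (3 * R / 4) := by
      refine closure_minimal (fun x hx => hsupp s hs x ?_) Metric.isClosed_closedBall
      have h1 : x + s • e ∈ Function.support β := hx
      rw [β.support_eq] at h1
      exact Metric.ball_subset_closedBall h1
    have h := hcon (fun x => β (x + s • e)) (hβ.comp (contDiff_id.add contDiff_const))
      (HasCompactSupport.of_support_subset_isCompact (isCompact_closedBall x₀ (3 * R / 4))
        (subset_closure.trans hsub))
      (hsub.trans (Metric.closedBall_subset_ball (by linarith)))
    simpa only [fderiv_comp_add_right] using h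
  obtain ⟨B, hB⟩ : ∃ B, ∀ x, ‖fderiv ℝ β x e‖ ≤ B := by
    have hc : Continuous fun x => fderiv ℝ β x e :=
      (hβ.continuous_fderiv (by simp)).clm_apply continuous_const
    exact hc.bounded_above_of_compact_support (β.hasCompactSupport.fderiv_apply (𝕜 := ℝ) e)
  have hB0 : 0 ≤ B := (norm_nonneg _).trans (hB 0)
  have hint (s : ℝ) : Integrable (fun x => β (x + s • e)) (volume.restrict H) := by
    have : Integrable (fun x => β x) := β.continuous.integrable_of_hasCompactSupport
      β.hasCompactSupport
    exact (this.comp_add_right (s • e)).restrict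
  have hderiv (s : ℝ) (hs : |s| < 2 * s₁) :
      HasDerivAt (fun s : ℝ => ∫ x in H, β (x + s • e)) 0 s := by
    have h := hasDerivAt_integral_of_dominated_loc_of_deriv_le (μ := volume.restrict H) (𝕜 := ℝ)
      (F := fun s x => β (x + s • e)) (F' := fun s x => fderiv ℝ β (x + s • e) e) (x₀ := s)
      (s := {s | |s| < 2 * s₁})
      (bound := (Metric.closedBall x₀ (3 * R / 4)).indicator fun _ => B)
      ((isOpen_lt continuous_abs continuous_const).mem_nhds hs)
      (Filter.Eventually.of_forall fun s => (hint s).aestronglyMeasurable) (hint s) ?_ ?_ ?_ ?_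
    · have h2 := h.2
      rwa [hzero s hs.le] at h2
    · have hc : Continuous fun x => fderiv ℝ β (x + s • e) e :=
        ((hβ.continuous_fderiv (by simp)).comp (continuous_id.add continuous_const)).clm_apply
          continuous_const
      exact hc.aestronglyMeasurable
    · refine Filter.Eventually.of_forall fun x s hs => ?_
      by_cases hx : x ∈ Metric.closedBall x₀ (3 * R / 4)
      · rw [indicator_of_mem hx]; exact hB _
      · rw [indicator_of_notMem hx]
        have h1 : x + s • e ∉ tsupport β := by
          rw [β.tsupport_eq]
          exact fun h1 => hx (hsupp s (le_of_lt hs) x h1)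
        have h2 : fderiv ℝ β (x + s • e) = 0 :=
          image_eq_zero_of_notMem_tsupport fun h2 => h1 (tsupport_fderiv_subset ℝ h2)
        simp [h2]
    · refine (integrable_indicator_iff measurableSet_closedBall).2 ?_
      have := (isCompact_closedBall x₀ (3 * R / 4)).measure_lt_top (μ := volume)
      exact integrableOn_const ((Measure.restrict_apply_le _ _).trans_lt this).ne
    · refine Filter.Eventually.of_forall fun x s _ => ?_
      have h1 : HasFDerivAt β (fderiv ℝ β (x + s • e)) (x + s • e) :=
        (hβ.differentiable (by simp) _).hasFDerivAt
      have h2 : HasDerivAt (fun s : ℝ => x + s • e) e s := by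
        simpa using ((hasDerivAt_id s).smul_const e).const_add x
      exact HasFDerivAt.comp_hasDerivAt (l := ⇑β) (f := fun s : ℝ => x + s • e) s h1 h2
  have hconst := constant_of_has_deriv_right_zero (a := 0) (b := s₁)
    (f := fun s : ℝ => ∫ x in H, β (x + s • e))
    (fun s hs => (hderiv s (by rw [abs_of_nonneg hs.1]; linarith [hs.2])).continuousAt
      |>.continuousWithinAt)
    (fun s hs => (hderiv s (by rw [abs_of_nonneg hs.1]; linarith [hs.2])).hasDerivWithinAt)
    s₁ ⟨hs₁0.le, le_rfl⟩
  set c : ℝ := s₁ * inner ℝ (affGrad a) e with hc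
  have hc0 : 0 < c := mul_pos hs₁0 he
  set H' : Set (E d) := {x | c < a x} with hH'
  have hH'm : MeasurableSet H' := (isOpen_lt continuous_const (continuous_affine a)).measurableSet
  have hshift : ∫ x in H, β (x + s₁ • e) = ∫ x in H', β x := by
    rw [← integral_indicator hHm, ← integral_indicator hH'm,
      ← integral_add_right_eq_self (H'.indicator fun x => β x) (s₁ • e)]
    refine integral_congr_ae (Filter.Eventually.of_forall fun x => ?_)
    have hiff : x + s₁ • e ∈ H' ↔ x ∈ H := by
      rw [hH', hH, mem_ofPred_eq, mem_ofPred_eq, affine_add, inner_smul_right, ← hc]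
      constructor <;> intro h <;> linarith
    by_cases hx : x ∈ H
    · simp only [indicator_of_mem hx, indicator_of_mem (hiff.2 hx)]
    · simp only [indicator_of_notMem hx, indicator_of_notMem (mt hiff.1 hx)]
  have hβi : Integrable (fun x => β x) := β.continuous.integrable_of_hasCompactSupport
      β.hasCompactSupport
  have hsub : H' ⊆ H := fun x hx => hc0.trans hx
  have hdiff := setIntegral_sdiff (μ := volume) hH'm hβi.integrableOn hsub (f := fun x => β x)
  simp only [zero_smul, add_zero] at hconst
  rw [← hshift, hconst, sub_self] at hdiff
  have hpos : 0 < ∫ x in H \ H', β x := by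
    rw [setIntegral_pos_iff_support_of_nonneg_ae
      (Filter.Eventually.of_forall fun x => β.nonneg) hβi.integrableOn]
    have hopen : IsOpen ({x | 0 < a x} ∩ {x | a x < c} ∩ Metric.ball x₀ (R / 4)) :=
      ((isOpen_lt continuous_const (continuous_affine a)).inter
        (isOpen_lt (continuous_affine a) continuous_const)).inter Metric.isOpen_ball
    have hne : ({x | 0 < a x} ∩ {x | a x < c} ∩ Metric.ball x₀ (R / 4)).Nonempty := by
      refine ⟨x₀ + (s₁ / 2) • e, ⟨?_, ?_⟩, ?_⟩
      · rw [mem_ofPred_eq, affine_add, hx₀, inner_smul_right]; positivity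
      · rw [mem_ofPred_eq, affine_add, hx₀, inner_smul_right]; linarith
      · rw [Metric.mem_ball, dist_eq_norm, add_sub_cancel_left, norm_smul,
          Real.norm_of_nonneg (by positivity)]
        linarith
    refine (hopen.measure_pos volume hne).trans_le (measure_mono ?_)
    rintro x ⟨⟨h1, h2⟩, h3⟩
    refine ⟨?_, h1, fun h4 => lt_asymm (show a x < c from h2) (show c < a x from h4)⟩
    have : x ∈ Metric.ball x₀ (R / 4) := h3
    change x ∈ Function.support β
    rw [β.support_eq]
    exact this
  exact hpos.ne' hdiff

theorem inner_affGrad_eq_zero (a : E d →ᵃ[ℝ] ℝ) {x₀ : E d} (hx₀ : a x₀ = 0) {R : ℝ}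
    (hR : 0 < R) {e : E d}
    (h : ∀ ψ : E d → ℝ, ContDiff ℝ ∞ ψ → HasCompactSupport ψ → tsupport ψ ⊆ Metric.ball x₀ R →
      ∫ x in {x | 0 < a x}, fderiv ℝ ψ x e = 0) : inner ℝ (affGrad a) e = 0 := by
  rcases lt_trichotomy (inner ℝ (affGrad a) e) 0 with he | he | he
  · obtain ⟨ψ, h1, h2, h3, h4⟩ := exists_setIntegral_fderiv_ne_zero a hx₀ hR (e := -e)
      (by rw [inner_neg_right]; linarith)
    simp only [map_neg, integral_neg, h ψ h1 h2 h3, neg_zero] at h4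
    exact absurd rfl h4
  · exact he
  · obtain ⟨ψ, h1, h2, h3, h4⟩ := exists_setIntegral_fderiv_ne_zero a hx₀ hR he
    exact absurd (h ψ h1 h2 h3) h4

theorem integral_fderiv_eq_zero {ψ : E d → ℝ} (hψ : ContDiff ℝ ∞ ψ) (hc : HasCompactSupport ψ)
    (e : E d) : ∫ x, fderiv ℝ ψ x e = 0 := by
  have hint : Integrable (fun x => fderiv ℝ ψ x e) :=
    ((hψ.continuous_fderiv (by simp)).clm_apply continuous_const).integrable_of_hasCompactSupport
      (hc.fderiv_apply (𝕜 := ℝ) e)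
  have h := integral_mul_fderiv_eq_neg_fderiv_mul_of_integrable (μ := (volume : Measure (E d)))
    (f := ψ) (g := fun _ => (1 : ℝ)) (v := e) (by simpa using hint) (by simp)
    (by simpa using hψ.continuous.integrable_of_hasCompactSupport hc)
    (fun x _ => hψ.differentiable (by simp) x) (fun x _ => differentiableAt_const _)
  simpa using h

end Divergence

/-! ### Continuity of the normal flux matrix across facets -/

section Coefficients

variable {d b : ℕ} {Ω : Set (E d)} {K K' : Finset (E d)} {w w' : E d}

theorem barycenter_mem_interior (hK : IsSimplex K) : barycenter K ∈ interior (hull K) := by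
  have hcard : (K.card : ℝ) = d + 1 := by rw [hK.2]; push_cast; ring
  have hpos : (0 : ℝ) < d + 1 := by positivity
  rw [mem_interior_hull_iff hK]
  intro z hz
  have h1 : barycenter K = z + (K.card : ℝ)⁻¹ • ∑ x ∈ K, (x - z) := by
    rw [Finset.sum_sub_distrib, Finset.sum_const, smul_sub, ← Nat.cast_smul_eq_nsmul ℝ, smul_smul,
      hcard, inv_mul_cancel₀ hpos.ne', one_smul, barycenter, hcard]
    abel
  rw [h1, affine_add, inner_smul_right, inner_sum]
  simp only [← affine_sub]
  rw [Finset.sum_sub_distrib, Finset.sum_const, nsmul_eq_mul, bary_self hK hz,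
    Finset.sum_eq_single z (fun y hy hyz => bary_of_ne hK hz hy hyz.symm)
      (fun h => absurd hz h), bary_self hK hz, hcard]
  have : (d + 1 : ℝ)⁻¹ * (1 - (d + 1) * 1) = (d + 1 : ℝ)⁻¹ - 1 := by field_simp
  rw [this]
  have : (0 : ℝ) < (d + 1 : ℝ)⁻¹ := by positivity
  linarith

theorem barycenter_mem {T : SimplicialMesh d Ω} (hK : K ∈ T.elements) : barycenter K ∈ Ω :=
  T.interior_subset K hK.1 (barycenter_mem_interior (T.isSimplex hK))

theorem fderiv_apply_eq_sum (f : E d →L[ℝ] ℝ) (c : Fin d → ℝ) :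
    f (WithLp.toLp 2 c) = ∑ j, c j * f (EuclideanSpace.single j 1) := by
  have : (WithLp.toLp 2 c : E d) = ∑ j, c j • EuclideanSpace.single j (1 : ℝ) := by
    ext i
    simp [Finset.sum_apply, Pi.single_apply]
  rw [this, map_sum]
  simp

/-- The normal component of a divergence free elementwise constant field is continuous across
facets. -/
theorem sum_affGrad_mul_eq {T : SimplicialMesh d Ω} (hd : 1 ≤ d) (hΩ : IsOpen Ω)
    {G : E d → Matrix (Fin b) (Fin b) ℝ} {L : Fin d → E d → Matrix (Fin b) (Fin b) ℝ}
    {g₀ B c₀ : ℝ} (hL : IsSymmetricHyperbolic Ω G L g₀ B c₀) (hc : IsElementwiseConstant T G L)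
    (h : SharesFacet K K' w w') (hK : K ∈ T.elements) (hK' : K' ∈ T.elements) {v : E d}
    (hv : v ∈ K) (hvw : v ≠ w) (hvΩ : v ∈ Ω) (i k : Fin b) :
    ∑ j, affGrad (bary K w) j * L j (barycenter K) i k =
      ∑ j, affGrad (bary K w) j * L j (barycenter K') i k := by
  have sK := T.isSimplex hK
  have sK' := T.isSimplex hK'
  have hneg := h.bary_neg hd hK hK'
  obtain ⟨x₀, hx₀Ω, hx₀, hx⟩ := exists_facet_point sK hΩ hvΩ hv h.left hvw
  -- In a small ball around a point in the relative interior of the facet, the hyperplane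
  -- $\lambda_w=0$ separates the interior of $K$ from that of $K'$.
  have hev : ∀ᶠ y in nhds x₀, y ∈ Ω ∧ (∀ z ∈ (K : Set (E d)) \ {w}, 0 < bary K z y) ∧
      ∀ z ∈ (K' : Set (E d)) \ {w'}, 0 < bary K' z y := by
    refine (hΩ.mem_nhds hx₀Ω |> Filter.eventually_iff.2).and (Filter.Eventually.and ?_ ?_)
    · refine (Filter.eventually_all_finite (K.finite_toSet.sdiff)).2 fun z hz => ?_
      exact (isOpen_lt continuous_const (continuous_affine _)).mem_nhds (hx z hz.1 hz.2)
    · refine (Filter.eventually_all_finite (K'.finite_toSet.sdiff)).2 fun z hz => ?_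
      have hzK : z ∈ K := h.symm.mem_of_ne hz.1 hz.2
      have hzw : z ≠ w := by rintro rfl; exact h.notMem_right hz.1
      refine (isOpen_lt continuous_const (continuous_affine _)).mem_nhds ?_
      have h1 : bary K' z x₀ = bary K z x₀ := by
        rw [affine_eq_sum_bary sK (bary K' z) x₀, Finset.sum_eq_single z, bary_self sK' hz.1,
          mul_one]
        · intro y hy hyz
          rcases eq_or_ne y w with rfl | hyw
          · rw [hx₀, zero_mul]
          · rw [bary_of_ne sK' hz.1 (h.mem_of_ne hy hyw) hyz.symm, mul_zero]
        · exact fun hh => absurd hzK hh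
      rw [mem_ofPred_eq, h1]
      exact hx z hzK hzw
  obtain ⟨R, hR, hball⟩ := Metric.eventually_nhds_iff_ball.1 hev
  have hin : ∀ y ∈ Metric.ball x₀ R, 0 < bary K w y → y ∈ interior (hull K) := by
    intro y hy hpos
    rw [mem_interior_hull_iff sK]
    intro z hz
    rcases eq_or_ne z w with rfl | hzw
    · exact hpos
    · exact (hball y hy).2.1 z ⟨hz, hzw⟩
  have hin' : ∀ y ∈ Metric.ball x₀ R, bary K w y < 0 → y ∈ interior (hull K') := by
    intro y hy hlt
    rw [mem_interior_hull_iff sK']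
    intro z hz
    rcases eq_or_ne z w' with rfl | hzw
    · have := h.bary_mul sK sK' y
      by_contra hcon
      nlinarith
    · exact (hball y hy).2.2 z ⟨hz, hzw⟩
  set α : Fin d → ℝ := fun j => L j (barycenter K) i k with hα
  set α' : Fin d → ℝ := fun j => L j (barycenter K') i k with hα'
  have key : inner ℝ (affGrad (bary K w)) (WithLp.toLp 2 (α - α') : E d) = 0 := by
    refine inner_affGrad_eq_zero (bary K w) hx₀ hR fun ψ hψ hψc hψs => ?_
    have hdiv := hL.div_L i k ψ hψ hψc (hψs.trans fun y hy => (hball y hy).1)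
    have hoff (y : E d) (hy : y ∉ Metric.ball x₀ R) : fderiv ℝ ψ y = 0 :=
      image_eq_zero_of_notMem_tsupport fun h2 => hy (hψs (tsupport_fderiv_subset ℝ h2))
    rw [setIntegral_eq_integral_of_forall_compl_eq_zero (fun y hy => Finset.sum_eq_zero fun j _ => by
      rw [hoff y fun hy' => hy (hball y hy').1]; simp)] at hdiv
    have hH : MeasurableSet {x | 0 < bary K w x} :=
      (isOpen_lt continuous_const (continuous_affine _)).measurableSet
    have hint (e : E d) : Integrable (fun x => fderiv ℝ ψ x e) :=
      ((hψ.continuous_fderiv (by simp)).clm_apply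
        continuous_const).integrable_of_hasCompactSupport (hψc.fderiv_apply (𝕜 := ℝ) e)
    -- The field is $\alpha$ on one side and $\alpha'$ on the other. The constant $\alpha'$
    -- contributes nothing to the integral, so only the jump $\alpha-\alpha'$ on the half space
    -- remains.
    have hae : (fun x => ∑ j, L j x i k * fderiv ℝ ψ x (EuclideanSpace.single j 1)) =ᵐ[volume]
        fun x => {x | 0 < bary K w x}.indicator
          (fun x => fderiv ℝ ψ x (WithLp.toLp 2 (α - α'))) x + fderiv ℝ ψ x (WithLp.toLp 2 α') := by
      have hnull := volume_affine_level (bary K w) (affGrad_bary_ne_zero sK h.left hv hvw.symm) 0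
      filter_upwards [compl_mem_ae_iff.2 hnull] with y hy
      by_cases hyB : y ∈ Metric.ball x₀ R
      · rcases lt_trichotomy (bary K w y) 0 with hlt | heq | hgt
        · rw [indicator_of_notMem (show y ∉ {x | 0 < bary K w x} from not_lt.2 hlt.le), zero_add,
            fderiv_apply_eq_sum]
          refine Finset.sum_congr rfl fun j _ => ?_
          rw [(hc K' hK' y (hin' y hyB hlt) _ (barycenter_mem_interior sK')).2 j]
        · exact absurd heq hy
        · rw [indicator_of_mem (show y ∈ {x | 0 < bary K w x} from hgt), ← map_add,
            ← WithLp.toLp_add, sub_add_cancel, fderiv_apply_eq_sum]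
          refine Finset.sum_congr rfl fun j _ => ?_
          rw [(hc K hK y (hin y hyB hgt) _ (barycenter_mem_interior sK)).2 j]
      · rw [hoff y hyB]
        by_cases hy0 : y ∈ {x | 0 < bary K w x}
        · rw [indicator_of_mem hy0, hoff y hyB]; simp
        · rw [indicator_of_notMem hy0]; simp
    rw [integral_congr_ae hae, integral_add ((hint _).indicator hH) (hint _),
      integral_fderiv_eq_zero hψ hψc, add_zero, integral_indicator hH] at hdiv
    exact hdiv
  rw [EuclideanSpace.inner_eq_star_dotProduct] at key
  simp only [dotProduct, star_trivial, Pi.sub_apply, sub_mul, Finset.sum_sub_distrib] at key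
  simp only [hα, hα'] at key
  rw [sub_eq_zero] at key
  simpa only [mul_comm] using key

theorem normalMatrix_neg (L : Fin d → E d → Matrix (Fin b) (Fin b) ℝ) (ν x : E d) :
    normalMatrix L (-ν) x = -normalMatrix L ν x := by
  simp [normalMatrix]

theorem normalMatrix_smul (L : Fin d → E d → Matrix (Fin b) (Fin b) ℝ) (c : ℝ) (ν x : E d) :
    normalMatrix L (c • ν) x = c • normalMatrix L ν x := by
  simp [normalMatrix, Finset.smul_sum, smul_smul]

theorem normalMatrix_add (L : Fin d → E d → Matrix (Fin b) (Fin b) ℝ) (ν ν' x : E d) :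
    normalMatrix L (ν + ν') x = normalMatrix L ν x + normalMatrix L ν' x := by
  simp [normalMatrix, add_smul, Finset.sum_add_distrib]

theorem normalMatrix_facetNormal_eq {T : SimplicialMesh d Ω} (hd : 1 ≤ d) (hΩ : IsOpen Ω)
    {G : E d → Matrix (Fin b) (Fin b) ℝ} {L : Fin d → E d → Matrix (Fin b) (Fin b) ℝ}
    {g₀ B c₀ : ℝ} (hL : IsSymmetricHyperbolic Ω G L g₀ B c₀) (hc : IsElementwiseConstant T G L)
    (h : SharesFacet K K' w w') (hK : K ∈ T.elements) (hK' : K' ∈ T.elements) {v : E d}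
    (hv : v ∈ K) (hvw : v ≠ w) (hvΩ : v ∈ Ω) :
    normalMatrix L (facetNormal K K') (barycenter K) =
      normalMatrix L (facetNormal K K') (barycenter K') := by
  rw [h.facetNormal_eq hd (T.isSimplex hK), normalMatrix_neg, normalMatrix_neg, normalMatrix_smul,
    normalMatrix_smul]
  congr 2
  ext i k
  simpa [normalMatrix, Matrix.sum_apply] using
    sum_affGrad_mul_eq hd hΩ hL hc h hK hK' hv hvw hvΩ i k

end Coefficients

/-! ### Characteristic speeds and coercivity -/

section Speed

variable {d b : ℕ} {Ω : Set (E d)}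

/-- A bound on the generalized eigenvalues of a symmetric pencil bounds its Rayleigh quotient. -/
theorem dotProduct_le_of_generalized_eigenvalue_le {D G : Matrix (Fin b) (Fin b) ℝ}
    (hD : D.IsSymm) (hG : G.IsSymm) {g₀ c₀ : ℝ} (hg₀ : 0 < g₀)
    (hpos : ∀ u : Fin b → ℝ, g₀ * (u ⬝ᵥ u) ≤ (G *ᵥ u) ⬝ᵥ u)
    (hspeed : ∀ (μ : ℝ) (w : Fin b → ℝ), w ≠ 0 → D *ᵥ w = μ • (G *ᵥ w) → |μ| ≤ c₀)
    (u : Fin b → ℝ) : (D *ᵥ u) ⬝ᵥ u ≤ c₀ * ((G *ᵥ u) ⬝ᵥ u) := by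
  rcases eq_or_ne u 0 with rfl | hu
  · simp
  have hGpos : ∀ x : Fin b → ℝ, x ≠ 0 → 0 < (G *ᵥ x) ⬝ᵥ x := by
    intro x hx
    have h1 : 0 < x ⬝ᵥ x := by
      rw [← vecNorm_sq]
      have : (WithLp.toLp 2 x : EuclideanSpace ℝ (Fin b)) ≠ 0 := by simpa using hx
      have := norm_pos_iff.2 this
      rw [vecNorm]; positivity
    exact (mul_pos hg₀ h1).trans_le (hpos x)
  set q : (Fin b → ℝ) → ℝ := fun x => ((D *ᵥ x) ⬝ᵥ x) / ((G *ᵥ x) ⬝ᵥ x) with hq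
  have hquad (M : Matrix (Fin b) (Fin b) ℝ) (c : ℝ) (x : Fin b → ℝ) :
      (M *ᵥ (c • x)) ⬝ᵥ (c • x) = c ^ 2 * ((M *ᵥ x) ⬝ᵥ x) := by
    rw [Matrix.mulVec_smul, smul_dotProduct, dotProduct_smul, smul_eq_mul, smul_eq_mul]; ring
  have hcontq (M : Matrix (Fin b) (Fin b) ℝ) : Continuous fun x : Fin b → ℝ => (M *ᵥ x) ⬝ᵥ x :=
    (Continuous.matrix_mulVec continuous_const continuous_id).dotProduct continuous_id
  have hcont : ContinuousOn q (Metric.sphere 0 1) := by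
    refine (hcontq D).continuousOn.div (hcontq G).continuousOn fun x hx => (hGpos x ?_).ne'
    rintro rfl
    simp at hx
  have hun : 0 < ‖u‖ := norm_pos_iff.2 hu
  -- At a maximizer $w$ of the Rayleigh quotient, $q(w)G-D$ is positive semidefinite and its form
  -- vanishes at $w$. So $w$ lies in its kernel and is a generalized eigenvector, to which the speed
  -- bound applies.
  obtain ⟨w, hw, hmax⟩ := (isCompact_sphere (0 : Fin b → ℝ) 1).exists_isMaxOn
    ⟨‖u‖⁻¹ • u, by simp [norm_smul, hun.ne']⟩ hcont
  have hw0 : w ≠ 0 := by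
    rintro rfl
    simp at hw
  have hle : ∀ x : Fin b → ℝ, (D *ᵥ x) ⬝ᵥ x ≤ q w * ((G *ᵥ x) ⬝ᵥ x) := by
    intro x
    rcases eq_or_ne x 0 with rfl | hx
    · simp
    have hxn : 0 < ‖x‖ := norm_pos_iff.2 hx
    have h1 : q (‖x‖⁻¹ • x) ≤ q w := hmax (by simp [norm_smul, hxn.ne'])
    have h2 : q (‖x‖⁻¹ • x) = q x := by
      simp only [hq, hquad]
      rw [mul_div_mul_left _ _ (by positivity)]
    rw [h2, hq] at h1
    exact (div_le_iff₀ (hGpos x hx)).1 h1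
  have hN : (q w • G - D).PosSemidef := by
    refine Matrix.PosSemidef.of_dotProduct_mulVec_nonneg ?_ fun x => ?_
    · rw [Matrix.IsHermitian, Matrix.conjTranspose_eq_transpose_of_trivial, Matrix.transpose_sub,
        Matrix.transpose_smul, hD.eq, hG.eq]
    · rw [star_trivial, dotProduct_comm, Matrix.sub_mulVec, Matrix.smul_mulVec, sub_dotProduct,
        smul_dotProduct, smul_eq_mul]
      exact sub_nonneg.2 (hle x)
  have hNw : (q w • G - D) *ᵥ w = 0 := by
    rw [← hN.dotProduct_mulVec_zero_iff, star_trivial, dotProduct_comm, Matrix.sub_mulVec,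
      Matrix.smul_mulVec, sub_dotProduct, smul_dotProduct, smul_eq_mul, hq]
    rw [div_mul_cancel₀ _ (hGpos w hw0).ne', sub_self]
  rw [Matrix.sub_mulVec, Matrix.smul_mulVec, sub_eq_zero] at hNw
  have h1 := (le_abs_self _).trans (hspeed (q w) w hw0 hNw.symm)
  exact (hle u).trans (mul_le_mul_of_nonneg_right h1 (hGpos u hu).le)

theorem isSymm_normalMatrix {L : Fin d → E d → Matrix (Fin b) (Fin b) ℝ} {x : E d}
    (h : ∀ j, (L j x).IsSymm) (ν : E d) : (normalMatrix L ν x).IsSymm := by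
  rw [Matrix.IsSymm, normalMatrix, Matrix.transpose_sum]
  exact Finset.sum_congr rfl fun j _ => by rw [Matrix.transpose_smul, (h j).eq]

theorem abs_normalMatrix_le {L : Fin d → E d → Matrix (Fin b) (Fin b) ℝ} {x : E d} {B : ℝ}
    (h : ∀ j i k, |L j x i k| ≤ B) (ν : E d) (i k : Fin b) :
    |normalMatrix L ν x i k| ≤ d * (‖ν‖ * B) := by
  rw [normalMatrix, Matrix.sum_apply]
  refine (Finset.abs_sum_le_sum_abs _ _).trans ?_
  calc _ ≤ ∑ _j : Fin d, ‖ν‖ * B := by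
        refine Finset.sum_le_sum fun j _ => ?_
        rw [Matrix.smul_apply, smul_eq_mul, abs_mul]
        exact mul_le_mul (by simpa using PiLp.norm_apply_le ν j) (h j i k) (abs_nonneg _)
          (norm_nonneg _)
    _ = _ := by simp

theorem flux_mulVec (L : Fin d → E d → Matrix (Fin b) (Fin b) ℝ) (x : E d) (u : Fin b → ℝ)
    (y : E d) : flux L x u *ᵥ (fun j => y j) = normalMatrix L y x *ᵥ u := by
  ext l
  simp only [flux, normalMatrix, Matrix.mulVec, dotProduct, Matrix.of_apply, Matrix.sum_apply,
    Matrix.smul_apply, smul_eq_mul, Finset.sum_mul]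
  rw [Finset.sum_comm]
  exact Finset.sum_congr rfl fun k _ => Finset.sum_congr rfl fun j _ => by ring

variable {G : E d → Matrix (Fin b) (Fin b) ℝ} {L : Fin d → E d → Matrix (Fin b) (Fin b) ℝ}
  {g₀ B c₀ cmax : ℝ}

/-- Below the causality limit the temporal flux matrix is uniformly positive definite. -/
theorem IsSymmetricHyperbolic.coercive (hL : IsSymmetricHyperbolic Ω G L g₀ B c₀) (hg₀ : 0 < g₀)
    (hc₀ : 0 ≤ c₀) (hc : c₀ < cmax) {x : E d} (hx : x ∈ Ω) {y : E d} (hy : ‖y‖ < 1 / cmax)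
    (u : Fin b → ℝ) :
    g₀ * (1 - c₀ / cmax) * (u ⬝ᵥ u) ≤ ((G x - normalMatrix L y x) *ᵥ u) ⬝ᵥ u := by
  have hcm : 0 < cmax := hc₀.trans_lt hc
  have hG := hL.posDef_G x hx u
  have hG0 : 0 ≤ (G x *ᵥ u) ⬝ᵥ u :=
    (mul_nonneg hg₀.le (by rw [← vecNorm_sq]; positivity)).trans hG
  -- The speed bound for the unit vector $y/\|y\|$ is scaled by $\|y\|<1/c_{\max}$, which leaves the
  -- fraction $1-c_0/c_{\max}$ of $\mathcal G$.
  have hD : (normalMatrix L y x *ᵥ u) ⬝ᵥ u ≤ c₀ / cmax * ((G x *ᵥ u) ⬝ᵥ u) := by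
    rcases eq_or_ne y 0 with rfl | hy0
    · have : normalMatrix L (0 : E d) x = 0 := by simp [normalMatrix]
      rw [this, Matrix.zero_mulVec, zero_dotProduct]
      positivity
    have hyn : 0 < ‖y‖ := norm_pos_iff.2 hy0
    have h1 := dotProduct_le_of_generalized_eigenvalue_le
      (isSymm_normalMatrix (fun j => hL.symm_L j x hx) (‖y‖⁻¹ • y)) (hL.symm_G x hx) hg₀
      (hL.posDef_G x hx) (hL.speed x hx (‖y‖⁻¹ • y) (by simp [norm_smul, hyn.ne'])) u
    have h2 : normalMatrix L y x = ‖y‖ • normalMatrix L (‖y‖⁻¹ • y) x := by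
      rw [← normalMatrix_smul, smul_smul, mul_inv_cancel₀ hyn.ne', one_smul]
    rw [h2, Matrix.smul_mulVec, smul_dotProduct, smul_eq_mul]
    calc _ ≤ ‖y‖ * (c₀ * ((G x *ᵥ u) ⬝ᵥ u)) := mul_le_mul_of_nonneg_left h1 hyn.le
      _ ≤ 1 / cmax * (c₀ * ((G x *ᵥ u) ⬝ᵥ u)) :=
          mul_le_mul_of_nonneg_right hy.le (mul_nonneg hc₀ hG0)
      _ = _ := by ring
  have h1 : 0 ≤ 1 - c₀ / cmax := by
    rw [sub_nonneg, div_le_one hcm]; exact hc.le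
  rw [Matrix.sub_mulVec, sub_dotProduct]
  nlinarith [mul_le_mul_of_nonneg_left hG h1]

theorem IsSymmetricHyperbolic.bound (hL : IsSymmetricHyperbolic Ω G L g₀ B c₀) {x : E d}
    (hx : x ∈ Ω) {y : E d} {m : ℝ} (hy : ‖y‖ ≤ m) (i k : Fin b) :
    |(G x - normalMatrix L y x) i k| ≤ |B| * (1 + d * m) := by
  rw [Matrix.sub_apply]
  refine (abs_sub _ _).trans ?_
  have h1 := (hL.bound_G x hx i k).trans (le_abs_self B)
  have h2 := abs_normalMatrix_le (fun j i k => (hL.bound_L j x hx i k).trans (le_abs_self B)) y i k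
  have h3 : (d : ℝ) * (‖y‖ * |B|) ≤ d * (m * |B|) := by gcongr
  linarith

end Speed

/-! ### Geometry of a tent: height, causality, facet weights -/

section Tent

variable {d b : ℕ} {Ω : Set (E d)} {T : SimplicialMesh d Ω} {v : E d} {cmax : ℝ}
  {φbot φtop : E d → ℝ} {K K' : Finset (E d)} {w w' : E d}

/-- Coefficients and gradients are only known inside an element; this suffices because the boundary
of a convex set is null. -/
theorem setIntegral_hull_of_const (K : Finset (E d)) {f : E d → ℝ} {c : ℝ}
    (hf : ∀ x ∈ interior (hull K), f x = c) :
    ∫ x in hull K, f x = (volume (hull K)).toReal * c := by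
  have hae : (hull K : Set (E d)) =ᵐ[volume] interior (hull K) := by
    have h := (convex_convexHull ℝ (K : Set (E d))).addHaar_frontier volume
    have hcl : IsClosed (hull K) := K.finite_toSet.isClosed_convexHull ℝ
    rw [frontier, (K.finite_toSet.isClosed_convexHull ℝ).closure_eq] at h
    exact (ae_le_set.2 h).antisymm (interior_subset.eventuallyLE)
  rw [setIntegral_congr_set hae, setIntegral_congr_fun isOpen_interior.measurableSet hf,
    setIntegral_const, measureReal_def, ← measure_congr hae, smul_eq_mul]

theorem gradient_eq_affGrad {φ : E d → ℝ} {a : E d →ᵃ[ℝ] ℝ} (h : ∀ x ∈ hull K, φ x = a x)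
    {x : E d} (hx : x ∈ interior (hull K)) : gradient φ x = affGrad a := by
  refine ((hasGradientAt_affine a x).congr_of_eventuallyEq ?_).gradient
  filter_upwards [isOpen_interior.mem_nhds hx] with y hy
  exact h y (interior_subset hy)

theorem affGrad_add (a a' : E d →ᵃ[ℝ] ℝ) : affGrad (a + a') = affGrad a + affGrad a' :=
  affGrad_eq_of_inner fun y => by
    rw [inner_add_left, inner_affGrad, inner_affGrad, AffineMap.add_linear]; rfl

theorem affGrad_smul (c : ℝ) (a : E d →ᵃ[ℝ] ℝ) : affGrad (c • a) = c • affGrad a :=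
  affGrad_eq_of_inner fun y => by
    rw [inner_smul_left, inner_affGrad, AffineMap.smul_linear]; rfl

/-- Both fronts are affine on $K$ and agree at every vertex except $v$. -/
theorem IsTent.height_eq (ht : IsTent T v cmax φbot φtop) (hK : K ∈ T.patch v) {x : E d}
    (hx : x ∈ hull K) : φtop x - φbot x = (φtop v - φbot v) * bary K v x := by
  obtain ⟨hKe, hvK⟩ := SimplicialMesh.mem_patch.1 hK
  have sK := T.isSimplex hKe
  obtain ⟨a, ha⟩ := ht.affine_bot K hK
  obtain ⟨a', ha'⟩ := ht.affine_top K hK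
  rw [ha x hx, ha' x hx, affine_eq_sum_bary sK a, affine_eq_sum_bary sK a',
    ← Finset.sum_sub_distrib, Finset.sum_eq_single v]
  · rw [ha v (subset_convexHull ℝ _ hvK), ha' v (subset_convexHull ℝ _ hvK)]
    ring
  · intro y hy hyv
    rw [← ha y (subset_convexHull ℝ _ hy), ← ha' y (subset_convexHull ℝ _ hy),
      ht.boundary K hK y hy hyv, sub_self]
  · exact fun h => absurd hvK h

theorem IsTent.gradient_bot (ht : IsTent T v cmax φbot φtop) (hK : K ∈ T.patch v) {x : E d}
    (hx : x ∈ interior (hull K)) : gradient φbot x = gradient φbot (barycenter K) := by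
  obtain ⟨a, ha⟩ := ht.affine_bot K hK
  rw [gradient_eq_affGrad ha hx, gradient_eq_affGrad ha (barycenter_mem_interior
    (T.isSimplex (SimplicialMesh.mem_patch.1 hK).1))]

theorem IsTent.gradient_height (ht : IsTent T v cmax φbot φtop) (hK : K ∈ T.patch v) {x : E d}
    (hx : x ∈ interior (hull K)) :
    gradient (fun x => φtop x - φbot x) x = (φtop v - φbot v) • affGrad (bary K v) := by
  rw [gradient_eq_affGrad (a := (φtop v - φbot v) • bary K v)
    (fun y hy => by rw [ht.height_eq hK hy]; rfl) hx, affGrad_smul]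

theorem IsTent.gradient_top (ht : IsTent T v cmax φbot φtop) (hK : K ∈ T.patch v) {x : E d}
    (hx : x ∈ interior (hull K)) :
    gradient φtop x = gradient φbot x + (φtop v - φbot v) • affGrad (bary K v) := by
  obtain ⟨a, ha⟩ := ht.affine_bot K hK
  rw [gradient_eq_affGrad (a := a + (φtop v - φbot v) • bary K v) _ hx, affGrad_add, affGrad_smul,
    gradient_eq_affGrad ha hx]
  intro y hy
  have h1 := ht.height_eq hK hy
  have h2 := ha y hy
  change φtop y = a y + (φtop v - φbot v) * bary K v y
  linarith

/-- The gradients of the intermediate fronts are convex combinations of the two extreme ones, so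
causality passes to every $M(t)$. -/
theorem IsTent.norm_gradient_lt (ht : IsTent T v cmax φbot φtop) (hK : K ∈ T.patch v) {t : ℝ}
    (h : t ∈ Icc (0 : ℝ) 1) :
    ‖gradient φbot (barycenter K) + t • ((φtop v - φbot v) • affGrad (bary K v))‖ < 1 / cmax := by
  have hx := barycenter_mem_interior (T.isSimplex (SimplicialMesh.mem_patch.1 hK).1)
  have h1 := ht.causal_bot K hK _ hx
  have h2 := ht.causal_top K hK _ hx
  have h3 := (convex_ball (0 : E d) (1 / cmax)).add_smul_sub_mem (mem_ball_zero_iff.2 h1)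
    (mem_ball_zero_iff.2 h2) h
  rwa [ht.gradient_top hK hx, add_sub_cancel_left, mem_ball_zero_iff] at h3

theorem IsTent.pole_nonneg (ht : IsTent T v cmax φbot φtop) : 0 ≤ φtop v - φbot v :=
  sub_nonneg.2 ht.pole

theorem isBounded_hull (K : Finset (E d)) : Bornology.IsBounded (hull K) :=
  (isBounded_convexHull (s := (K : Set (E d)))).2 K.finite_toSet.isBounded

/-- The height of a tent is bounded by the diameter of each element of the patch. -/
theorem IsTent.pole_le (hd : 1 ≤ d) (ht : IsTent T v cmax φbot φtop) (hK : K ∈ T.patch v) :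
    φtop v - φbot v ≤ 2 / cmax * Metric.diam (hull K) := by
  obtain ⟨hKe, hvK⟩ := SimplicialMesh.mem_patch.1 hK
  have sK := T.isSimplex hKe
  obtain ⟨y, hy, hyv⟩ := exists_mem_ne hd sK v
  have h0 := ht.norm_gradient_lt hK (t := 0) ⟨le_rfl, zero_le_one⟩
  have h1 := ht.norm_gradient_lt hK (t := 1) ⟨zero_le_one, le_rfl⟩
  rw [zero_smul, add_zero] at h0
  rw [one_smul] at h1
  set e := (φtop v - φbot v) • affGrad (bary K v) with he
  have hen : ‖e‖ ≤ 2 / cmax := by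
    have h2 : e = (gradient φbot (barycenter K) + e) - gradient φbot (barycenter K) := by abel
    rw [h2]
    refine (norm_sub_le _ _).trans ?_
    have : 2 / cmax = 1 / cmax + 1 / cmax := by ring
    linarith
  -- The height falls from its pole value to zero along the edge from $v$ to $y$, and its gradient
  -- $e$ is a difference of two causal gradients.
  have h3 : φtop v - φbot v = inner ℝ e (v - y) := by
    rw [he, inner_smul_left, RCLike.conj_to_real, ← affine_sub, bary_self sK hvK,
      bary_of_ne sK hvK hy hyv.symm]
    ring
  rw [h3]
  refine (real_inner_le_norm _ _).trans (mul_le_mul hen ?_ (norm_nonneg _)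
    ((norm_nonneg _).trans hen))
  rw [← dist_eq_norm]
  exact Metric.dist_le_diam_of_mem (isBounded_hull K) (subset_convexHull ℝ _ hvK)
    (subset_convexHull ℝ _ hy)

/-- The weight `∫_F δ` of the facet shared by `K` and `K'`. -/
noncomputable def facetWeight (δ : E d → ℝ) (K K' : Finset (E d)) : ℝ :=
  if (facet K K').card = d then ∫ x in hull (facet K K'), δ x ∂μHE[d - 1] else 0

theorem SharesFacet.apex_ne (h : SharesFacet K K' w w') (hv : v ∈ K') : v ≠ w := by
  rintro rfl; exact h.notMem_right hv

theorem IsTent.facetWeight_eq (ht : IsTent T v cmax φbot φtop) (hK : K ∈ T.patch v)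
    (hK' : K' ∈ T.patch v) (h : SharesFacet K K' w w') :
    facetWeight (fun x => φtop x - φbot x) K K' =
      (φtop v - φbot v) * ((volume (hull K)).toReal * ‖affGrad (bary K w)‖) := by
  obtain ⟨hKe, hvK⟩ := SimplicialMesh.mem_patch.1 hK
  have sK := T.isSimplex hKe
  have hF : ∀ y, y ∈ facet K K' ↔ y ∈ K ∧ y ≠ w := fun y => by rw [mem_facet, h.iff_left]
  rw [facetWeight, if_pos (h.card_facet hKe.2), ← integral_bary_facet sK hvK h.left
    (h.apex_ne (SimplicialMesh.mem_patch.1 hK').2) hF, ← integral_const_mul]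
  exact setIntegral_congr_fun (measurableSet_hull _) fun x hx =>
    ht.height_eq hK ((mem_hull_facet_iff sK h.left hF).1 hx).1

theorem IsTent.facetWeight_nonneg (ht : IsTent T v cmax φbot φtop) (hK : K ∈ T.patch v)
    (hK' : K' ∈ T.patch v) : 0 ≤ facetWeight (fun x => φtop x - φbot x) K K' := by
  by_cases h : (facet K K').card = d
  · obtain ⟨w, w', hs⟩ := exists_sharesFacet (SimplicialMesh.mem_patch.1 hK).1.2
      (SimplicialMesh.mem_patch.1 hK').1.2 h
    rw [ht.facetWeight_eq hK hK' hs]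
    exact mul_nonneg ht.pole_nonneg (by positivity)
  · rw [facetWeight, if_neg h]

theorem facetWeight_comm (δ : E d → ℝ) (K K' : Finset (E d)) :
    facetWeight δ K' K = facetWeight δ K K' := by
  rw [facetWeight, facetWeight, facet_comm]

theorem exists_sharesFacet_of_facetWeight_ne_zero {δ : E d → ℝ} (hK : K.card = d + 1)
    (hK' : K'.card = d + 1) (h : facetWeight δ K K' ≠ 0) : ∃ w w', SharesFacet K K' w w' := by
  refine exists_sharesFacet hK hK' ?_
  by_contra h'
  exact h (if_neg h')

open Classical in
/-- A sum over the neighbours of `K` in the patch of an interior vertex `v` is a sum over the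
vertices of `K` other than `v`. -/
theorem sum_neighbours {M : Type*} [AddCommMonoid M] (hd : 1 ≤ d) (hΩ : IsOpen Ω) (hv : v ∈ Ω)
    (hK : K ∈ T.patch v) {f : T.patch v → M} {g : E d → M}
    (h0 : ∀ K' : T.patch v, (facet K K').card ≠ d → f K' = 0)
    (h : ∀ (K' : T.patch v) w w', SharesFacet K K' w w' → f K' = g w) :
    ∑ K', f K' = ∑ w ∈ K.erase v, g w := by
  obtain ⟨hKe, hvK⟩ := SimplicialMesh.mem_patch.1 hK
  -- Each term is spread over the vertices of $K$ so that the sums can be exchanged. Then each facet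
  -- through $v$ has one neighbour, which exists because $v\in\Omega$ and is unique by
  -- `SharesFacet.unique`.
  have h1 : ∀ K' : T.patch v, f K' =
      ∑ w ∈ K.erase v, if ∃ w', SharesFacet K K' w w' then g w else 0 := by
    intro K'
    have hK' := SimplicialMesh.mem_patch.1 K'.2
    by_cases hc : (facet K K').card = d
    · obtain ⟨w, w', hs⟩ := exists_sharesFacet hKe.2 hK'.1.2 hc
      rw [Finset.sum_eq_single w, if_pos ⟨w', hs⟩, h K' w w' hs]
      · intro y hy hyw
        refine if_neg ?_
        rintro ⟨y', hy'⟩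
        exact hy'.notMem_right (hs.mem_of_ne hy'.left hyw)
      · exact fun hh => absurd (Finset.mem_erase.2 ⟨(hs.apex_ne hK'.2).symm, hs.left⟩) hh
    · rw [h0 K' hc, Finset.sum_eq_zero]
      intro w _
      refine if_neg ?_
      rintro ⟨w', hs⟩
      exact hc (hs.card_facet hKe.2)
  simp only [h1]
  rw [Finset.sum_comm]
  refine Finset.sum_congr rfl fun w hw => ?_
  obtain ⟨hwv, hwK⟩ := Finset.mem_erase.1 hw
  obtain ⟨L, hL, w', hs⟩ := T.exists_neighbour hΩ hv hKe hvK hwK hwv.symm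
  rw [Finset.sum_eq_single ⟨L, hL⟩, if_pos ⟨w', hs⟩]
  · intro K' _ hne
    refine if_neg ?_
    rintro ⟨w'', hs'⟩
    exact hne (Subtype.ext (hs'.unique hd hs hKe (SimplicialMesh.mem_patch.1 K'.2).1
      (SimplicialMesh.mem_patch.1 hL).1))
  · exact fun hh => absurd (Finset.mem_univ _) hh

/-- The discrete divergence theorem for the tent height. -/
theorem IsTent.sum_facetWeight_smul_normal (hd : 1 ≤ d) (hΩ : IsOpen Ω)
    (ht : IsTent T v cmax φbot φtop) (hK : K ∈ T.patch v) :
    ∑ K' : T.patch v, facetWeight (fun x => φtop x - φbot x) K K' • facetNormal K K' =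
      (volume (hull K)).toReal • ((φtop v - φbot v) • affGrad (bary K v)) := by
  classical
  obtain ⟨hKe, hvK⟩ := SimplicialMesh.mem_patch.1 hK
  have sK := T.isSimplex hKe
  rw [sum_neighbours hd hΩ ht.mem hK (g := fun w =>
    -(((φtop v - φbot v) * (volume (hull K)).toReal) • affGrad (bary K w)))]
  -- The factor $\|\nabla\lambda_w\|$ in the weight cancels the normalization of the normal. As all
  -- the gradients $\nabla\lambda_w$ sum to zero, the terms with $w\ne v$ add up to
  -- $\nabla\lambda_v$.
  · have h1 := sum_affGrad_bary sK
    rw [← Finset.add_sum_erase _ _ hvK] at h1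
    rw [Finset.sum_neg_distrib, ← Finset.smul_sum, ← smul_neg, ← eq_neg_of_add_eq_zero_left h1,
      smul_smul, mul_comm]
  · intro K' hc
    rw [facetWeight, if_neg hc, zero_smul]
  · intro K' w w' hs
    have hK' := SimplicialMesh.mem_patch.1 K'.2
    rw [ht.facetWeight_eq hK K'.2 hs, hs.facetNormal_eq hd sK, smul_neg, smul_smul]
    have hn := norm_ne_zero_iff.2
      (affGrad_bary_ne_zero sK hs.left hvK (hs.apex_ne hK'.2).symm)
    congr 2
    field_simp

/-- The step height is at most $ch_K\le c\gamma\rho_K$, the gradients satisfy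
$\|\nabla\lambda_w\|\rho_K\le1$, and $d$ facets of $K$ contain $v$; this is the value $\eta=c\gamma
d$. -/
theorem IsTent.sum_facetWeight_le (hd : 1 ≤ d) (hΩ : IsOpen Ω) {γ c : ℝ} (hγ : 0 ≤ γ)
    (hT : T.ShapeRegular γ) (ht : IsTent T v cmax φbot φtop) (hK : K ∈ T.patch v) (hc : 0 ≤ c)
    {τ : ℝ} (hcfl : τ * (φtop v - φbot v) ≤ c * Metric.diam (hull K)) :
    ∑ K' : T.patch v, τ * facetWeight (fun x => φtop x - φbot x) K K' ≤
      c * γ * d * (volume (hull K)).toReal := by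
  classical
  obtain ⟨hKe, hvK⟩ := SimplicialMesh.mem_patch.1 hK
  have sK := T.isSimplex hKe
  rw [sum_neighbours hd hΩ ht.mem hK (g := fun w =>
    τ * ((φtop v - φbot v) * ((volume (hull K)).toReal * ‖affGrad (bary K w)‖)))]
  · obtain ⟨x, ρ, hρ, hball, hdiam⟩ := hT K hKe
    have hle : ∀ w ∈ K.erase v,
        τ * ((φtop v - φbot v) * ((volume (hull K)).toReal * ‖affGrad (bary K w)‖)) ≤
          c * γ * (volume (hull K)).toReal := by
      intro w hw
      have h1 := norm_affGrad_bary_mul_le sK (Finset.mem_of_mem_erase hw) hball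
      have h2 : τ * (φtop v - φbot v) ≤ c * (γ * ρ) :=
        hcfl.trans (mul_le_mul_of_nonneg_left hdiam hc)
      have h3 : τ * (φtop v - φbot v) * ‖affGrad (bary K w)‖ ≤ c * γ := by
        calc _ ≤ c * (γ * ρ) * ‖affGrad (bary K w)‖ :=
              mul_le_mul_of_nonneg_right h2 (norm_nonneg _)
          _ = c * γ * (‖affGrad (bary K w)‖ * ρ) := by ring
          _ ≤ c * γ * 1 := mul_le_mul_of_nonneg_left h1 (mul_nonneg hc hγ)
          _ = _ := mul_one _
      calc _ = τ * (φtop v - φbot v) * ‖affGrad (bary K w)‖ * (volume (hull K)).toReal := by ring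
        _ ≤ _ := mul_le_mul_of_nonneg_right h3 ENNReal.toReal_nonneg
    refine (Finset.sum_le_card_nsmul _ _ _ hle).trans (le_of_eq ?_)
    rw [Finset.card_erase_of_mem hvK, hKe.2, Nat.add_sub_cancel, nsmul_eq_mul]
    ring
  · intro K' h
    rw [facetWeight, if_neg h, mul_zero]
  · intro K' w w' hs
    rw [ht.facetWeight_eq hK K'.2 hs]

end Tent

/-! ### Representation of the bilinear forms by operators -/

section Forms

variable {d b : ℕ} {Ω : Set (E d)} {T : SimplicialMesh d Ω} {v : E d}

/-- A bilinear form that agrees with `a` on $V_h$ excludes the default value `0` of `formOperator`.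
-/
theorem ip_formOperator {a : Broken T v b → Broken T v b → ℝ}
    (B : DG0 T v b →ₗ[ℝ] DG0 T v b →ₗ[ℝ] ℝ) (hB : ∀ u w, a u.toBroken w.toBroken = B u w)
    (u w : DG0 T v b) : ip (formOperator a u) w = a u.toBroken w.toBroken := by
  have h : ∃ Q : Module.End ℝ (DG0 T v b), ∀ u w, ip (Q u) w = a u.toBroken w.toBroken := by
    obtain ⟨Q, hQ, -⟩ := existsUnique_repr B
    exact ⟨Q, fun u w => by rw [hQ, hB]⟩
  rw [formOperator, dif_pos h]
  exact h.choose_spec u w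

end Forms

section Bilinear

variable {I : Type*} [Fintype I] {b : ℕ}

/-- A weighted block diagonal form, as a bilinear form. -/
noncomputable def blockForm (p : I → ℝ) (P : I → Matrix (Fin b) (Fin b) ℝ) :
    (I → Fin b → ℝ) →ₗ[ℝ] (I → Fin b → ℝ) →ₗ[ℝ] ℝ :=
  LinearMap.mk₂ ℝ (fun u w => ∑ K, p K * ((P K *ᵥ u K) ⬝ᵥ w K))
    (fun u u' w => by
      simp [Matrix.mulVec_add, add_dotProduct, Finset.sum_add_distrib, mul_add])
    (fun c u w => by
      simp only [Pi.smul_apply, Matrix.mulVec_smul, smul_dotProduct, Finset.mul_sum, smul_eq_mul]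
      exact Finset.sum_congr rfl fun K _ => by ring)
    (fun u w w' => by
      simp [dotProduct_add, Finset.sum_add_distrib, mul_add])
    (fun c u w => by
      simp only [Pi.smul_apply, dotProduct_smul, Finset.mul_sum, smul_eq_mul]
      exact Finset.sum_congr rfl fun K _ => by ring)

/-- `edgeForm` as a bilinear form. -/
noncomputable def edgeBilin (θ : I → I → ℝ) (D S : I → I → Matrix (Fin b) (Fin b) ℝ) :
    (I → Fin b → ℝ) →ₗ[ℝ] (I → Fin b → ℝ) →ₗ[ℝ] ℝ :=
  LinearMap.mk₂ ℝ (edgeForm θ D S)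
    (fun u u' w => by
      simp only [edgeForm, ← mul_add, ← Finset.sum_add_distrib]
      refine congrArg _ (Finset.sum_congr rfl fun K _ => Finset.sum_congr rfl fun K' _ => ?_)
      simp only [Pi.add_apply, Matrix.mulVec_add, Matrix.mulVec_sub, Matrix.mulVec_smul,
        sub_dotProduct, add_dotProduct, smul_dotProduct, smul_eq_mul]
      ring)
    (fun c u w => by
      simp only [edgeForm, smul_eq_mul, Finset.mul_sum]
      refine Finset.sum_congr rfl fun K _ => Finset.sum_congr rfl fun K' _ => ?_
      simp only [Pi.smul_apply, Matrix.mulVec_add, Matrix.mulVec_sub, Matrix.mulVec_smul,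
        sub_dotProduct, add_dotProduct, smul_dotProduct, smul_eq_mul]
      ring)
    (fun u w w' => by
      simp only [edgeForm, ← mul_add, ← Finset.sum_add_distrib]
      refine congrArg _ (Finset.sum_congr rfl fun K _ => Finset.sum_congr rfl fun K' _ => ?_)
      simp only [Pi.add_apply, dotProduct_add, dotProduct_sub]
      ring)
    (fun c u w => by
      simp only [edgeForm, smul_eq_mul, Finset.mul_sum]
      refine Finset.sum_congr rfl fun K _ => Finset.sum_congr rfl fun K' _ => ?_
      simp only [Pi.smul_apply, dotProduct_smul, dotProduct_sub, smul_eq_mul]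
      ring)

theorem edgeForm_smul (τ : ℝ) (θ : I → I → ℝ) (D S : I → I → Matrix (Fin b) (Fin b) ℝ)
    (u w : I → Fin b → ℝ) :
    edgeForm (fun K K' => τ * θ K K') D S u w = τ * edgeForm θ D S u w := by
  simp only [edgeForm, Finset.mul_sum]
  exact Finset.sum_congr rfl fun K _ => Finset.sum_congr rfl fun K' _ => by ring

theorem outflowForm_smul (τ : ℝ) (θ : I → I → ℝ) (D : I → I → Matrix (Fin b) (Fin b) ℝ)
    (u w : I → Fin b → ℝ) :
    outflowForm (fun K K' => τ * θ K K') D u w = τ * outflowForm θ D u w := by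
  simp only [outflowForm, Finset.mul_sum]
  exact Finset.sum_congr rfl fun K _ => Finset.sum_congr rfl fun K' _ => by ring

end Bilinear

/-! ### The tent operators as block and facet forms -/

section TentForms

variable {d b : ℕ} {Ω : Set (E d)} {T : SimplicialMesh d Ω} {v : E d} {cmax g₀ B c₀ : ℝ}
  {φbot φtop : E d → ℝ} {G : E d → Matrix (Fin b) (Fin b) ℝ}
  {L : Fin d → E d → Matrix (Fin b) (Fin b) ℝ} {S : Finset (E d) → Matrix (Fin b) (Fin b) ℝ}

theorem IsElementwiseConstant.normalMatrix_eq (hc : IsElementwiseConstant T G L)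
    {K : Finset (E d)} (hK : K ∈ T.elements) {x : E d} (hx : x ∈ interior (hull K)) (ν : E d) :
    normalMatrix L ν x = normalMatrix L ν (barycenter K) := by
  refine Finset.sum_congr rfl fun j _ => ?_
  rw [(hc K hK x hx _ (barycenter_mem_interior (T.isSimplex hK))).2 j]

theorem IsTent.massForm0_eq (ht : IsTent T v cmax φbot φtop) (hc : IsElementwiseConstant T G L)
    (u w : DG0 T v b) : massForm0 G L φbot u.toBroken w.toBroken =
      ∑ K : T.patch v, (volume (hull K.1)).toReal *
        (((G (barycenter K.1) - normalMatrix L (gradient φbot (barycenter K.1)) (barycenter K.1)) *ᵥ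
          u K) ⬝ᵥ w K) := by
  refine Finset.sum_congr rfl fun K _ => setIntegral_hull_of_const _ fun x hx => ?_
  have hKe := (SimplicialMesh.mem_patch.1 K.2).1
  rw [flux_mulVec, ht.gradient_bot K.2 hx, hc.normalMatrix_eq hKe hx,
    (hc K hKe x hx _ (barycenter_mem_interior (T.isSimplex hKe))).1, Matrix.sub_mulVec]
  rfl

theorem IsTent.massForm1_eq (ht : IsTent T v cmax φbot φtop) (hc : IsElementwiseConstant T G L)
    (u w : DG0 T v b) : massForm1 L (fun x => φtop x - φbot x) u.toBroken w.toBroken =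
      ∑ K : T.patch v, (volume (hull K.1)).toReal *
        ((normalMatrix L ((φtop v - φbot v) • affGrad (bary K.1 v)) (barycenter K.1) *ᵥ u K) ⬝ᵥ
          w K) := by
  refine Finset.sum_congr rfl fun K _ => setIntegral_hull_of_const _ fun x hx => ?_
  rw [flux_mulVec, ht.gradient_height K.2 hx,
    hc.normalMatrix_eq (SimplicialMesh.mem_patch.1 K.2).1 hx]
  rfl

theorem dgForm_eq (δ : E d → ℝ) (u w : DG0 T v b) : dgForm L S δ u.toBroken w.toBroken =
    edgeForm (fun K K' : T.patch v => facetWeight δ K.1 K'.1)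
      (fun K K' => normalMatrix L (facetNormal K.1 K'.1) (barycenter K.1))
      (fun K K' => S (facet K.1 K'.1)) u w := by
  have h0 : ∀ K : T.patch v, ∫ x in hull K.1, δ x * ∑ l, ∑ j,
      flux L x (u.toBroken K x) l j *
        fderiv ℝ (fun y => w.toBroken K y l) x (EuclideanSpace.single j 1) = 0 := by
    intro K
    simp [DG0.toBroken]
  rw [dgForm, Finset.sum_eq_zero fun K _ => h0 K, zero_add, edgeForm]
  refine congrArg _ (Finset.sum_congr rfl fun K _ => Finset.sum_congr rfl fun K' _ => ?_)
  rw [facetWeight]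
  split_ifs
  · rw [← integral_mul_const]
    rfl
  · rw [zero_mul]

theorem normalMatrix_sum {J : Type*} (s : Finset J) (c : J → ℝ) (ν : J → E d) (x : E d) :
    normalMatrix L (∑ K ∈ s, c K • ν K) x = ∑ K ∈ s, c K • normalMatrix L (ν K) x := by
  simp only [normalMatrix, Finset.smul_sum]
  rw [Finset.sum_comm]
  refine Finset.sum_congr rfl fun j _ => ?_
  rw [WithLp.ofLp_sum, Finset.sum_apply, Finset.sum_smul]
  exact Finset.sum_congr rfl fun K _ => by simp [smul_smul]

/-- The discrete divergence theorem trades $\nabla\delta$ for facet weights; in this form $M_1$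
combines with the central flux of $A$. -/
theorem IsTent.massForm1_eq_outflowForm (hd : 1 ≤ d) (hΩ : IsOpen Ω)
    (ht : IsTent T v cmax φbot φtop) (hc : IsElementwiseConstant T G L) (u w : DG0 T v b) :
    massForm1 L (fun x => φtop x - φbot x) u.toBroken w.toBroken =
      outflowForm (fun K K' : T.patch v => facetWeight (fun x => φtop x - φbot x) K.1 K'.1)
        (fun K K' => normalMatrix L (facetNormal K.1 K'.1) (barycenter K.1)) u w := by
  rw [ht.massForm1_eq hc, outflowForm]
  refine Finset.sum_congr rfl fun K _ => ?_
  have h1 : (volume (hull K.1)).toReal *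
      ((normalMatrix L ((φtop v - φbot v) • affGrad (bary K.1 v)) (barycenter K.1) *ᵥ u K) ⬝ᵥ
        w K) = (normalMatrix L ((volume (hull K.1)).toReal •
          ((φtop v - φbot v) • affGrad (bary K.1 v))) (barycenter K.1) *ᵥ u K) ⬝ᵥ w K := by
    rw [normalMatrix_smul L (volume (hull K.1)).toReal, Matrix.smul_mulVec, smul_dotProduct,
      smul_eq_mul]
  rw [h1, ← ht.sum_facetWeight_smul_normal hd hΩ K.2, normalMatrix_sum, Matrix.sum_mulVec,
    sum_dotProduct]
  exact Finset.sum_congr rfl fun K' _ => by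
    rw [Matrix.smul_mulVec, smul_dotProduct, smul_eq_mul]

theorem SharesFacet.norm_facetNormal {K K' : Finset (E d)} {w w' : E d} (hd : 1 ≤ d)
    (h : SharesFacet K K' w w') (hK : IsSimplex K) : ‖facetNormal K K'‖ = 1 :=
  ((h.isFacetNormal_iff hd hK).2 (h.facetNormal_eq hd hK)).1

theorem SharesFacet.facet_mem_faces {K K' : Finset (E d)} {w w' : E d} (hd : 1 ≤ d)
    (h : SharesFacet K K' w w') (hK : K ∈ T.elements) : facet K K' ∈ T.faces := by
  refine T.down_closed hK.1 (fun y hy => (mem_facet.1 hy).1) ?_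
  rw [← Finset.card_pos, h.card_facet hK.2]
  omega

/-- Antisymmetry needs $\mathcal D$ to agree from both sides of the facet, which is where the
vanishing divergence enters. In the constant, $d|B|$ bounds the entries of $\mathcal D$, the extra
$|B|$ covers $S$, and $b^2$ passes from entries to forms. -/
theorem IsTent.isFluxData (hd : 1 ≤ d) (hΩ : IsOpen Ω) (ht : IsTent T v cmax φbot φtop)
    (hL : IsSymmetricHyperbolic Ω G L g₀ B c₀) (hc : IsElementwiseConstant T G L) {σ₀ : ℝ}
    (hS : IsStabilization T S σ₀ B) {τ : ℝ} (hτ : 0 ≤ τ) :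
    IsFluxData (fun K K' : T.patch v => τ * facetWeight (fun x => φtop x - φbot x) K.1 K'.1)
      (fun K K' => normalMatrix L (facetNormal K.1 K'.1) (barycenter K.1))
      (fun K K' => S (facet K.1 K'.1)) (b ^ 2 * ((d + 1) * |B|)) σ₀ := by
  have hmem (K : T.patch v) : K.1 ∈ T.elements := (SimplicialMesh.mem_patch.1 K.2).1
  have hshare (K K' : T.patch v)
      (h : τ * facetWeight (fun x => φtop x - φbot x) K.1 K'.1 ≠ 0) :
      ∃ w w', SharesFacet K.1 K'.1 w w' :=
    exists_sharesFacet_of_facetWeight_ne_zero (hmem K).2 (hmem K').2 (right_ne_zero_of_mul h)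
  have hB : 0 ≤ d * |B| := by positivity
  refine ⟨fun K K' => mul_nonneg hτ (ht.facetWeight_nonneg K.2 K'.2),
    fun K K' => by rw [facetWeight_comm], fun K K' _ => ?_, fun K K' h => ?_,
    fun K K' h => ?_, fun K K' h => ?_, fun K K' h => ?_⟩
  · exact isSymm_normalMatrix (fun j => hL.symm_L j _ (barycenter_mem (hmem K))) _
  · obtain ⟨w, w', hs⟩ := hshare K K' h
    rw [normalMatrix_facetNormal_eq hd hΩ hL hc hs (hmem K) (hmem K')
      (SimplicialMesh.mem_patch.1 K.2).2 (hs.apex_ne (SimplicialMesh.mem_patch.1 K'.2).2) ht.mem,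
      hs.facetNormal_swap hd (hmem K) (hmem K'), normalMatrix_neg]
  · obtain ⟨w, w', hs⟩ := hshare K K' h
    refine abs_mulVec_dotProduct_le fun i k => ?_
    have h1 := abs_normalMatrix_le (L := L) (x := barycenter K.1) (fun j i k =>
      (hL.bound_L j _ (barycenter_mem (hmem K)) i k).trans (le_abs_self B))
      (facetNormal K.1 K'.1) i k
    rw [hs.norm_facetNormal hd (T.isSimplex (hmem K)), one_mul] at h1
    linarith [abs_nonneg B]
  · obtain ⟨w, w', hs⟩ := hshare K K' h
    refine abs_mulVec_dotProduct_le fun i k => ?_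
    have h1 := hS.bound _ (hs.facet_mem_faces hd (hmem K)) (hs.card_facet (hmem K).2) i k
    linarith [le_abs_self B]
  · obtain ⟨w, w', hs⟩ := hshare K K' h
    exact hS.posDef _ (hs.facet_mem_faces hd (hmem K)) (hs.card_facet (hmem K).2)

theorem opNorm_satPropagator_le (hd : 1 ≤ d) (hΩ : IsOpen Ω) {γ σ₀ : ℝ} (hγ : 0 ≤ γ)
    (hg₀ : 0 < g₀) (hσ₀ : 0 < σ₀) (hc₀ : 0 ≤ c₀) (hcmax : c₀ < cmax)
    (hT : T.ShapeRegular γ) (hL : IsSymmetricHyperbolic Ω G L g₀ B c₀)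
    (hc : IsElementwiseConstant T G L) (hS : IsStabilization T S σ₀ B)
    (ht : IsTent T v cmax φbot φtop) {s r : ℕ} (hs : 1 ≤ s) (hr : 1 ≤ r) {κ Λ β q c : ℝ}
    (hκ : κ = g₀ * (1 - c₀ / cmax)) (hΛ : Λ = b ^ 2 * (|B| * (1 + d * (1 / cmax))))
    (hβ : β = b ^ 2 * ((d + 1) * |B|)) (hq1 : 1 ≤ q) (hq : 1 + (s : ℝ) ≤ q * κ) (hc' : 0 ≤ c)
    (hε1 : c * γ * d * (4 * β + 5 * β ^ 2 / σ₀) ≤ 1)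
    (hsmall : c * γ * d * (4 * β + 5 * β ^ 2 / σ₀) *
      (2 * (s * q ^ s) + Λ * ((s + Λ / κ) * q ^ s) ^ 2) ≤ 2)
    (hcfl : ∀ K ∈ T.patch v, (φtop v - φbot v) / r ≤ c * Metric.diam (hull K))
    {M₀ M₁ A : Module.End ℝ (DG0 T v b)} (hM₀ : M₀ = formOperator (massForm0 G L φbot))
    (hM₁ : M₁ = formOperator (massForm1 L (fun x => φtop x - φbot x)))
    (hA : A = formOperator (dgForm L S (fun x => φtop x - φbot x))) (u : DG0 T v b) :
    opNorm (M₀ - M₁) (satPropagator r s M₀ M₁ A u) ≤ opNorm M₀ u := by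
  have hcm : 0 < cmax := hc₀.trans_lt hcmax
  have hmem (K : T.patch v) : K.1 ∈ T.elements := (SimplicialMesh.mem_patch.1 K.2).1
  set p : T.patch v → ℝ := fun K => (volume (hull K.1)).toReal with hp
  set P : T.patch v → Matrix (Fin b) (Fin b) ℝ := fun K => G (barycenter K.1) -
    normalMatrix L (gradient φbot (barycenter K.1)) (barycenter K.1) with hP
  set N : T.patch v → Matrix (Fin b) (Fin b) ℝ := fun K =>
    normalMatrix L ((φtop v - φbot v) • affGrad (bary K.1 v)) (barycenter K.1) with hN
  have h0 : ∀ u w : DG0 T v b, ∑ K, p K * (M₀ u K ⬝ᵥ w K) =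
      ∑ K, p K * ((P K *ᵥ u K) ⬝ᵥ w K) := fun u w => by
    rw [← ht.massForm0_eq hc u w, hM₀, ← ip_formOperator (blockForm p P) (ht.massForm0_eq hc),
      ip_eq]
  have h1 : ∀ u w : DG0 T v b, ip (M₁ u) w =
      massForm1 L (fun x => φtop x - φbot x) u.toBroken w.toBroken := fun u w => by
    rw [hM₁, ip_formOperator (blockForm p N) (ht.massForm1_eq hc)]
  have h2 : ∀ u w : DG0 T v b, ip (A u) w =
      dgForm L S (fun x => φtop x - φbot x) u.toBroken w.toBroken := fun u w => by
    rw [hA, ip_formOperator (edgeBilin _ _ _) (dgForm_eq _)]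
  -- This is the mass matrix of the intermediate front at pseudo-time $t$, to which causality
  -- applies.
  have hPN (t : ℝ) (K : T.patch v) : P K - t • N K = G (barycenter K.1) -
      normalMatrix L (gradient φbot (barycenter K.1) +
        t • ((φtop v - φbot v) • affGrad (bary K.1 v))) (barycenter K.1) := by
    rw [normalMatrix_add, normalMatrix_smul L t]
    simp only [hP, hN]
    abel
  have hκ0 : 0 < κ := by
    rw [hκ]
    exact mul_pos hg₀ (sub_pos.2 ((div_lt_one hcm).2 hcmax))
  have key := satPropagator_weighted_energy_le (p := p) (fun K => volume_pos T K) hs hr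
    (M₀ := M₀) (M₁ := M₁) (A := A) (P := P) (N := N) (β := β) (σ := σ₀) (κ := κ) (Λ := Λ)
    (q := q) (η := c * γ * d) u hκ0 (by rw [hΛ]; positivity) (by rw [hβ]; positivity) hσ₀
    (by positivity) hq1 hq hε1 hsmall
    (by rw [hβ]; exact ht.isFluxData hd hΩ hL hc hS (τ := 1 / (r : ℝ)) (by positivity))
    (fun K => ?_) (fun K => ?_) (fun K => ?_) (fun t htt K x => ?_) (fun t htt K x y => ?_)
    h0 (fun u w => ?_) (fun u w => ?_) (fun u w => ?_)
  · rw [opNorm, opNorm, ip_eq, ip_eq]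
    exact Real.sqrt_le_sqrt key
  · refine ht.sum_facetWeight_le hd hΩ hγ hT K.2 hc' ?_
    rw [one_div_mul_eq_div]
    exact hcfl K K.2
  · have h3 := isSymm_normalMatrix (fun j => hL.symm_L j _ (barycenter_mem (hmem K)))
      (gradient φbot (barycenter K.1))
    exact (hL.symm_G _ (barycenter_mem (hmem K))).sub h3
  · exact isSymm_normalMatrix (fun j => hL.symm_L j _ (barycenter_mem (hmem K))) _
  · rw [hPN, hκ]
    exact hL.coercive hg₀ hc₀ hcmax (barycenter_mem (hmem K)) (ht.norm_gradient_lt K.2 htt) x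
  · rw [hPN, hΛ]
    exact abs_mulVec_dotProduct_le
      (hL.bound (barycenter_mem (hmem K)) (ht.norm_gradient_lt K.2 htt).le) x y
  · rw [← ip_eq, h1, ht.massForm1_eq hc]
  · rw [← ip_eq, h1, ht.massForm1_eq_outflowForm hd hΩ hc, outflowForm_smul]
  · rw [← ip_eq, h2, dgForm_eq, edgeForm_smul]

end TentForms

end TentDG

/-! ### Choice of the constants and conclusion -/

theorem mainTheorem4 (d b s : ℕ) (hd : 1 ≤ d) (hs : 1 ≤ s) (γ g₀ B σ₀ c₀ cmax : ℝ)
    (hγ : 0 < γ) (hg₀ : 0 < g₀) (hσ₀ : 0 < σ₀) (hc₀ : 0 ≤ c₀) (hcmax : c₀ < cmax) :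
    ∃ τ₀ : ℝ, 0 < τ₀ ∧ ∃ C : ℝ, 0 < C ∧
      ∀ (Ω : Set (TentDG.E d)) (T : TentDG.SimplicialMesh d Ω)
        (G : TentDG.E d → Matrix (Fin b) (Fin b) ℝ)
        (L : Fin d → TentDG.E d → Matrix (Fin b) (Fin b) ℝ)
        (S : Finset (TentDG.E d) → Matrix (Fin b) (Fin b) ℝ)
        (v : TentDG.E d) (φbot φtop : TentDG.E d → ℝ),
        IsOpen Ω → T.ShapeRegular γ →
        TentDG.IsSymmetricHyperbolic Ω G L g₀ B c₀ →
        TentDG.IsElementwiseConstant T G L →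
        TentDG.IsStabilization T S σ₀ B →
        TentDG.IsTent T v cmax φbot φtop →
        ∀ (M₀ M₁ A : Module.End ℝ (TentDG.DG0 T v b)),
          M₀ = TentDG.formOperator (TentDG.massForm0 G L φbot) →
          M₁ = TentDG.formOperator (TentDG.massForm1 L (fun x => φtop x - φbot x)) →
          A = TentDG.formOperator (TentDG.dgForm L S (fun x => φtop x - φbot x)) →
          ∀ r : ℕ, 1 ≤ r →
            (1 / (r : ℝ) ≤ τ₀ → ∀ u : TentDG.DG0 T v b,
              TentDG.opNorm (M₀ - M₁) (TentDG.satPropagator r s M₀ M₁ A u) ≤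
                TentDG.opNorm M₀ u) ∧
            ((∀ K ∈ T.patch v, ∀ K' ∈ T.patch v, ∀ x ∈ TentDG.hull K',
                (φtop x - φbot x) / r ≤ C * Metric.diam (TentDG.hull K)) →
              ∀ u : TentDG.DG0 T v b,
                TentDG.opNorm (M₀ - M₁) (TentDG.satPropagator r s M₀ M₁ A u) ≤
                  TentDG.opNorm M₀ u) := by
  have hcm : 0 < cmax := hc₀.trans_lt hcmax
  obtain ⟨κ, hκ⟩ : ∃ κ, κ = g₀ * (1 - c₀ / cmax) := ⟨_, rfl⟩
  obtain ⟨Λ, hΛ⟩ : ∃ Λ, Λ = b ^ 2 * (|B| * (1 + d * (1 / cmax))) := ⟨_, rfl⟩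
  obtain ⟨β, hβ⟩ : ∃ β, β = b ^ 2 * ((d + 1) * |B|) := ⟨_, rfl⟩
  have hκ0 : 0 < κ := by
    rw [hκ]
    exact mul_pos hg₀ (sub_pos.2 ((div_lt_one hcm).2 hcmax))
  have hΛ0 : 0 ≤ Λ := by rw [hΛ]; positivity
  have hβ0 : 0 ≤ β := by rw [hβ]; positivity
  obtain ⟨q, hq1, hq⟩ : ∃ q : ℝ, 1 ≤ q ∧ 1 + (s : ℝ) ≤ q * κ :=
    ⟨max 1 ((1 + s) / κ), le_max_left _ _, by
      rw [← div_le_iff₀ hκ0]; exact le_max_right _ _⟩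
  have hd0 : (0 : ℝ) < d := by exact_mod_cast hd
  obtain ⟨Z, hZ⟩ : ∃ Z, Z = 4 * β + 5 * β ^ 2 / σ₀ := ⟨_, rfl⟩
  obtain ⟨Y, hY⟩ : ∃ Y, Y = 2 * (s * q ^ s) + Λ * ((s + Λ / κ) * q ^ s) ^ 2 := ⟨_, rfl⟩
  have hZ0 : 0 ≤ Z := by rw [hZ]; positivity
  have hY0 : 0 ≤ Y := by rw [hY]; positivity
  -- This makes $\eta=C\gamma d=1/((Z+1)(Y+1))$, so that $\eta Z\le1$ and $\eta ZY\le2$ hold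
  -- together; the added ones keep the denominator positive even if $Z=0$.
  obtain ⟨C, hC⟩ : ∃ C, C = 1 / ((Z + 1) * (Y + 1) * (γ * d)) := ⟨_, rfl⟩
  have hC0 : 0 < C := by rw [hC]; positivity
  have hη : C * γ * d = 1 / ((Z + 1) * (Y + 1)) := by
    rw [hC]; field_simp
  have hε1 : C * γ * d * Z ≤ 1 := by
    rw [hη, one_div_mul_eq_div, div_le_one (by positivity)]
    nlinarith [mul_nonneg hZ0 hY0]
  have hsmall : C * γ * d * Z * Y ≤ 2 := by
    rw [hη, one_div_mul_eq_div, div_mul_eq_mul_div, div_le_iff₀ (by positivity)]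
    nlinarith [mul_nonneg hZ0 hY0]
  rw [hZ] at hε1 hsmall
  rw [hY] at hsmall
  -- With $\tau_0=Cc_{\max}/2$ the bound $2h_K/c_{\max}$ on the pole height becomes the CFL bound
  -- $Ch_K$.
  refine ⟨C * (cmax / 2), by positivity, C, hC0, ?_⟩
  intro Ω T G L S v φbot φtop hΩ hT hL hc hS ht M₀ M₁ A hM₀ hM₁ hA r hr
  have main : (∀ K ∈ T.patch v, (φtop v - φbot v) / r ≤ C * Metric.diam (TentDG.hull K)) →
      ∀ u : TentDG.DG0 T v b, TentDG.opNorm (M₀ - M₁) (TentDG.satPropagator r s M₀ M₁ A u) ≤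
        TentDG.opNorm M₀ u := fun hcfl u =>
    TentDG.opNorm_satPropagator_le hd hΩ hγ.le hg₀ hσ₀ hc₀ hcmax hT hL hc hS ht hs hr hκ hΛ hβ hq1
      hq hC0.le hε1 hsmall hcfl hM₀ hM₁ hA u
  refine ⟨fun hτ => main fun K hK => ?_, fun hcfl => main fun K hK => ?_⟩
  · have h1 := ht.pole_le hd hK
    calc (φtop v - φbot v) / r = 1 / (r : ℝ) * (φtop v - φbot v) := by ring
      _ ≤ C * (cmax / 2) * (2 / cmax * Metric.diam (TentDG.hull K)) :=
          mul_le_mul hτ h1 ht.pole_nonneg (by positivity)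
      _ = C * Metric.diam (TentDG.hull K) := by field_simp
  -- Only the value of the height at the vertex $v$ is needed.
  · exact hcfl K hK K hK v
      (subset_convexHull ℝ _ (TentDG.SimplicialMesh.mem_patch.1 hK).2)
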